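/- **Setting.** Let $S$ be a countable set, $P=(P_{ik})_{i,k\in S}$ a stochastic matrix with $P_{ii}=0$ for all $i$, $(p_i)_{i\in S}$ a probability distribution on $S$, and $F_{ik}$ $(i,k\in S)$ probability distributions on $[0,\infty)$. Let $(J_n,T_n)_{n\ge 0}$ be a time-homogeneous Markov chain on $S\times[0,\infty)$ with $P[J_0=i,T_0=0]=p_i$ and $$P[J_{n+1}=k,\,T_{n+1}\le u\mid J_n=i,\,T_n=s]=P_{ik}F_{ik}(u),$$ which does not depend on $s$. Assume that the chain with transition matrix $P$ is irreducible, aperiodic and positive recurrent; that $F_{ik}$ has no atoms whenever $P_{ik}>0$; and that $\sup\{m_{ik}:P_{ik}>0\}<\infty$, where $m_{ik}=\int_0^\infty(1-F_{ik}(y))\,dy$. Put $m_i=\sum_k P_{ik}m_{ik}$. Let $S_n=T_0+\dots+T_n$, $N_t=\sup\{n:S_n\le t\}$, assume $N_t<\infty$ almost surely for every $t\ge 0$, and let $Y_t=J_{N_t}$ $(t\ge0)$. Fix $j\in S$. Let $0\le N^j_0<N^j_1<\cdots$ be the successive indices $n$ with $J_n=j$, let $\tau^j_k=S_{N^j_k}$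 and $g^j_t=\max(\sup\{n:\tau^j_n\le t\},0)$, where $\sup\emptyset=-\infty$. Let $\mathcal F^Y_t$ be the completion of $\sigma(Y_s:s\le t)$, let $\mathcal F^Y_{\tau^j_n}$ be the $\sigma$-field generated by the events $E$ such that $E\cap\{\tau^j_n\le t\}\in\mathcal F^Y_t$ for all $t\ge 0$, and let $\mathcal F^Y_{\tau^j_{g^j_t}}$ be the $\sigma$-field generated by the events $A$ such that for every $n$ there is $E\in\mathcal F^Y_{\tau^j_n}$ with $A\cap\{g^j_t=n\}=E\cap\{g^j_t=n\}$. **Lemma.** Let $(H_t)_{t\ge0}$ be an $\mathbb R^d$-valued process such that $H_t$ is $\mathcal F^Y_{\tau^j_{g^j_t}}$-measurable for every $t\ge0$. Suppose there are an $\mathbb R^d$-valued random variable $H_\infty$ and a non-decreasing deterministic function $\epsilon:[0,\infty)\to[0,\infty)$ such that, as $t\to\infty$, $$H_t\xrightarrow{d}H_\infty,\qquad \epsilon(t)\to\infty,\qquad \frac{\epsilon(t)}{t}\to0,\qquad H_t-H_{t-\epsilon(t)}\xrightarrow{P}0 .$$ (Where $\epsilon(t)>t$, read $t-\epsilon(t)$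 as $0$; this does not occur for large $t$.) Let $(L^{(1)}_t)_{t\ge0}$ and $(L^{(2)}_t)_{t\ge0}$ be arbitrary processes, defined on the same probability space, with values in $\mathbb R^d$ and in $\mathbb R^{d\times d}$ respectively, such that $(L^{(1)}_t,L^{(2)}_t)\xrightarrow{P}(\mathbf 0_d,I_d)$ as $t\to\infty$, where $I_d$ is the identity matrix. Then, conditionally on $\{Y_t=j\}$, $L^{(1)}_t+L^{(2)}_tH_t$ and the backward residual time $t-\tau^j_{g^j_t}$ are asymptotically independent: for every Borel set $A\subseteq\mathbb R^d$ with $P[H_\infty\in\partial A]=0$ and every $x\ge0$, $$\lim_{t\to\infty}P\Big[L^{(1)}_t+L^{(2)}_tH_t\in A,\ t-\tau^j_{g^j_t}>x\ \Big|\ Y_t=j\Big]=P[H_\infty\in A]\;\frac{\sum_{k\in S}P_{jk}\int_x^\infty(1-F_{jk}(y))\,dy}{m_j}.$$ (The last factor is $\pi^*_j(x,\infty)$, where $\pi^*_j$ is the limiting law of the residual time.) -/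

import Mathlib

open MeasureTheory ProbabilityTheory Filter Set
open scoped NNReal ENNReal Topology

namespace SemiMarkov

/-- The data of a semi-Markov process on `S`: the transition matrix `P` of the embedded chain
(`P i k = trans i k`), the sojourn time laws `F i k` on `[0, ∞)` (sojourn in `i` when the next
state is `k`), and the initial distribution. -/
structure Params (S : Type*) where
  trans : S → PMF S
  sojourn : S → S → ProbabilityMeasure ℝ≥0
  init : PMF S

variable {S : Type*}

/-- `n`-step transition probabilities of the embedded chain. -/
noncomputable def nStep (P : S → PMF S) (i : S) : ℕ → PMF S
  | 0 => PMF.pure i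
  | n + 1 => (nStep P i n).bind P

/-- Every state can be reached from every state. -/
def Irreducible (P : S → PMF S) : Prop :=
  ∀ i k, ∃ n, nStep P i n k ≠ 0

/-- For every state `i`, the gcd of `{n | P^n(i, i) > 0}` is `1`. -/
def Aperiodic (P : S → PMF S) : Prop :=
  ∀ i, ∀ d : ℕ, (∀ n, nStep P i n i ≠ 0 → d ∣ n) → d = 1

open Classical in
/-- `avoid P i n k` is the probability that the chain started at `i` is at `k` at time `n`
and has not returned to `i` at any of the times `1, …, n`. -/
noncomputable def avoid (P : S → PMF S) (i : S) : ℕ → S → ℝ≥0∞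
  | 0, k => if k = i then 1 else 0
  | n + 1, k => if k = i then 0 else ∑' l, avoid P i n l * P l k

/-- The expected return time to `i`, as the sum over `n ≥ 0` of the probability that the chain
started at `i` has not returned by time `n`. -/
noncomputable def expectedReturnTime (P : S → PMF S) (i : S) : ℝ≥0∞ :=
  ∑' n, ∑' k, avoid P i n k

/-- Positive recurrence: all expected return times are finite. -/
def PositiveRecurrent (P : S → PMF S) : Prop :=
  ∀ i, expectedReturnTime P i < ∞

namespace Params

variable (D : Params S)

/-- `∫_x^∞ (1 - F_{ik}(y)) dy`, where `1 - F_{ik}(y)` is the mass of `(y, ∞)`. -/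
noncomputable def tailIntegral (i k : S) (x : ℝ≥0) : ℝ≥0∞ :=
  ∫⁻ y in Ioi (x : ℝ), (D.sojourn i k : Measure ℝ≥0) {s | y < (s : ℝ)}

/-- `m_{ik}`, the mean of `F_{ik}`. -/
noncomputable def meanSojournTo (i k : S) : ℝ≥0∞ := D.tailIntegral i k 0

/-- `m_i = ∑_k P_{ik} m_{ik}`, the mean sojourn time in `i`. -/
noncomputable def meanSojourn (i : S) : ℝ≥0∞ := ∑' k, D.trans i k * D.meanSojournTo i k

/-- The tail `x ↦ π*_j (x, ∞) = (∑_k P_{jk} ∫_x^∞ (1 - F_{jk}(y)) dy) / m_j`. -/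
noncomputable def residualTail (j : S) (x : ℝ≥0) : ℝ≥0∞ :=
  (∑' k, D.trans j k * D.tailIntegral j k x) / D.meanSojourn j

/-- The standing assumptions on the parameters. The sojourn laws matter only along the possible
transitions `P_{ik} > 0`. -/
structure Admissible : Prop where
  trans_self : ∀ i, D.trans i i = 0
  irreducible : Irreducible D.trans
  aperiodic : Aperiodic D.trans
  positiveRecurrent : PositiveRecurrent D.trans
  noAtoms : ∀ i k, D.trans i k ≠ 0 → ∀ s : ℝ≥0, (D.sojourn i k : Measure ℝ≥0) {s} = 0
  meanSojournTo_bdd : (⨆ (i : S) (k : S) (_ : D.trans i k ≠ 0), D.meanSojournTo i k) < ∞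

end Params

variable {Ω : Type*}

/-- `S_n = T_0 + ⋯ + T_n`, the time of the `n`-th jump. -/
noncomputable def jumpTime (T : ℕ → Ω → ℝ≥0) (n : ℕ) (ω : Ω) : ℝ≥0 :=
  ∑ i ∈ Finset.range (n + 1), T i ω

/-- `N_t = sup {n | S_n ≤ t}`. -/
noncomputable def jumpCount (T : ℕ → Ω → ℝ≥0) (t : ℝ≥0) (ω : Ω) : ℕ :=
  sSup {n | jumpTime T n ω ≤ t}

/-- The semi-Markov process `Y_t = J_{N_t}`. -/
noncomputable def proc (J : ℕ → Ω → S) (T : ℕ → Ω → ℝ≥0) (t : ℝ≥0) (ω : Ω) : S :=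
  J (jumpCount T t ω) ω

/-- `N^j_k`, the index of the `k`-th visit (`k = 0, 1, …`) of `J` to `j`; `⊤` if there is
no such visit. -/
noncomputable def visitIndex (J : ℕ → Ω → S) (j : S) : ℕ → Ω → ℕ∞
  | 0, ω => ⨅ (m : ℕ) (_ : J m ω = j), (m : ℕ∞)
  | k + 1, ω => ⨅ (m : ℕ) (_ : visitIndex J j k ω < m ∧ J m ω = j), (m : ℕ∞)

open Classical in
/-- `τ^j_k`, the time of the `k`-th entry (`k = 0, 1, …`) into `j`; `⊤` if there is none. -/
noncomputable def hitTime (J : ℕ → Ω → S) (T : ℕ → Ω → ℝ≥0) (j : S) (k : ℕ) (ω : Ω) : ℝ≥0∞ :=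
  if visitIndex J j k ω = ⊤ then ⊤ else (jumpTime T (visitIndex J j k ω).toNat ω : ℝ≥0∞)

/-- `g^j_t = max (sup {n | τ^j_n ≤ t}) 0`. -/
noncomputable def lastVisit (J : ℕ → Ω → S) (T : ℕ → Ω → ℝ≥0) (j : S) (t : ℝ≥0) (ω : Ω) : ℕ :=
  sSup {n | hitTime J T j n ω ≤ t}

/-- The backward residual time `t - τ^j_{g^j_t}`. The subtraction in `[0, ∞]` truncates, which
only concerns outcomes with `τ^j_0 > t`, that is, no visit to `j` by time `t`. -/
noncomputable def backwardResidual (J : ℕ → Ω → S) (T : ℕ → Ω → ℝ≥0) (j : S) (t : ℝ≥0)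
    (ω : Ω) : ℝ≥0∞ :=
  (t : ℝ≥0∞) - hitTime J T j (lastVisit J T j t ω) ω

variable [MeasurableSpace S] [MeasurableSpace Ω]

/-- The σ-field generated by `J_0, T_0, …, J_n, T_n`. -/
@[reducible] noncomputable def past (J : ℕ → Ω → S) (T : ℕ → Ω → ℝ≥0) (n : ℕ) : MeasurableSpace Ω :=
  ⨆ (m : ℕ) (_ : m ≤ n),
    MeasurableSpace.comap (J m) inferInstance ⊔ MeasurableSpace.comap (T m) inferInstance

/-- `(J, T)` is the time-homogeneous Markov chain on `S × [0, ∞)` with transition kernel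
`Q_{ik}(u) = P_{ik} F_{ik}(u)`, which does not depend on the current value of `T`, started from
`P[J_0 = i, T_0 = 0] = p_i`, and almost surely only finitely many jumps occur in finite time. -/
structure IsChain (D : Params S) (μ : Measure Ω) (J : ℕ → Ω → S) (T : ℕ → Ω → ℝ≥0) : Prop where
  measurable_J : ∀ n, Measurable (J n)
  measurable_T : ∀ n, Measurable (T n)
  init : ∀ i, μ {ω | J 0 ω = i ∧ T 0 ω = 0} = D.init i
  markov : ∀ (n : ℕ) (i k : S) (u : ℝ≥0) (E : Set Ω), MeasurableSet[past J T n] E →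
    μ (E ∩ {ω | J n ω = i} ∩ {ω | J (n + 1) ω = k ∧ T (n + 1) ω ≤ u}) =
      μ (E ∩ {ω | J n ω = i}) * (D.trans i k * (D.sojourn i k : Measure ℝ≥0) (Iic u))
  conservative : ∀ t : ℝ≥0, ∀ᵐ ω ∂μ, {n | jumpTime T n ω ≤ t}.Finite

/-- `F^Y_t`: the σ-field generated by `Y_s`, `s ≤ t`, completed by the `μ`-null sets. (The entry
times into `j` are stopping times of the raw filtration only up to null sets, because the paths of
`Y` are regular only almost surely.) -/
@[reducible] noncomputable def historyUpTo (μ : Measure Ω) (J : ℕ → Ω → S) (T : ℕ → Ω → ℝ≥0) (t : ℝ≥0) :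
    MeasurableSpace Ω :=
  eventuallyMeasurableSpace
    (⨆ (s : ℝ≥0) (_ : s ≤ t), MeasurableSpace.comap (proc J T s) inferInstance) (ae μ)

/-- `F^Y_τ` for `τ = τ^j_n`: the events `E` with `E ∩ {τ ≤ t} ∈ F^Y_t` for all `t`. -/
@[reducible] noncomputable def stoppedHistory (μ : Measure Ω) (J : ℕ → Ω → S) (T : ℕ → Ω → ℝ≥0) (j : S) (n : ℕ) :
    MeasurableSpace Ω :=
  MeasurableSpace.generateFrom
    {E | ∀ t : ℝ≥0, MeasurableSet[historyUpTo μ J T t] (E ∩ {ω | hitTime J T j n ω ≤ t})}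

/-- The σ-field of the history up to the last entry time `τ^j_{g^j_t}` into `j` before `t`:
the events that agree on `{g^j_t = n}` with an event of `F^Y_{τ^j_n}`, for every `n`. -/
@[reducible] noncomputable def lastVisitHistory (μ : Measure Ω) (J : ℕ → Ω → S) (T : ℕ → Ω → ℝ≥0) (j : S) (t : ℝ≥0) :
    MeasurableSpace Ω :=
  MeasurableSpace.generateFrom
    {A | ∀ n : ℕ, ∃ E, MeasurableSet[stoppedHistory μ J T j n] E ∧
      A ∩ {ω | lastVisit J T j t ω = n} = E ∩ {ω | lastVisit J T j t ω = n}}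

end SemiMarkov

/-! Put s(t) = t - ε(t) and X_t = L¹_t + L²_t H_t. Slutsky's argument and the hypothesis on
increments of H give X_t - H_{s(t)} → 0 in probability, so it is enough to decouple H_{s(t)} from
the event Φ_B(t) that at time t the process is in `j` with age in B (B = (x,∞) for the numerator, B
= [0,∞) for the conditioning event).

The decoupling is regeneration. Apart from a negligible event, H_s is determined by what is known
before any entry into `j` later than s (`lastVisitHistory_inter`, in terms of the σ-field
`strictPast`). Since t - s(t) → ∞ and the forward recurrence times are tight, an entry into `j`
falls in (s(t), t - K] with probability tending to 1 for every fixed K. At the first such entry the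
chain starts afresh, and if u ≥ K is the time left, the probability of Φ_B(t) is the renewal
potential ∫ 1_B(u - y) P_j[sojourn > u - y] U(dy), where U is the renewal measure of the visits to
`j`. It is close to its limit q_B when K is large. Hence P[E ∩ Φ_B(t)] - q_B P[E] → 0 uniformly over
the events E of `strictPast` at s(t) (`eventually_ageEvent_mixing`). The portmanteau theorem then
gives P[X_t ∈ A, Φ_B(t)] → P[H_∞ ∈ A] q_B, and in the ratio for the two choices of B the mean return
time cancels.

The limit q_B is the key renewal theorem (`IsRenewal.tendsto_pot`) for the law f of the return time.
That law is atomless because the possible sojourn laws are, and its mean is finite by positive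
recurrence and the bounded mean sojourns. For a smoothed integrand z the potential Z = U ∗ z is
bounded, uniformly continuous, and Z - f ∗ Z = z → 0. An L² argument (`tendsto_sub_of_harmonic`)
shows that such a Z varies slowly; the identity U ∗ (tail of f) = 1 on [0,∞) then identifies its
limit. Monotonicity of the integrand removes the smoothing. -/

set_option linter.unusedSectionVars false

/-! ### Asymptotically harmonic functions of an atomless law -/

namespace Renewal

/-- Bounded measurable real functions. -/
structure BddMeas (g : ℝ → ℝ) : Prop where
  meas : Measurable g
  bdd : ∃ M, ∀ t, |g t| ≤ M

namespace BddMeas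

variable {g h : ℝ → ℝ}

lemma add (hg : BddMeas g) (hh : BddMeas h) : BddMeas (fun t => g t + h t) := by
  obtain ⟨M, hM⟩ := hg.bdd
  obtain ⟨N, hN⟩ := hh.bdd
  exact ⟨hg.meas.add hh.meas, M + N, fun t => (abs_add_le _ _).trans (add_le_add (hM t) (hN t))⟩

lemma mul (hg : BddMeas g) (hh : BddMeas h) : BddMeas (fun t => g t * h t) := by
  obtain ⟨M, hM⟩ := hg.bdd
  obtain ⟨N, hN⟩ := hh.bdd
  refine ⟨hg.meas.mul hh.meas, M * N, fun t => ?_⟩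
  rw [abs_mul]
  exact mul_le_mul (hM t) (hN t) (abs_nonneg _) ((abs_nonneg _).trans (hM t))

lemma const (c : ℝ) : BddMeas (fun _ => c) := ⟨measurable_const, |c|, fun _ => le_rfl⟩

lemma sub (hg : BddMeas g) (hh : BddMeas h) : BddMeas (fun t => g t - h t) := by
  simpa [sub_eq_add_neg] using hg.add ((const (-1)).mul hh)

lemma abs (hg : BddMeas g) : BddMeas (fun t => |g t|) := by
  obtain ⟨M, hM⟩ := hg.bdd
  exact ⟨hg.meas.abs, M, fun t => by simpa using hM t⟩

lemma comp_sub_left (hg : BddMeas g) (t : ℝ) : BddMeas (fun y => g (t - y)) := by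
  obtain ⟨M, hM⟩ := hg.bdd
  exact ⟨hg.meas.comp (measurable_const.sub measurable_id), M, fun y => hM _⟩

lemma comp_sub_right (hg : BddMeas g) (y : ℝ) : BddMeas (fun t => g (t - y)) := by
  obtain ⟨M, hM⟩ := hg.bdd
  exact ⟨hg.meas.comp (measurable_id.sub measurable_const), M, fun y => hM _⟩

lemma integrable (hg : BddMeas g) (f : Measure ℝ) [IsFiniteMeasure f] : Integrable g f := by
  obtain ⟨M, hM⟩ := hg.bdd
  exact Integrable.of_bound hg.meas.aestronglyMeasurable M (ae_of_all _ hM)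

end BddMeas

/-- The averaging operator `g ↦ E[g(t - ξ)]`, where `ξ` has law `f`. -/
noncomputable def avg (f : Measure ℝ) (g : ℝ → ℝ) (t : ℝ) : ℝ := ∫ y, g (t - y) ∂f

section Avg

variable (f : Measure ℝ) [IsProbabilityMeasure f] {g h : ℝ → ℝ}

lemma avg_le {M : ℝ} (hg : BddMeas g) (hM : ∀ t, g t ≤ M) (t : ℝ) : avg f g t ≤ M := by
  have := integral_mono (μ := f) ((hg.comp_sub_left t).integrable f) (integrable_const M)
    (fun y => hM (t - y))
  simpa [avg] using this

lemma BddMeas.avg (hg : BddMeas g) : BddMeas (avg f g) := by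
  obtain ⟨M, hM⟩ := hg.bdd
  refine ⟨?_, M, fun t => ?_⟩
  · have : StronglyMeasurable (fun p : ℝ × ℝ => g (p.1 - p.2)) :=
      (hg.meas.comp (measurable_fst.sub measurable_snd)).stronglyMeasurable
    exact this.integral_prod_right'.measurable
  · have := norm_integral_le_of_norm_le_const (μ := f) (f := fun y => g (t - y)) (C := M)
      (ae_of_all f fun y => hM (t - y))
    simpa [Renewal.avg] using this

lemma avg_mono (hg : BddMeas g) (hh : BddMeas h) (hgh : ∀ t, g t ≤ h t) (t : ℝ) :
    avg f g t ≤ avg f h t :=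
  integral_mono ((hg.comp_sub_left t).integrable f) ((hh.comp_sub_left t).integrable f)
    (fun y => hgh (t - y))

lemma avg_add (hg : BddMeas g) (hh : BddMeas h) (t : ℝ) :
    avg f (fun t => g t + h t) t = avg f g t + avg f h t :=
  integral_add ((hg.comp_sub_left t).integrable f) ((hh.comp_sub_left t).integrable f)

lemma avg_sub (hg : BddMeas g) (hh : BddMeas h) (t : ℝ) :
    avg f (fun t => g t - h t) t = avg f g t - avg f h t :=
  integral_sub ((hg.comp_sub_left t).integrable f) ((hh.comp_sub_left t).integrable f)

omit [IsProbabilityMeasure f] in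
lemma avg_const_mul (c t : ℝ) : avg f (fun t => c * g t) t = c * avg f g t :=
  integral_const_mul _ _

lemma tendsto_avg_zero (hg : BddMeas g) (h0 : Tendsto g atTop (𝓝 0)) :
    Tendsto (avg f g) atTop (𝓝 0) := by
  obtain ⟨M, hM⟩ := hg.bdd
  have := tendsto_integral_filter_of_dominated_convergence (μ := f) (l := atTop)
    (F := fun t y => g (t - y)) (f := fun _ => (0 : ℝ)) (fun _ => M)
    (Eventually.of_forall fun t => (hg.comp_sub_left t).meas.aestronglyMeasurable)
    (Eventually.of_forall fun t => ae_of_all _ fun y => hM _) (integrable_const M)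
    (ae_of_all _ fun y => h0.comp (tendsto_atTop_add_const_right _ (-y) tendsto_id))
  rw [integral_zero] at this
  exact this

/-- Nonnegativity of the variance. -/
lemma sq_integral_le (hg : BddMeas g) : (∫ y, g y ∂f) ^ 2 ≤ ∫ y, g y ^ 2 ∂f := by
  set c := ∫ y, g y ∂f with hc
  have h1 : 0 ≤ ∫ y, (g y - c) ^ 2 ∂f := integral_nonneg fun y => sq_nonneg _
  have h2 : ∫ y, (g y - c) ^ 2 ∂f = ∫ y, (g y * g y) + ((-2 * c) * g y + c ^ 2) ∂f := by
    congr 1; ext y; ring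
  rw [h2, integral_add ((hg.mul hg).integrable f)
    ((((BddMeas.const (-2 * c)).mul hg).add (BddMeas.const _)).integrable f),
    integral_add (((BddMeas.const (-2 * c)).mul hg).integrable f) (integrable_const _),
    integral_const_mul, ← hc] at h1
  simp only [integral_const, probReal_univ, smul_eq_mul, one_mul] at h1
  simp only [pow_two] at h1 ⊢
  linarith

end Avg

/-- The mean square increment `E[(Z(t - ξ) - Z(t))²]`. -/
noncomputable def sqIncr (f : Measure ℝ) (Z : ℝ → ℝ) (t : ℝ) : ℝ := ∫ y, (Z (t - y) - Z t) ^ 2 ∂f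

section SqIncr

variable (f : Measure ℝ) [IsProbabilityMeasure f] {Z : ℝ → ℝ}

/-- Expanding the square: up to the defect Z - f ∗ Z, the mean square increment is f ∗ Z² - Z², a
difference whose averages telescope. -/
lemma sqIncr_eq (hZ : BddMeas Z) (t : ℝ) :
    sqIncr f Z t = avg f (fun t => Z t * Z t) t - Z t * Z t + 2 * (Z t * (Z t - avg f Z t)) := by
  have h2 : sqIncr f Z t = ∫ y, (Z (t - y) * Z (t - y)) + ((-2 * Z t) * Z (t - y) + Z t ^ 2) ∂f := by
    unfold sqIncr; congr 1; ext y; ring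
  have hZ' := hZ.comp_sub_left t
  rw [h2, integral_add ((hZ'.mul hZ').integrable f)
    ((((BddMeas.const (-2 * Z t)).mul hZ').add (BddMeas.const _)).integrable f),
    integral_add (((BddMeas.const (-2 * Z t)).mul hZ').integrable f) (integrable_const _),
    integral_const_mul]
  simp only [avg, integral_const, probReal_univ, smul_eq_mul, one_mul]
  ring

lemma BddMeas.sqIncr (hZ : BddMeas Z) : BddMeas (sqIncr f Z) := by
  have := (((hZ.mul hZ).avg f).sub (hZ.mul hZ)).add
    ((BddMeas.const 2).mul (hZ.mul (hZ.sub (hZ.avg f))))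
  convert this using 1
  ext t; exact sqIncr_eq f hZ t

/-- If `Z` is asymptotically harmonic then its mean square increments are asymptotically
subharmonic. -/
lemma sqIncr_le_avg (hZ : BddMeas Z) {M : ℝ} (hM : ∀ t, |Z t| ≤ M) (t : ℝ) :
    sqIncr f Z t ≤ avg f (sqIncr f Z) t +
      4 * M * (avg f (fun s => |Z s - avg f Z s|) t + |Z t - avg f Z t|) := by
  set z : ℝ → ℝ := fun s => Z s - avg f Z s with hz
  have hzb : BddMeas z := hZ.sub (hZ.avg f)
  -- Up to the defects z, the increment Z(t - y) - Z(t) is the f-average over u of the increments at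
  -- t - u, so its square is controlled by Jensen. Integrating in y and exchanging the integrals
  -- produces the average of `sqIncr`. The factor 4M bounds a + (a + b), both summands being at most
  -- 2M in absolute value.
  have key : ∀ y, (Z (t - y) - Z t) ^ 2 ≤
      ∫ u, (Z (t - u - y) - Z (t - u)) ^ 2 ∂f + 4 * M * (|z (t - y)| + |z t|) := by
    intro y
    set a := ∫ u, (Z (t - u - y) - Z (t - u)) ∂f with ha
    have hb1 : BddMeas fun u => Z (t - u - y) - Z (t - u) :=
      ((hZ.comp_sub_right y).sub hZ).comp_sub_left t
    have hJ : a ^ 2 ≤ ∫ u, (Z (t - u - y) - Z (t - u)) ^ 2 ∂f := sq_integral_le f hb1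
    have ha' : a = avg f Z (t - y) - avg f Z t := by
      rw [ha, integral_sub (((hZ.comp_sub_right y).comp_sub_left t).integrable f)
        ((hZ.comp_sub_left t).integrable f)]
      congr 2
      ext u; congr 1; ring
    have hD : Z (t - y) - Z t = a + (z (t - y) - z t) := by rw [ha', hz]; ring
    have hA : |a| ≤ 2 * M := by
      have := norm_integral_le_of_norm_le_const (μ := f) (C := 2 * M)
        (f := fun u => Z (t - u - y) - Z (t - u))
        (ae_of_all f fun u => by
          rw [Real.norm_eq_abs]
          exact (abs_sub _ _).trans (by linarith [hM (t - u - y), hM (t - u)]))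
      simpa using this
    have hB : |Z (t - y) - Z t| ≤ 2 * M :=
      (abs_sub _ _).trans (by linarith [hM (t - y), hM t])
    set b := z (t - y) - z t
    have hbz : |b| ≤ |z (t - y)| + |z t| := abs_sub _ _
    have hM0 : 0 ≤ M := (abs_nonneg _).trans (hM 0)
    calc (Z (t - y) - Z t) ^ 2 = a ^ 2 + b * (a + (a + b)) := by rw [hD]; ring
      _ ≤ a ^ 2 + |b| * (4 * M) := by
          have h5 : |a + (a + b)| ≤ 4 * M := by
            refine (abs_add_le _ _).trans ?_
            rw [← hD]; linarith
          have h6 : b * (a + (a + b)) ≤ |b| * (4 * M) := by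
            refine (le_abs_self _).trans ?_
            rw [abs_mul]
            exact mul_le_mul_of_nonneg_left h5 (abs_nonneg _)
          linarith
      _ ≤ _ := by
          have := mul_le_mul_of_nonneg_right hbz (show (0 : ℝ) ≤ 4 * M by linarith)
          linarith
  have hF : Measurable (fun p : ℝ × ℝ => (Z (t - p.2 - p.1) - Z (t - p.2)) ^ 2) :=
    ((hZ.meas.comp ((measurable_const.sub measurable_snd).sub measurable_fst)).sub
      (hZ.meas.comp (measurable_const.sub measurable_snd))).pow_const 2
  have hFb : ∀ p : ℝ × ℝ, ‖(Z (t - p.2 - p.1) - Z (t - p.2)) ^ 2‖ ≤ (2 * M) ^ 2 := by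
    intro p
    rw [norm_pow, Real.norm_eq_abs]
    gcongr
    exact (abs_sub _ _).trans (by linarith [hM (t - p.2 - p.1), hM (t - p.2)])
  have hFi : Integrable (fun p : ℝ × ℝ => (Z (t - p.2 - p.1) - Z (t - p.2)) ^ 2) (f.prod f) :=
    Integrable.of_bound hF.aestronglyMeasurable _ (ae_of_all _ hFb)
  have hb2 : BddMeas fun y => (4 * M) * (|z (t - y)| + |z t|) :=
    (BddMeas.const (4 * M)).mul ((hzb.abs.comp_sub_left t).add (BddMeas.const _))
  have hb3 : BddMeas fun y => (Z (t - y) - Z t) ^ 2 := by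
    have := (hZ.comp_sub_left t).sub (BddMeas.const (Z t))
    simpa only [pow_two] using this.mul this
  have h1 := integral_mono (μ := f) (hb3.integrable f)
    (hFi.integral_prod_left.add (hb2.integrable f)) key
  have h1' := h1.trans_eq (integral_add hFi.integral_prod_left (hb2.integrable f))
  refine h1'.trans (le_of_eq ?_)
  congr 1
  · rw [integral_integral_swap hFi]; rfl
  · rw [integral_const_mul, integral_add ((hzb.abs.comp_sub_left t).integrable f)
      (integrable_const _)]
    simp only [integral_const, probReal_univ, smul_eq_mul, one_mul]
    rfl

/-- By asymptotic subharmonicity `sqIncr` lies, up to o(1), below each of its iterated averages, and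
the sum of the first N of these telescopes to f^{∗N} ∗ Z² - Z². The function G is f^{∗N} ∗ Z², and E
collects the errors. -/
lemma nat_mul_sqIncr_le (hZ : BddMeas Z) {M : ℝ} (hM : ∀ t, |Z t| ≤ M)
    (h0 : Tendsto (fun t => Z t - avg f Z t) atTop (𝓝 0)) (N : ℕ) :
    ∃ G E : ℝ → ℝ, BddMeas G ∧ BddMeas E ∧ (∀ t, G t ≤ M ^ 2) ∧ Tendsto E atTop (𝓝 0) ∧
      ∀ t, N * sqIncr f Z t ≤ G t - Z t * Z t + E t := by
  have hz : BddMeas fun t => Z t - avg f Z t := hZ.sub (hZ.avg f)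
  have hsq : BddMeas (sqIncr f Z) := BddMeas.sqIncr f hZ
  induction N with
  | zero =>
    refine ⟨fun t => Z t * Z t, fun _ => 0, hZ.mul hZ, .const 0, fun t => ?_, tendsto_const_nhds,
      fun t => by simp⟩
    change Z t * Z t ≤ M ^ 2
    rw [← pow_two, ← sq_abs]
    have := hM t
    gcongr
  | succ N ih =>
    obtain ⟨G, E, hG, hE, hGM, hE0, hle⟩ := ih
    set e : ℝ → ℝ := fun t => 4 * M * (avg f (fun s => |Z s - avg f Z s|) t + |Z t - avg f Z t|)
    have heb : BddMeas e := (BddMeas.const _).mul ((hz.abs.avg f).add hz.abs)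
    have he0 : Tendsto e atTop (𝓝 0) := by
      have habs : Tendsto (fun t => |Z t - avg f Z t|) atTop (𝓝 0) := by simpa using h0.abs
      simpa using ((tendsto_avg_zero f hz.abs habs).add habs).const_mul (4 * M)
    -- Average the induction hypothesis, pass from `avg f (sqIncr f Z)` back to `sqIncr f Z` at the
    -- price of N times e, and add the identity `sqIncr_eq` once: the terms f ∗ Z² cancel.
    refine ⟨avg f G, fun t => avg f E t + N * e t + 2 * (Z t * (Z t - avg f Z t)),
      hG.avg f, ((hE.avg f).add ((BddMeas.const _).mul heb)).add
        ((BddMeas.const 2).mul (hZ.mul hz)), avg_le f hG hGM, ?_, fun t => ?_⟩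
    · have h3 : Tendsto (fun t => Z t * (Z t - avg f Z t)) atTop (𝓝 0) := by
        refine squeeze_zero_norm (a := fun t => M * |Z t - avg f Z t|) (fun t => ?_) ?_
        · rw [norm_mul, Real.norm_eq_abs, Real.norm_eq_abs]
          have := hM t
          gcongr
        · simpa using h0.abs.const_mul M
      simpa using ((tendsto_avg_zero f hE hE0).add (he0.const_mul (N : ℝ))).add (h3.const_mul 2)
    · have h1 := avg_mono f ((BddMeas.const (N : ℝ)).mul hsq) ((hG.sub (hZ.mul hZ)).add hE) hle t
      rw [avg_const_mul, avg_add f (hG.sub (hZ.mul hZ)) hE, avg_sub f hG (hZ.mul hZ)] at h1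
      have h2 := sqIncr_le_avg f hZ hM t
      have h3 := sqIncr_eq f hZ t
      have h4 := mul_le_mul_of_nonneg_left h2 (Nat.cast_nonneg (α := ℝ) N)
      push_cast
      simp only [e]
      linarith

/-- N times a nonnegative quantity stays below M² + o(1) for every fixed N. -/
lemma tendsto_sqIncr (hZ : BddMeas Z) (h0 : Tendsto (fun t => Z t - avg f Z t) atTop (𝓝 0)) :
    Tendsto (sqIncr f Z) atTop (𝓝 0) := by
  obtain ⟨M, hM⟩ := hZ.bdd
  have hpos : ∀ t, 0 ≤ sqIncr f Z t := fun t => integral_nonneg fun y => sq_nonneg _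
  rw [Metric.tendsto_nhds]
  intro δ hδ
  obtain ⟨N, hN⟩ := exists_nat_gt ((M ^ 2 + 1) / δ)
  obtain ⟨G, E, -, -, hGM, hE0, hle⟩ := nat_mul_sqIncr_le f hZ hM h0 N
  filter_upwards [hE0.eventually (gt_mem_nhds zero_lt_one)] with t ht
  rw [Real.dist_eq, sub_zero, abs_of_nonneg (hpos t)]
  rw [div_lt_iff₀ hδ] at hN
  by_contra! hcon
  have h1 := hle t
  have h2 := mul_le_mul_of_nonneg_left hcon (Nat.cast_nonneg (α := ℝ) N)
  nlinarith [hGM t, mul_self_nonneg (Z t)]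

/-- A uniformly continuous bounded asymptotically harmonic function is slowly varying. -/
theorem tendsto_sub_of_harmonic (hf : ∀ c, f {c} = 0) (hZ : BddMeas Z) (hu : UniformContinuous Z)
    (h0 : Tendsto (fun t => Z t - avg f Z t) atTop (𝓝 0)) (y : ℝ) :
    Tendsto (fun t => Z (t - y) - Z t) atTop (𝓝 0) := by
  -- The asymptotic periods of Z form a subgroup, closed by uniform continuity, which contains the
  -- support of f because `sqIncr` tends to 0.
  let Γ : AddSubgroup ℝ :=
    { carrier := {y | Tendsto (fun t => Z (t - y) - Z t) atTop (𝓝 0)}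
      zero_mem' := by simp
      add_mem' := by
        intro a b ha hb
        have h1 : Tendsto (fun t => Z (t - b - a) - Z (t - b)) atTop (𝓝 0) :=
          ha.comp (tendsto_atTop_add_const_right _ (-b) tendsto_id)
        have := h1.add hb
        simp only [mem_ofPred_eq, add_zero] at this ⊢
        refine this.congr fun t => ?_
        rw [show t - b - a = t - (a + b) by ring]; ring
      neg_mem' := by
        intro a ha
        have h1 : Tendsto (fun t => Z (t + a - a) - Z (t + a)) atTop (𝓝 0) :=
          ha.comp (tendsto_atTop_add_const_right _ a tendsto_id)
        have := h1.neg
        simp only [mem_ofPred_eq, neg_zero] at this ⊢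
        refine this.congr fun t => ?_
        rw [show t + a - a = t by ring, sub_neg_eq_add]; ring }
  have hclosed : IsClosed (Γ : Set ℝ) := by
    rw [← closure_subset_iff_isClosed]
    intro y hy
    change Tendsto (fun t => Z (t - y) - Z t) atTop (𝓝 0)
    rw [Metric.tendsto_nhds]
    intro δ hδ
    obtain ⟨η, hη, hη'⟩ := Metric.uniformContinuous_iff.1 hu (δ / 2) (by positivity)
    obtain ⟨y', hy', hyy⟩ := Metric.mem_closure_iff.1 hy η hη
    filter_upwards [(Metric.tendsto_nhds.1 hy') (δ / 2) (by positivity)] with t ht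
    have h1 : dist (Z (t - y)) (Z (t - y')) < δ / 2 := hη' (by rwa [dist_sub_left])
    rw [Real.dist_eq] at *
    calc |Z (t - y) - Z t - 0| = |(Z (t - y) - Z (t - y')) + (Z (t - y') - Z t - 0)| := by
          congr 1; ring
      _ ≤ _ := abs_add_le _ _
      _ < δ := by linarith
  have hsupp : ∀ y, (∀ η > 0, f (Metric.ball y η) ≠ 0) → y ∈ Γ := by
    intro y hy
    change Tendsto (fun t => Z (t - y) - Z t) atTop (𝓝 0)
    rw [Metric.tendsto_nhds]
    intro δ hδ
    obtain ⟨η, hη, hη'⟩ := Metric.uniformContinuous_iff.1 hu (δ / 2) (by positivity)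
    -- Chebyshev: an increment of size δ at y forces, by the choice of η, increments of size at
    -- least δ/2 on the whole ball, hence this much mean square increment.
    have hpos : 0 < (f.real (Metric.ball y η)) * (δ / 2) ^ 2 := by
      have : 0 < f.real (Metric.ball y η) :=
        ENNReal.toReal_pos (hy η hη) (measure_ne_top _ _)
      positivity
    filter_upwards [(tendsto_sqIncr f hZ h0).eventually (gt_mem_nhds hpos)] with t ht
    rw [Real.dist_eq, sub_zero]
    by_contra! hcon
    have hb3 : BddMeas fun y => (Z (t - y) - Z t) ^ 2 := by
      have := (hZ.comp_sub_left t).sub (BddMeas.const (Z t))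
      simpa only [pow_two] using this.mul this
    have h1 : ∫ u in Metric.ball y η, (δ / 2) ^ 2 ∂f ≤ ∫ u in Metric.ball y η, (Z (t - u) - Z t) ^ 2 ∂f := by
      refine setIntegral_mono_on (integrable_const _).integrableOn (hb3.integrable f).integrableOn
        measurableSet_ball fun u hu' => ?_
      rw [← sq_abs (Z (t - u) - Z t)]
      gcongr
      have h3 : dist (Z (t - y)) (Z (t - u)) < δ / 2 :=
        hη' (by rw [dist_sub_left, dist_comm]; exact hu')
      rw [Real.dist_eq] at h3
      have h4 : |Z (t - y) - Z t| ≤ |Z (t - y) - Z (t - u)| + |Z (t - u) - Z t| := abs_sub_le _ _ _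
      linarith
    have h2 : ∫ u in Metric.ball y η, (Z (t - u) - Z t) ^ 2 ∂f ≤ sqIncr f Z t :=
      setIntegral_le_integral (hb3.integrable f) (ae_of_all _ fun u => sq_nonneg _)
    simp only [integral_const, MeasurableSet.univ, measureReal_restrict_apply, univ_inter,
      smul_eq_mul] at h1
    linarith
  rcases Γ.dense_or_cyclic with hd | ⟨a, ha⟩
  · have : (Γ : Set ℝ) = univ := by rw [← hclosed.closure_eq, hd.closure_eq]
    exact (this ▸ mem_univ y : y ∈ (Γ : Set ℝ))
  -- A cyclic Γ is countable, so it is f-null as f has no atoms; its complement misses the support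
  -- and is null too, against total mass 1.
  · exfalso
    have hcount : (Γ : Set ℝ).Countable := by
      have : (Γ : Set ℝ) ⊆ range fun n : ℤ => n • a := by
        intro x hx
        rw [SetLike.mem_coe, ha, AddSubgroup.mem_closure_singleton] at hx
        exact hx
      exact (countable_range _).mono this
    have h1 : f (Γ : Set ℝ) = 0 := by
      rw [← biUnion_of_singleton (Γ : Set ℝ), measure_biUnion_null_iff hcount]
      exact fun c _ => hf c
    have h2 : f ((Γ : Set ℝ)ᶜ) = 0 := by
      refine measure_null_of_locally_null _ fun x hx => ?_
      have : ¬ ∀ η > 0, f (Metric.ball x η) ≠ 0 := fun h => hx (hsupp x h)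
      push Not at this
      obtain ⟨η, hη, h⟩ := this
      exact ⟨_, mem_nhdsWithin_of_mem_nhds (Metric.ball_mem_nhds x hη), h⟩
    have h3 := measure_union_le (μ := f) (Γ : Set ℝ) (Γ : Set ℝ)ᶜ
    rw [union_compl_self, h1, h2, measure_univ] at h3
    simp at h3

end SqIncr

end Renewal

/-! ### Renewal measures, potentials and uniform bounds -/

namespace Renewal

/-- `∫ w(t - y) U(dy)`. -/
noncomputable def pot (U : Measure ℝ) (w : ℝ → ℝ≥0∞) (t : ℝ) : ℝ≥0∞ := ∫⁻ y, w (t - y) ∂U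

/-- The tail `u ↦ f(u, ∞)` on `[0, ∞)`, extended by zero. -/
noncomputable def tail (f : Measure ℝ) : ℝ → ℝ≥0∞ := (Ici 0).indicator fun u => f (Ioi u)

/-- `U` is the renewal measure of the atomless law `f` on `[0, ∞)`. -/
structure IsRenewal (f U : Measure ℝ) : Prop where
  prob : IsProbabilityMeasure f
  sfinite : SFinite U
  nonneg : f (Iio 0) = 0
  noAtoms : ∀ c, f {c} = 0
  eq : U = Measure.dirac 0 + f ∗ U
  fin : ∀ t, U (Iic t) ≠ ∞

lemma measurable_pot {U : Measure ℝ} [SFinite U] {w : ℝ → ℝ≥0∞} (hw : Measurable w) :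
    Measurable (pot U w) :=
  Measurable.lintegral_prod_right' (f := fun p : ℝ × ℝ => w (p.1 - p.2))
    (hw.comp (measurable_fst.sub measurable_snd))

lemma measurable_tail (f : Measure ℝ) : Measurable (tail f) := by
  refine Measurable.indicator ?_ measurableSet_Ici
  have : Antitone fun u => f (Ioi u) := fun a b h => measure_mono (Ioi_subset_Ioi h)
  exact this.measurable

namespace IsRenewal

variable {f U : Measure ℝ} (h : IsRenewal f U)
include h

lemma pot_eq {w : ℝ → ℝ≥0∞} (hw : Measurable w) (t : ℝ) :
    pot U w t = w t + ∫⁻ y, pot U w (t - y) ∂f := by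
  have := h.prob
  have := h.sfinite
  have hm : Measurable fun y => w (t - y) := hw.comp (measurable_const.sub measurable_id)
  conv_lhs => rw [pot, h.eq, lintegral_add_measure, lintegral_dirac' _ hm,
    Measure.lintegral_conv hm]
  simp only [sub_zero, pot, sub_sub]

/-- Exactly one renewal is the last one before t. Analytically: split 1 = f(u,∞) + f(-∞,u] for u ≥ 0
in the potential of the indicator of [0,∞), compare with its renewal equation, and cancel the common
term, finite since U(-∞,t] is. -/
lemma pot_tail (t : ℝ) : pot U (tail f) t = (Ici 0).indicator 1 t := by
  have := h.prob
  have := h.sfinite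
  have hw0 : Measurable ((Ici (0 : ℝ)).indicator (1 : ℝ → ℝ≥0∞)) :=
    measurable_one.indicator measurableSet_Ici
  have h1 := h.pot_eq hw0 t
  have hm : Measurable fun p : ℝ × ℝ => (Ici (0 : ℝ)).indicator (1 : ℝ → ℝ≥0∞) (t - p.1 - p.2) :=
    hw0.comp ((measurable_const.sub measurable_fst).sub measurable_snd)
  have h2 : ∫⁻ y, pot U ((Ici 0).indicator 1) (t - y) ∂f = ∫⁻ x, f (Iic (t - x)) ∂U := by
    unfold pot
    rw [lintegral_lintegral_swap hm.aemeasurable]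
    refine lintegral_congr fun x => ?_
    rw [← lintegral_indicator_one measurableSet_Iic]
    refine lintegral_congr fun y => ?_
    simp only [indicator, mem_Ici, mem_Iic, sub_nonneg]
    congr 1
    exact propext ⟨fun _ => by linarith, fun _ => by linarith⟩
  have h3 : pot U ((Ici 0).indicator 1) t = pot U (tail f) t + ∫⁻ x, f (Iic (t - x)) ∂U := by
    unfold pot
    rw [← lintegral_add_left (f := fun y => tail f (t - y))
      ((measurable_tail f).comp (measurable_const.sub measurable_id))]
    refine lintegral_congr fun x => ?_
    unfold tail
    by_cases hx : 0 ≤ t - x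
    · rw [indicator_of_mem (mem_Ici.2 hx), indicator_of_mem (mem_Ici.2 hx)]
      have := measure_union (μ := f) (Iic_disjoint_Ioi (le_refl (t - x))) measurableSet_Ioi
      rw [Iic_union_Ioi, measure_univ] at this
      rw [Pi.one_apply, this, add_comm]
    · rw [indicator_of_notMem (by simpa using hx), indicator_of_notMem (by simpa using hx), zero_add]
      exact (measure_mono_null (fun y hy => by
        simp only [mem_Iic, mem_Iio] at *; linarith) h.nonneg).symm
  have h4 : ∫⁻ x, f (Iic (t - x)) ∂U ≠ ∞ := by
    refine ne_top_of_le_ne_top (h.fin t) ?_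
    rw [← lintegral_indicator_one measurableSet_Iic]
    refine lintegral_mono fun x => ?_
    by_cases hx : x ≤ t
    · rw [indicator_of_mem (mem_Iic.2 hx)]; exact prob_le_one
    · rw [measure_mono_null (fun y hy => by
        simp only [mem_Iic, mem_Iio] at *; linarith) h.nonneg]; exact zero_le
  rw [h2] at h1
  rw [h1] at h3
  exact ((ENNReal.add_left_inj h4).1 h3).symm

/-- The tail of f is at least f(a,∞) on [0,a], so f(a,∞) U[t - a, t] is at most the potential of the
tail, which is at most 1. Some a > 0 has f(a,∞) > 0 because f is not concentrated at 0. -/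
lemma exists_bound : ∃ a > 0, ∃ C : ℝ≥0∞, C ≠ ∞ ∧ ∀ t, U (Icc (t - a) t) ≤ C := by
  have := h.prob
  have h0 : f (Ioi 0) ≠ 0 := by
    intro h0
    have h1 : (univ : Set ℝ) = Iio 0 ∪ {0} ∪ Ioi 0 := by
      rw [← Iic_union_Ioi (a := (0 : ℝ)), ← Iio_union_right]
    have : f univ = 0 := by
      rw [h1, measure_union_null_iff, measure_union_null_iff]
      exact ⟨⟨h.nonneg, h.noAtoms 0⟩, h0⟩
    simp at this
  obtain ⟨a, ha, hfa⟩ : ∃ a > 0, f (Ioi a) ≠ 0 := by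
    by_contra! hcon
    apply h0
    have : Ioi (0 : ℝ) ⊆ ⋃ n : ℕ, Ioi (1 / ((n : ℝ) + 1)) := by
      intro x hx
      obtain ⟨n, hn⟩ := exists_nat_one_div_lt (mem_Ioi.1 hx)
      exact mem_iUnion.2 ⟨n, hn⟩
    refine measure_mono_null this (measure_iUnion_null fun n => hcon _ (by positivity))
  refine ⟨a, ha, (f (Ioi a))⁻¹, by simpa using hfa, fun t => ?_⟩
  rw [← one_mul (U _), ← ENNReal.inv_mul_cancel hfa (measure_ne_top _ _), mul_assoc]
  refine mul_le_of_le_one_right' ?_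
  have h1 : pot U (tail f) t ≤ 1 := by
    rw [h.pot_tail]; exact indicator_le_self _ _ _
  refine le_trans ?_ h1
  rw [← setLIntegral_const]
  refine (setLIntegral_mono' measurableSet_Icc fun y hy => ?_).trans (setLIntegral_le_lintegral _ _)
  rw [mem_Icc] at hy
  rw [tail, indicator_of_mem (mem_Ici.2 (by linarith))]
  exact measure_mono (Ioi_subset_Ioi (by linarith))

end IsRenewal

/-! ### Smoothing and integrands decreasing on the half line -/

/-- The average of `w` over the window `[t - δ, t)`. -/
noncomputable def smooth (δ : ℝ) (w : ℝ → ℝ≥0∞) (t : ℝ) : ℝ≥0∞ :=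
  (ENNReal.ofReal δ)⁻¹ * ∫⁻ s in Ioc 0 δ, w (t - s)

lemma measurable_smooth {δ : ℝ} {w : ℝ → ℝ≥0∞} (hw : Measurable w) : Measurable (smooth δ w) :=
  (Measurable.lintegral_prod_right' (f := fun p : ℝ × ℝ => w (p.1 - p.2))
    (hw.comp (measurable_fst.sub measurable_snd))).const_mul _

lemma smooth_le {δ : ℝ} (hδ : 0 < δ) {w : ℝ → ℝ≥0∞} {t : ℝ} {c : ℝ≥0∞}
    (hc : ∀ s ∈ Ioc 0 δ, w (t - s) ≤ c) : smooth δ w t ≤ c := by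
  have h1 : ∫⁻ s in Ioc 0 δ, w (t - s) ≤ c * ENNReal.ofReal δ := by
    refine (setLIntegral_mono' measurableSet_Ioc hc).trans ?_
    simp
  have h0 : ENNReal.ofReal δ ≠ 0 := by simpa using hδ
  refine (mul_le_mul_right h1 _).trans ?_
  rw [mul_comm, mul_assoc, ENNReal.mul_inv_cancel h0 ENNReal.ofReal_ne_top, mul_one]

lemma le_smooth {δ : ℝ} (hδ : 0 < δ) {w : ℝ → ℝ≥0∞} {t : ℝ} {c : ℝ≥0∞}
    (hc : ∀ s ∈ Ioc 0 δ, c ≤ w (t - s)) : c ≤ smooth δ w t := by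
  have h1 : c * ENNReal.ofReal δ ≤ ∫⁻ s in Ioc 0 δ, w (t - s) := by
    refine le_trans ?_ (setLIntegral_mono' measurableSet_Ioc hc)
    simp
  have h0 : ENNReal.ofReal δ ≠ 0 := by simpa using hδ
  refine le_trans ?_ (mul_le_mul_right h1 _)
  rw [mul_comm, mul_assoc, ENNReal.mul_inv_cancel h0 ENNReal.ofReal_ne_top, mul_one]

lemma pot_smooth {U : Measure ℝ} [SFinite U] {δ : ℝ} {w : ℝ → ℝ≥0∞} (hw : Measurable w) (t : ℝ) :
    pot U (smooth δ w) t = smooth δ (pot U w) t := by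
  unfold pot smooth
  rw [lintegral_const_mul]
  · congr 1
    rw [lintegral_lintegral_swap]
    · refine lintegral_congr fun s => lintegral_congr fun y => ?_
      congr 1; ring
    · exact (hw.comp ((measurable_const.sub measurable_fst).sub measurable_snd)).aemeasurable
  · exact (Measurable.lintegral_prod_right' (f := fun p : ℝ × ℝ => w (t - p.1 - p.2))
      (hw.comp ((measurable_const.sub measurable_fst).sub measurable_snd)))

lemma smooth_eq_lintegral {δ : ℝ} {w : ℝ → ℝ≥0∞} (t : ℝ) :
    smooth δ w t = (ENNReal.ofReal δ)⁻¹ * ∫⁻ v, w v * (Ioc 0 δ).indicator 1 (t - v) := by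
  unfold smooth
  congr 1
  rw [← lintegral_indicator measurableSet_Ioc,
    ← lintegral_sub_left_eq_self (fun v => w v * (Ioc 0 δ).indicator 1 (t - v)) t]
  refine lintegral_congr fun s => ?_
  rw [sub_sub_cancel]
  by_cases hs : s ∈ Ioc 0 δ <;> simp [hs]

lemma lintegral_smooth {δ : ℝ} (hδ : 0 < δ) {w : ℝ → ℝ≥0∞} (hw : Measurable w) :
    ∫⁻ t, smooth δ w t = ∫⁻ t, w t := by
  unfold smooth
  have h0 : ENNReal.ofReal δ ≠ 0 := by simpa using hδ
  have hm : Measurable fun p : ℝ × ℝ => w (p.1 - p.2) :=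
    hw.comp (measurable_fst.sub measurable_snd)
  rw [lintegral_const_mul _ hm.lintegral_prod_right', lintegral_lintegral_swap hm.aemeasurable]
  simp only [lintegral_sub_right_eq_self w]
  simp only [lintegral_const, MeasurableSet.univ, Measure.restrict_apply, univ_inter,
    Real.volume_Ioc, sub_zero]
  rw [mul_comm, mul_assoc, ENNReal.mul_inv_cancel h0 ENNReal.ofReal_ne_top, mul_one]

/-- Bounded functions on `[0, ∞)`, decreasing on `(0, ∞)` and with finite integral. -/
structure Decr (w : ℝ → ℝ≥0∞) (c : ℝ≥0∞) : Prop where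
  meas : Measurable w
  top : c ≠ ∞
  le : ∀ t, w t ≤ c
  zero : ∀ t < 0, w t = 0
  anti : AntitoneOn w (Ioi 0)
  int : ∫⁻ t, w t ≠ ∞

/-- A decreasing function lies below its average over the preceding window; this and
`Decr.smooth_le_add`, the reverse bound after a shift by δ, fail only where the window meets the
jump at 0, and there c pays for the error. -/
lemma Decr.le_smooth_add {w : ℝ → ℝ≥0∞} {c : ℝ≥0∞} (hw : Decr w c) {δ : ℝ} (hδ : 0 < δ) (t : ℝ) :
    w t ≤ smooth δ w t + c * (Icc 0 δ).indicator 1 t := by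
  rcases lt_or_ge t 0 with ht | ht
  · simp [hw.zero t ht]
  rcases le_or_gt t δ with htδ | htδ
  · rw [indicator_of_mem (mem_Icc.2 ⟨ht, htδ⟩)]
    exact le_add_left (by simpa using hw.le t)
  · refine le_add_right (le_smooth hδ fun s hs => hw.anti ?_ ?_ ?_) <;>
      simp only [mem_Ioi, mem_Ioc] at * <;> linarith

lemma Decr.smooth_le_add {w : ℝ → ℝ≥0∞} {c : ℝ≥0∞} (hw : Decr w c) {δ : ℝ} (hδ : 0 < δ) (t : ℝ) :
    smooth δ w (t + δ) ≤ w t + c * (Icc 0 δ).indicator 1 (t + δ) := by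
  rcases lt_or_ge (t + δ) 0 with ht | ht
  · refine smooth_le hδ fun s hs => ?_
    rw [hw.zero _ (by have := hs.1; linarith)]; exact zero_le
  rcases le_or_gt t 0 with htδ | htδ
  · rw [indicator_of_mem (mem_Icc.2 ⟨ht, by linarith⟩)]
    refine le_add_left (smooth_le hδ fun s _ => by simpa using hw.le _)
  · refine le_add_right (smooth_le hδ fun s hs => hw.anti ?_ ?_ ?_) <;>
      simp only [mem_Ioi, mem_Ioc] at * <;> linarith

/-- Monotonicity gives t w(t) ≤ ∫ w. -/
lemma Decr.tendsto {w : ℝ → ℝ≥0∞} {c : ℝ≥0∞} (hw : Decr w c) : Tendsto w atTop (𝓝 0) := by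
  have h1 : ∀ᶠ t : ℝ in atTop, w t ≤ (∫⁻ t, w t) / ENNReal.ofReal t := by
    filter_upwards [eventually_gt_atTop 0] with t ht
    rw [ENNReal.le_div_iff_mul_le (by simp [ht]) (by simp)]
    calc w t * ENNReal.ofReal t = ∫⁻ s in Ioc 0 t, w t := by simp
      _ ≤ ∫⁻ s in Ioc 0 t, w s := setLIntegral_mono' measurableSet_Ioc fun s hs =>
          hw.anti hs.1 ht hs.2
      _ ≤ _ := setLIntegral_le_lintegral _ _
  refine tendsto_of_tendsto_of_tendsto_of_le_of_le' tendsto_const_nhds ?_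
    (Eventually.of_forall fun _ => zero_le) h1
  have := ENNReal.Tendsto.const_div (a := ∫⁻ t, w t) ENNReal.tendsto_ofReal_atTop (Or.inr hw.int)
  simpa using this

lemma Decr.tendsto_smooth {w : ℝ → ℝ≥0∞} {c : ℝ≥0∞} (hw : Decr w c) {δ : ℝ} (hδ : 0 < δ) :
    Tendsto (smooth δ w) atTop (𝓝 0) := by
  have h1 : ∀ᶠ t : ℝ in atTop, smooth δ w t ≤ w (t - δ) := by
    filter_upwards [eventually_gt_atTop δ] with t ht
    refine smooth_le hδ fun s hs => hw.anti ?_ ?_ ?_ <;>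
      simp only [mem_Ioi, mem_Ioc] at * <;> linarith
  exact tendsto_of_tendsto_of_tendsto_of_le_of_le' tendsto_const_nhds
    (hw.tendsto.comp (tendsto_atTop_add_const_right _ (-δ) tendsto_id))
    (Eventually.of_forall fun _ => zero_le) h1

namespace IsRenewal

variable {f U : Measure ℝ} (h : IsRenewal f U)
include h

lemma pot_indicator_Icc (δ t : ℝ) (c : ℝ≥0∞) :
    ∫⁻ y, c * (Icc 0 δ).indicator 1 (t - y) ∂U = c * U (Icc (t - δ) t) := by
  have := h.sfinite
  rw [lintegral_const_mul]
  · congr 1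
    rw [← lintegral_indicator_one measurableSet_Icc]
    refine lintegral_congr fun y => ?_
    simp only [indicator, mem_Icc]
    congr 1
    exact propext ⟨fun _ => by constructor <;> linarith, fun _ => by constructor <;> linarith⟩
  · exact (measurable_one.indicator measurableSet_Icc).comp (measurable_const.sub measurable_id)

/-- Uniform bounds for renewal potentials. -/
lemma exists_pot_bound : ∃ K : ℝ≥0∞, K ≠ ∞ ∧ ∀ w c, Decr w c → ∀ t,
    pot U w t ≤ K * (c + ∫⁻ s, w s) := by
  have := h.sfinite
  obtain ⟨a, ha, C, hC, hb⟩ := h.exists_bound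
  have h0 : ENNReal.ofReal a ≠ 0 := by simpa using ha
  refine ⟨C + (ENNReal.ofReal a)⁻¹ * C, by finiteness, fun w c hw t => ?_⟩
  have hmi : Measurable ((Ioc (0 : ℝ) a).indicator (1 : ℝ → ℝ≥0∞)) :=
    measurable_one.indicator measurableSet_Ioc
  -- By Fubini the potential of the smoothed function is a⁻¹ ∫ w(v) U[t - v - a, t - v) dv, and
  -- every such window has mass at most C.
  have h1 : pot U (smooth a w) t ≤ (ENNReal.ofReal a)⁻¹ * (C * ∫⁻ s, w s) := by
    unfold pot
    simp only [smooth_eq_lintegral]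
    have hm : Measurable fun p : ℝ × ℝ => w p.2 * (Ioc 0 a).indicator 1 (t - p.1 - p.2) :=
      (hw.meas.comp measurable_snd).mul
        (hmi.comp ((measurable_const.sub measurable_fst).sub measurable_snd))
    rw [lintegral_const_mul _ hm.lintegral_prod_right', lintegral_lintegral_swap hm.aemeasurable]
    gcongr
    rw [← lintegral_const_mul _ hw.meas]
    refine lintegral_mono fun v => ?_
    change ∫⁻ y, w v * (Ioc 0 a).indicator 1 (t - y - v) ∂U ≤ _
    rw [lintegral_const_mul _ (by fun_prop), mul_comm]
    gcongr
    refine le_trans ?_ (hb (t - v))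
    rw [← lintegral_indicator_one measurableSet_Icc]
    refine lintegral_mono fun y => ?_
    by_cases hy : t - y - v ∈ Ioc 0 a
    · have hy' : y ∈ Icc (t - v - a) (t - v) := by
        rw [mem_Ioc] at hy
        constructor <;> linarith
      rw [indicator_of_mem hy, indicator_of_mem hy']; exact le_rfl
    · rw [indicator_of_notMem hy]; exact zero_le
  calc pot U w t ≤ ∫⁻ y, (smooth a w (t - y) + c * (Icc 0 a).indicator 1 (t - y)) ∂U :=
        lintegral_mono fun y => hw.le_smooth_add ha _
    _ = pot U (smooth a w) t + c * U (Icc (t - a) t) := by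
        rw [lintegral_add_left (f := fun y => smooth a w (t - y))
          ((measurable_smooth hw.meas).comp (measurable_const.sub measurable_id)),
          h.pot_indicator_Icc, pot]
    _ ≤ (ENNReal.ofReal a)⁻¹ * (C * ∫⁻ s, w s) + c * C := by gcongr; exact hb t
    _ ≤ _ := by
        rw [mul_add, add_mul, add_mul, ← mul_assoc, mul_comm c C]
        rw [add_comm]
        exact add_le_add (le_add_right le_rfl) (le_add_left le_rfl)

/-- Convolutions commute, and U ∗ tail is the indicator of [0,∞) by `pot_tail`. This identity is
what evaluates the limit in the renewal theorem. -/
lemma lintegral_pot_mul_tail {z : ℝ → ℝ≥0∞} (hz : Measurable z) (t : ℝ) :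
    ∫⁻ y, pot U z (t - y) * tail f y = ∫⁻ s in Iic t, z s := by
  have := h.sfinite
  have := h.prob
  have hm : Measurable fun p : ℝ × ℝ => z (t - p.1 - p.2) :=
    hz.comp ((measurable_const.sub measurable_fst).sub measurable_snd)
  have hm2 : Measurable fun p : ℝ × ℝ => z p.2 * tail f (t - p.1 - p.2) :=
    (hz.comp measurable_snd).mul
      ((measurable_tail f).comp ((measurable_const.sub measurable_fst).sub measurable_snd))
  calc ∫⁻ y, pot U z (t - y) * tail f y = ∫⁻ y, ∫⁻ r, z (t - y - r) * tail f y ∂U := by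
        refine lintegral_congr fun y => ?_
        rw [lintegral_mul_const _ (by fun_prop), pot]
    _ = ∫⁻ r, (∫⁻ y, z (t - y - r) * tail f y) ∂U :=
        lintegral_lintegral_swap (hm.mul ((measurable_tail f).comp measurable_fst)).aemeasurable
    _ = ∫⁻ r, (∫⁻ s, z s * tail f (t - r - s)) ∂U := by
        refine lintegral_congr fun r => ?_
        rw [← lintegral_sub_left_eq_self (fun s => z s * tail f (t - r - s)) (t - r)]
        refine lintegral_congr fun y => ?_
        rw [sub_sub_cancel]
        congr 2; ring
    _ = ∫⁻ s, ∫⁻ r, z s * tail f (t - r - s) ∂U := lintegral_lintegral_swap hm2.aemeasurable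
    _ = ∫⁻ s, (Iic t).indicator z s := by
        refine lintegral_congr fun s => ?_
        have hmt := measurable_tail f
        rw [lintegral_const_mul _ (by fun_prop)]
        have := h.pot_tail (t - s)
        unfold pot at this
        simp only [sub_right_comm t _ s, this]
        by_cases hs : s ≤ t <;> simp [hs]
    _ = _ := lintegral_indicator measurableSet_Iic _

end IsRenewal

end Renewal

/-! ### The key renewal theorem -/

namespace Renewal

namespace IsRenewal

variable {f U : Measure ℝ} (h : IsRenewal f U)
include h

/-- With a null tail the identity `lintegral_pot_mul_tail` for z the indicator of [0,1] would read 0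
= 1. -/
lemma lintegral_tail_ne_zero : ∫⁻ u, tail f u ≠ 0 := by
  intro h0
  have h1 := h.lintegral_pot_mul_tail (z := (Icc 0 1).indicator 1)
    (measurable_one.indicator measurableSet_Icc) 1
  rw [lintegral_eq_zero_iff (measurable_tail f)] at h0
  have h2 : ∫⁻ y, pot U ((Icc 0 1).indicator 1) (1 - y) * tail f y = 0 := by
    have : (fun y => pot U ((Icc 0 1).indicator 1) (1 - y) * tail f y) =ᵐ[volume] fun _ => 0 := by
      filter_upwards [h0] with y hy
      rw [hy]; simp
    rw [lintegral_congr_ae this, lintegral_zero]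
  rw [h2, setLIntegral_indicator measurableSet_Icc,
    inter_eq_left.2 (show Icc (0 : ℝ) 1 ⊆ Iic 1 from fun x hx => hx.2)] at h1
  simp at h1

/-- Key renewal theorem for functions with uniformly continuous potentials. -/
lemma tendsto_pot_of_uniformContinuous (hm : ∫⁻ u, tail f u ≠ ∞) {z : ℝ → ℝ≥0∞}
    (hz : Measurable z) (hzi : ∫⁻ t, z t ≠ ∞) (hz0 : Tendsto z atTop (𝓝 0))
    {B : ℝ≥0∞} (hB : B ≠ ∞) (hpB : ∀ t, pot U z t ≤ B)
    (hu : UniformContinuous fun t => (pot U z t).toReal) :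
    Tendsto (pot U z) atTop (𝓝 ((∫⁻ t, z t) / ∫⁻ u, tail f u)) := by
  have := h.prob
  have := h.sfinite
  have hfin : ∀ t, pot U z t ≠ ∞ := fun t => ne_top_of_le_ne_top hB (hpB t)
  set Z : ℝ → ℝ := fun t => (pot U z t).toReal with hZdef
  have hZle : ∀ t, Z t ≤ B.toReal := fun t => ENNReal.toReal_mono hB (hpB t)
  have hZnn : ∀ t, 0 ≤ Z t := fun t => ENNReal.toReal_nonneg
  have hZabs : ∀ t, |Z t| ≤ B.toReal := fun t => by rw [abs_of_nonneg (hZnn t)]; exact hZle t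
  have hZ : BddMeas Z := ⟨(measurable_pot hz).ennreal_toReal, B.toReal, hZabs⟩
  -- The renewal equation makes the defect of harmonicity equal to z, which vanishes at infinity.
  have hharm : Tendsto (fun t => Z t - avg f Z t) atTop (𝓝 0) := by
    have h1 : ∀ t, Z t - avg f Z t = (z t).toReal := by
      intro t
      have h2 := h.pot_eq hz t
      have h3 : avg f Z t = (∫⁻ y, pot U z (t - y) ∂f).toReal := by
        rw [avg, integral_toReal]
        · exact ((measurable_pot hz).comp (measurable_const.sub measurable_id)).aemeasurable
        · exact ae_of_all _ fun y => (hfin _).lt_top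
      have h4 := hfin t
      rw [h2, ENNReal.add_ne_top] at h4
      rw [h3, hZdef]
      simp only
      rw [h2, ENNReal.toReal_add h4.1 h4.2]; ring
    simp only [h1]
    exact (ENNReal.tendsto_toReal ENNReal.zero_ne_top).comp hz0
  have hslow := tendsto_sub_of_harmonic f h.noAtoms hZ hu hharm
  set g : ℝ → ℝ := fun u => (tail f u).toReal with hg
  have hgm : Measurable g := (measurable_tail f).ennreal_toReal
  have htfin : ∀ u, tail f u ≠ ∞ := fun u => by
    refine ne_top_of_le_ne_top ENNReal.one_ne_top ((indicator_le_self _ _ _).trans prob_le_one)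
  have hgi : Integrable g := integrable_toReal_of_lintegral_ne_top
    (measurable_tail f).aemeasurable hm
  have hgint : ∫ u, g u = (∫⁻ u, tail f u).toReal :=
    integral_toReal (measurable_tail f).aemeasurable (ae_of_all _ fun u => (htfin u).lt_top)
  have hgnn : ∀ u, 0 ≤ g u := fun u => ENNReal.toReal_nonneg
  have hI : ∀ t, ∫ y, Z (t - y) * g y = (∫⁻ s in Iic t, z s).toReal := by
    intro t
    rw [← h.lintegral_pot_mul_tail hz t, ← integral_toReal]
    · simp only [ENNReal.toReal_mul, hZdef, hg]
    · exact (((measurable_pot hz).comp (measurable_const.sub measurable_id)).mul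
        (measurable_tail f)).aemeasurable
    · exact ae_of_all _ fun y => ENNReal.mul_lt_top (hfin _).lt_top (htfin y).lt_top
  have hint : Tendsto (fun t : ℝ => ∫⁻ s in Iic t, z s) atTop (𝓝 (∫⁻ s, z s)) := by
    have := tendsto_measure_iUnion_atTop (μ := volume.withDensity z) (s := fun t : ℝ => Iic t)
      (fun a b hab => Iic_subset_Iic.2 hab)
    rw [iUnion_Iic, withDensity_apply _ MeasurableSet.univ, setLIntegral_univ] at this
    exact this.congr fun t => withDensity_apply _ measurableSet_Iic
  have hlim1 : Tendsto (fun t => ∫ y, Z (t - y) * g y) atTop (𝓝 (∫⁻ s, z s).toReal) := by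
    simp only [hI]
    exact (ENNReal.tendsto_toReal hzi).comp hint
  have hlim2 : Tendsto (fun t => ∫ y, (Z (t - y) - Z t) * g y) atTop (𝓝 0) := by
    have := tendsto_integral_filter_of_dominated_convergence (μ := volume) (l := atTop)
      (F := fun t y => (Z (t - y) - Z t) * g y) (f := fun _ => (0 : ℝ))
      (fun y => 2 * B.toReal * g y)
      (Eventually.of_forall fun t => ((((hZ.comp_sub_left t).meas.sub measurable_const)).mul
        hgm).aestronglyMeasurable)
      (Eventually.of_forall fun t => ae_of_all _ fun y => by
        rw [norm_mul, Real.norm_eq_abs, Real.norm_eq_abs, abs_of_nonneg (hgnn y)]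
        refine mul_le_mul_of_nonneg_right ((abs_sub _ _).trans ?_) (hgnn y)
        linarith [hZabs (t - y), hZabs t]) (hgi.const_mul _)
      (ae_of_all _ fun y => by simpa using (hslow y).mul_const (g y))
    simpa using this
  have hm0 : (∫⁻ u, tail f u).toReal ≠ 0 :=
    (ENNReal.toReal_pos h.lintegral_tail_ne_zero hm).ne'
  -- Write Z(t) ∫ tail as ∫ Z(t - y) tail(y) dy minus a correction: the first term tends to ∫ z, the
  -- correction vanishes by slow variation and dominated convergence.
  have heq : ∀ t, Z t = ((∫ y, Z (t - y) * g y) - ∫ y, (Z (t - y) - Z t) * g y) /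
      (∫⁻ u, tail f u).toReal := by
    intro t
    rw [eq_div_iff hm0, ← hgint, ← integral_const_mul, ← integral_sub]
    · congr 1; ext y; ring
    · exact hgi.bdd_mul (c := B.toReal) (hZ.comp_sub_left t).meas.aestronglyMeasurable
        (ae_of_all _ fun y => hZabs _)
    · exact hgi.bdd_mul (c := 2 * B.toReal)
        ((hZ.comp_sub_left t).meas.sub measurable_const).aestronglyMeasurable
        (ae_of_all _ fun y => (abs_sub _ _).trans (by linarith [hZabs (t - y), hZabs t]))
  have hfinal : Tendsto Z atTop (𝓝 ((∫⁻ t, z t) / ∫⁻ u, tail f u).toReal) := by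
    rw [ENNReal.toReal_div]
    have := (hlim1.sub hlim2).div_const (∫⁻ u, tail f u).toReal
    rw [sub_zero] at this
    exact this.congr fun t => (heq t).symm
  have hne : (∫⁻ t, z t) / ∫⁻ u, tail f u ≠ ∞ := ENNReal.div_ne_top hzi h.lintegral_tail_ne_zero
  have := ENNReal.tendsto_ofReal hfinal
  rw [ENNReal.ofReal_toReal hne] at this
  exact this.congr fun t => ENNReal.ofReal_toReal (hfin t)

omit h in
-- The smoothed function is a difference quotient of the primitive of a bounded function, which is
-- Lipschitz.
lemma uniformContinuous_smooth {φ : ℝ → ℝ≥0∞} (hφ : Measurable φ) {B : ℝ≥0∞} (hB : B ≠ ∞)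
    (hle : ∀ t, φ t ≤ B) {δ : ℝ} (hδ : 0 < δ) :
    UniformContinuous fun t => (smooth δ φ t).toReal := by
  set ψ : ℝ → ℝ := fun t => (φ t).toReal with hψ
  have hψm : Measurable ψ := hφ.ennreal_toReal
  have hψb : ∀ t, ‖ψ t‖ ≤ B.toReal := fun t => by
    rw [Real.norm_eq_abs, abs_of_nonneg ENNReal.toReal_nonneg]
    exact ENNReal.toReal_mono hB (hle t)
  have hii : ∀ a b, IntervalIntegrable ψ volume a b := fun a b =>
    (intervalIntegrable_const (c := B.toReal)).mono_fun hψm.aestronglyMeasurable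
      (ae_of_all _ fun t => (hψb t).trans (le_abs_self _))
  have hF : UniformContinuous fun x => ∫ s in (0 : ℝ)..x, ψ s := by
    refine (LipschitzWith.of_dist_le_mul (K := B.toReal.toNNReal) fun x y => ?_).uniformContinuous
    rw [dist_comm, dist_eq_norm, intervalIntegral.integral_interval_sub_left (hii _ _) (hii _ _),
      Real.coe_toNNReal _ ENNReal.toReal_nonneg, Real.dist_eq, abs_sub_comm]
    exact intervalIntegral.norm_integral_le_of_norm_le_const fun s _ => hψb s
  have heq : (fun t => (smooth δ φ t).toReal) = fun t => δ⁻¹ *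
      ((∫ s in (0 : ℝ)..t, ψ s) - ∫ s in (0 : ℝ)..(t - δ), ψ s) := by
    ext t
    rw [smooth, ENNReal.toReal_mul, ENNReal.toReal_inv, ENNReal.toReal_ofReal hδ.le]
    congr 1
    rw [intervalIntegral.integral_interval_sub_left (hii _ _) (hii _ _)]
    have := intervalIntegral.integral_comp_sub_left (a := 0) (b := δ) ψ t
    rw [sub_zero] at this
    rw [← this, intervalIntegral.integral_of_le hδ.le, integral_toReal]
    · exact (hφ.comp (measurable_const.sub measurable_id)).aemeasurable
    · exact ae_of_all _ fun s => (hle _).trans_lt hB.lt_top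
  rw [heq]
  exact (hF.sub (hF.comp (uniformContinuous_id.sub uniformContinuous_const))).const_mul' δ⁻¹

lemma tendsto_pot_smooth (hm : ∫⁻ u, tail f u ≠ ∞) {w : ℝ → ℝ≥0∞} {c : ℝ≥0∞} (hw : Decr w c)
    {δ : ℝ} (hδ : 0 < δ) :
    Tendsto (pot U (smooth δ w)) atTop (𝓝 ((∫⁻ t, w t) / ∫⁻ u, tail f u)) := by
  have := h.sfinite
  obtain ⟨K, hK, hKb⟩ := h.exists_pot_bound
  have hB : K * (c + ∫⁻ s, w s) ≠ ∞ := ENNReal.mul_ne_top hK (ENNReal.add_ne_top.2 ⟨hw.top, hw.int⟩)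
  rw [← lintegral_smooth hδ hw.meas]
  refine h.tendsto_pot_of_uniformContinuous hm (measurable_smooth hw.meas)
    (by rw [lintegral_smooth hδ hw.meas]; exact hw.int) (hw.tendsto_smooth hδ) hB (fun t => ?_) ?_
  · rw [pot_smooth hw.meas]
    exact smooth_le hδ fun s _ => hKb w c hw _
  · simp only [pot_smooth hw.meas]
    exact uniformContinuous_smooth (measurable_pot hw.meas) hB (hKb w c hw) hδ

/-- Bounds the error of the smoothing. The smoothed indicator of [0,2δ] has a potential converging
to 2δ over the mean; 3δ leaves room for a strict inequality. -/
lemma eventually_measure_Icc_le (hm : ∫⁻ u, tail f u ≠ ∞) {δ : ℝ} (hδ : 0 < δ) :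
    ∀ᶠ t in atTop, U (Icc (t - δ) t) ≤ ENNReal.ofReal (3 * δ) / ∫⁻ u, tail f u := by
  have := h.sfinite
  have hv : Decr ((Icc 0 (2 * δ)).indicator 1) 1 :=
    { meas := measurable_one.indicator measurableSet_Icc
      top := ENNReal.one_ne_top
      le := fun t => indicator_le_self _ _ _
      zero := fun t ht => indicator_of_notMem (fun h => by have := h.1; linarith) _
      anti := fun a ha b hb hab => by
        by_cases hb2 : b ∈ Icc 0 (2 * δ)
        · rw [indicator_of_mem hb2, indicator_of_mem]
          · rfl
          · exact ⟨(mem_Ioi.1 ha).le, hab.trans hb2.2⟩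
        · rw [indicator_of_notMem hb2]; exact zero_le
      int := by rw [lintegral_indicator_one measurableSet_Icc, Real.volume_Icc]; exact ENNReal.ofReal_ne_top }
  -- After the shift by δ the smoothing window stays inside [0,2δ] whenever t - y is in [0,δ], so
  -- the smoothed indicator is at least 1 there.
  have hlim := (h.tendsto_pot_smooth hm hv hδ).comp (tendsto_atTop_add_const_right _ δ tendsto_id)
  have hlt : (∫⁻ t, (Icc 0 (2 * δ)).indicator (1 : ℝ → ℝ≥0∞) t) / ∫⁻ u, tail f u <
      ENNReal.ofReal (3 * δ) / ∫⁻ u, tail f u := by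
    rw [lintegral_indicator_one measurableSet_Icc, Real.volume_Icc]
    refine ENNReal.div_lt_div_right h.lintegral_tail_ne_zero hm ?_
    rw [ENNReal.ofReal_lt_ofReal_iff (by positivity)]; linarith
  filter_upwards [hlim.eventually (gt_mem_nhds hlt)] with t ht
  refine le_trans ?_ ht.le
  have := h.pot_indicator_Icc δ t 1
  simp only [one_mul] at this
  rw [← this]
  refine lintegral_mono fun y => ?_
  by_cases hy : t - y ∈ Icc 0 δ
  · rw [indicator_of_mem hy]
    refine le_smooth hδ fun s hs => ?_
    have hs' : t + δ - y - s ∈ Icc 0 (2 * δ) := by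
      rw [mem_Icc] at hy ⊢
      rw [mem_Ioc] at hs
      constructor <;> linarith
    exact (indicator_of_mem hs' (1 : ℝ → ℝ≥0∞)).ge
  · rw [indicator_of_notMem hy]; exact zero_le

/-- **Key renewal theorem** for an atomless law and a function decreasing on `(0, ∞)`. -/
theorem tendsto_pot (hm : ∫⁻ u, tail f u ≠ ∞) {w : ℝ → ℝ≥0∞} {c : ℝ≥0∞} (hw : Decr w c) :
    Tendsto (pot U w) atTop (𝓝 ((∫⁻ t, w t) / ∫⁻ u, tail f u)) := by
  have := h.sfinite
  set L := (∫⁻ t, w t) / ∫⁻ u, tail f u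
  have hm0 := h.lintegral_tail_ne_zero
  have hL : L ≠ ∞ := ENNReal.div_ne_top hw.int hm0
  -- The smoothing error, c times the mass of a window of length δ, is asymptotically at most this,
  -- so δ can be chosen to make it small.
  have herr : Tendsto (fun δ : ℝ => c * (ENNReal.ofReal (3 * δ) / ∫⁻ u, tail f u)) (𝓝[>] 0) (𝓝 0) := by
    have h1 : Tendsto (fun δ : ℝ => ENNReal.ofReal (3 * δ)) (𝓝[>] 0) (𝓝 0) := by
      have : Tendsto (fun δ : ℝ => ENNReal.ofReal (3 * δ)) (𝓝 0) (𝓝 (ENNReal.ofReal (3 * 0))) :=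
        ENNReal.tendsto_ofReal (tendsto_id.const_mul 3)
      simpa using this.mono_left nhdsWithin_le_nhds
    have h2 := ENNReal.Tendsto.const_mul (a := c)
      (ENNReal.Tendsto.div_const h1 (b := ∫⁻ u, tail f u) (Or.inr hm0)) (Or.inr hw.top)
    simpa using h2
  refine ENNReal.tendsto_nhds hL |>.2 fun η hη => ?_
  have hη2 : 0 < η / 2 := ENNReal.half_pos hη.ne'
  obtain ⟨δ, hδe, hδ⟩ := ((herr.eventually (gt_mem_nhds hη2)).and self_mem_nhdsWithin).exists
  have hlim := h.tendsto_pot_smooth hm hw hδ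
  have hev := (ENNReal.tendsto_nhds hL).1 hlim (η / 2) hη2
  have hsh : Tendsto (fun t : ℝ => t + δ) atTop atTop := tendsto_atTop_add_const_right _ δ tendsto_id
  have hU := h.eventually_measure_Icc_le hm hδ
  -- The two sides of the sandwich look at the smoothed potential at t (upper bound) and at t + δ
  -- (lower bound).
  filter_upwards [hev, hsh.eventually hev, hU, hsh.eventually hU] with t h1 h2 h3 h4
  have hadd : ∀ s, ∫⁻ y, (smooth δ w (s - y) + c * (Icc 0 δ).indicator 1 (s - y)) ∂U =
      pot U (smooth δ w) s + c * U (Icc (s - δ) s) := fun s => by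
    rw [lintegral_add_left (f := fun y => smooth δ w (s - y))
      ((measurable_smooth hw.meas).comp (measurable_const.sub measurable_id)),
      h.pot_indicator_Icc, pot]
  have hadd2 : ∀ s, ∫⁻ y, (w (s - y) + c * (Icc 0 δ).indicator 1 (s + δ - y)) ∂U =
      pot U w s + c * U (Icc (s + δ - δ) (s + δ)) := fun s => by
    rw [lintegral_add_left (f := fun y => w (s - y))
      (hw.meas.comp (measurable_const.sub measurable_id)), h.pot_indicator_Icc, pot]
  constructor
  · rw [tsub_le_iff_right]
    calc L ≤ pot U (smooth δ w) (t + δ) + η / 2 := tsub_le_iff_right.1 h2.1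
      _ ≤ (pot U w t + c * U (Icc (t + δ - δ) (t + δ))) + η / 2 := by
          gcongr
          rw [← hadd2]
          refine lintegral_mono fun y => ?_
          have := hw.smooth_le_add hδ (t - y)
          rwa [show t - y + δ = t + δ - y by ring] at this
      _ ≤ (pot U w t + η / 2) + η / 2 := by
          gcongr
          exact (mul_le_mul_right h4 c).trans hδe.le
      _ = pot U w t + η := by rw [add_assoc, ENNReal.add_halves]
  · calc pot U w t ≤ pot U (smooth δ w) t + c * U (Icc (t - δ) t) := by
          rw [← hadd]
          exact lintegral_mono fun y => hw.le_smooth_add hδ _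
      _ ≤ (L + η / 2) + η / 2 := by
          gcongr
          · exact h1.2
          · exact (mul_le_mul_right h3 c).trans hδe.le
      _ = L + η := by rw [add_assoc, ENNReal.add_halves]

end IsRenewal

end Renewal

/-! ### Convolution of measures on the line -/

namespace SemiMarkov

section Conv

lemma conv_sum {ι : Type*} [Countable ι] (μ : Measure ℝ) (ν : ι → Measure ℝ)
    [∀ i, SFinite (ν i)] : μ ∗ Measure.sum ν = Measure.sum fun i => μ ∗ ν i := by
  refine Measure.ext_of_lintegral _ fun w hw => ?_
  have hw' : ∀ i, Measurable fun x => ∫⁻ y, w (x + y) ∂ν i := fun i =>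
    Measurable.lintegral_prod_right' (f := fun p : ℝ × ℝ => w (p.1 + p.2)) (by fun_prop)
  simp only [Measure.lintegral_conv hw, lintegral_sum_measure]
  rw [lintegral_tsum fun i => (hw' i).aemeasurable]

lemma sum_conv {ι : Type*} (μ : ι → Measure ℝ) (ν : Measure ℝ) [SFinite ν] :
    Measure.sum μ ∗ ν = Measure.sum fun i => μ i ∗ ν := by
  refine Measure.ext_of_lintegral _ fun w hw => ?_
  simp only [Measure.lintegral_conv hw, lintegral_sum_measure]

lemma conv_univ (μ ν : Measure ℝ) [SFinite ν] : (μ ∗ ν) univ = μ univ * ν univ := by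
  rw [← lintegral_one, Measure.lintegral_conv measurable_const]
  simp [mul_comm]

lemma ae_nonneg {μ : Measure ℝ} (h : μ (Iio 0) = 0) : ∀ᵐ x ∂μ, 0 ≤ x := by
  rw [ae_iff]
  exact measure_mono_null (fun x hx => not_le.1 hx) h

lemma conv_Iio_zero {μ ν : Measure ℝ} [SFinite ν] (hμ : μ (Iio 0) = 0) (hν : ν (Iio 0) = 0) :
    (μ ∗ ν) (Iio 0) = 0 := by
  rw [← lintegral_indicator_one measurableSet_Iio,
    Measure.lintegral_conv (measurable_one.indicator measurableSet_Iio)]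
  have h1 := ae_nonneg hμ
  have h2 := ae_nonneg hν
  rw [lintegral_congr_ae (g := fun _ => 0), lintegral_zero]
  filter_upwards [h1] with x hx
  rw [lintegral_congr_ae (g := fun _ => 0), lintegral_zero]
  filter_upwards [h2] with y hy
  exact indicator_of_notMem (by simp only [mem_Iio, not_lt]; linarith) _

lemma conv_singleton {μ ν : Measure ℝ} [SFinite ν] (hν : ∀ c, ν {c} = 0) (c : ℝ) :
    (μ ∗ ν) {c} = 0 := by
  rw [← lintegral_indicator_one (measurableSet_singleton c),
    Measure.lintegral_conv (measurable_one.indicator (measurableSet_singleton c))]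
  rw [lintegral_congr (g := fun _ => 0), lintegral_zero]
  intro x
  rw [← hν (c - x), ← lintegral_indicator_one (measurableSet_singleton _)]
  refine lintegral_congr fun y => ?_
  simp only [indicator, mem_singleton_iff]
  congr 1
  exact propext ⟨fun _ => by linarith, fun _ => by linarith⟩

end Conv

/-! ### The Markov renewal kernel and the return law to `j` -/

section Kernel

variable {S : Type*} (D : Params S)

/-- The measure `P_{ik} F_{ik}` on the real line. -/
noncomputable def law (i k : S) : Measure ℝ :=
  D.trans i k • (D.sojourn i k : Measure ℝ≥0).map ((↑) : ℝ≥0 → ℝ)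

instance law_sojourn_prob (i k : S) :
    IsProbabilityMeasure ((D.sojourn i k : Measure ℝ≥0).map ((↑) : ℝ≥0 → ℝ)) :=
  Measure.isProbabilityMeasure_map measurable_coe_nnreal_real.aemeasurable

lemma law_univ (i k : S) : law D i k univ = D.trans i k := by
  rw [law, Measure.smul_apply, measure_univ, smul_eq_mul, mul_one]

instance law_finite (i k : S) : IsFiniteMeasure (law D i k) :=
  ⟨by rw [law_univ]; exact (PMF.apply_ne_top _ _).lt_top⟩

lemma law_Iio (i k : S) : law D i k (Iio 0) = 0 := by
  rw [law, Measure.smul_apply, Measure.map_apply measurable_coe_nnreal_real measurableSet_Iio]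
  have : ((↑) : ℝ≥0 → ℝ) ⁻¹' Iio 0 = ∅ := by
    ext x; simp
  rw [this]; simp

variable {D} in
lemma law_singleton (hD : D.Admissible) (i k : S) (c : ℝ) : law D i k {c} = 0 := by
  rw [law, Measure.smul_apply,
    Measure.map_apply measurable_coe_nnreal_real (measurableSet_singleton c), smul_eq_mul]
  by_cases h : D.trans i k = 0
  · rw [h, zero_mul]
  · rcases lt_or_ge c 0 with hc | hc
    · have : ((↑) : ℝ≥0 → ℝ) ⁻¹' {c} = ∅ := by
        ext x
        simp only [mem_preimage, mem_singleton_iff, mem_empty_iff_false, iff_false]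
        have := x.coe_nonneg
        linarith
      rw [this]; simp
    · lift c to ℝ≥0 using hc
      have : ((↑) : ℝ≥0 → ℝ) ⁻¹' {(c : ℝ)} = {c} := by
        ext x; simp
      rw [this, hD.noAtoms i k h c, mul_zero]

lemma lintegral_law_ofReal (i k : S) :
    ∫⁻ x, ENNReal.ofReal x ∂law D i k = D.trans i k * D.meanSojournTo i k := by
  rw [law, lintegral_smul_measure, smul_eq_mul,
    lintegral_map ENNReal.measurable_ofReal measurable_coe_nnreal_real,
    lintegral_eq_lintegral_meas_lt _ (ae_of_all _ fun x => x.coe_nonneg)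
      measurable_coe_nnreal_real.aemeasurable]
  rfl

/-- One step of the Markov renewal kernel, acting on families of measures. -/
noncomputable def step (M : S → Measure ℝ) (k : S) : Measure ℝ :=
  Measure.sum fun l => M l ∗ law D l k

instance step_sFinite [Countable S] (M : S → Measure ℝ) [∀ l, SFinite (M l)] (k : S) :
    SFinite (step D M k) := by unfold step; infer_instance

lemma conv_step [Countable S] (μ : Measure ℝ) (M : S → Measure ℝ) [∀ l, SFinite (M l)] (k : S) :
    μ ∗ step D M k = step D (fun l => μ ∗ M l) k := by
  simp only [step, conv_sum, Measure.conv_assoc]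

lemma step_add (M N : S → Measure ℝ) [∀ l, SFinite (M l)] [∀ l, SFinite (N l)] (k : S) :
    step D (fun l => M l + N l) k = step D M k + step D N k := by
  refine Measure.ext_of_lintegral _ fun w hw => ?_
  simp only [step, lintegral_sum_measure, lintegral_add_measure, Measure.add_conv,
    ENNReal.tsum_add]

instance sFinite_finset_sum {ι : Type*} (s : Finset ι) (M : ι → Measure ℝ) [∀ i, SFinite (M i)] :
    SFinite (∑ i ∈ s, M i) := by
  classical
  induction s using Finset.induction_on with
  | empty => simp only [Finset.sum_empty]; infer_instance
  | insert a s ha ih => rw [Finset.sum_insert ha]; infer_instance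

lemma step_zero (k : S) : step D (fun _ => 0) k = 0 := by
  simp [step, Measure.zero_conv]

lemma step_finset_sum {ι : Type*} (s : Finset ι) (M : ι → S → Measure ℝ)
    [∀ i l, SFinite (M i l)] (k : S) :
    step D (fun l => ∑ i ∈ s, M i l) k = ∑ i ∈ s, step D (M i) k := by
  classical
  induction s using Finset.induction_on with
  | empty => simp only [Finset.sum_empty, step_zero]
  | insert a s ha ih => simp only [Finset.sum_insert ha]; rw [step_add, ih]

lemma step_univ (M : S → Measure ℝ) (k : S) :
    step D M k univ = ∑' l, M l univ * D.trans l k := by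
  rw [step, Measure.sum_apply _ MeasurableSet.univ]
  simp only [conv_univ, law_univ]

variable (j : S)

open Classical in
/-- The law of `S_n` on `{J_n = k}` for the chain started in `j` at time `0`. -/
noncomputable def occ : ℕ → S → Measure ℝ
  | 0, k => if k = j then Measure.dirac 0 else 0
  | n + 1, k => step D (occ n) k

open Classical in
/-- The law of `S_n` on `{J_n = k}`, without a return to `j` up to time `n`. -/
noncomputable def taboo : ℕ → S → Measure ℝ
  | 0, k => if k = j then Measure.dirac 0 else 0
  | n + 1, k => if k = j then 0 else step D (taboo n) k

/-- The law of `S_{n+1}` on the event that the first return to `j` takes `n + 1` steps. -/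
noncomputable def firstReturn (n : ℕ) : Measure ℝ := step D (taboo D j n) j

/-- The law of the return time to `j`. -/
noncomputable def returnLaw : Measure ℝ := Measure.sum (firstReturn D j)

/-- The renewal measure of the visits to `j`. -/
noncomputable def renewalMeasure : Measure ℝ := Measure.sum fun n => occ D j n j

variable [Countable S]

instance occ_sFinite (n : ℕ) (k : S) : SFinite (occ D j n k) := by
  induction n generalizing k with
  | zero => rw [occ]; split_ifs <;> infer_instance
  | succ n ih => rw [occ]; infer_instance

instance taboo_sFinite (n : ℕ) (k : S) : SFinite (taboo D j n k) := by
  induction n generalizing k with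
  | zero => rw [taboo]; split_ifs <;> infer_instance
  | succ n ih => rw [taboo]; split_ifs <;> infer_instance

instance firstReturn_sFinite (n : ℕ) : SFinite (firstReturn D j n) := by
  unfold firstReturn; infer_instance

instance returnLaw_sFinite : SFinite (returnLaw D j) := by
  unfold returnLaw; infer_instance

instance renewalMeasure_sFinite : SFinite (renewalMeasure D j) := by
  unfold renewalMeasure; infer_instance

/-- The taboo recursion discards the mass arriving in `j`; that mass is the first return, put back
at `j` by `occ D j 0`, a unit mass there and zero elsewhere. -/
lemma step_taboo (n : ℕ) (k : S) :
    step D (taboo D j n) k = taboo D j (n + 1) k + firstReturn D j n ∗ occ D j 0 k := by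
  rw [taboo, occ]
  by_cases h : k = j
  · subst h
    rw [if_pos rfl, if_pos rfl, zero_add, Measure.conv_dirac_zero]; rfl
  · rw [if_neg h, if_neg h, Measure.conv_zero, add_zero]

/-- First-return decomposition: either no return has occurred, or the first one takes p.1 + 1 steps
and p.2 steps remain. -/
lemma occ_succ (n : ℕ) (k : S) :
    occ D j (n + 1) k = taboo D j (n + 1) k +
      ∑ p ∈ Finset.HasAntidiagonal.antidiagonal n, firstReturn D j p.1 ∗ occ D j p.2 k := by
  induction n generalizing k with
  | zero =>
    have h0 : occ D j 0 = taboo D j 0 := by ext1 k; rw [occ, taboo]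
    rw [occ, h0, step_taboo]
    simp
  | succ n ih =>
    rw [occ, show occ D j (n + 1) = fun l => _ from funext ih, step_add, step_taboo,
      Finset.Nat.sum_antidiagonal_succ', step_finset_sum, add_assoc]
    simp only [← conv_step]
    rfl

lemma tsum_antidiagonal (a : ℕ × ℕ → ℝ≥0∞) :
    ∑' n, ∑ p ∈ Finset.HasAntidiagonal.antidiagonal n, a p = ∑' m, ∑' i, a (m, i) := by
  rw [← ENNReal.tsum_prod (f := fun m i => a (m, i)),
    ← Finset.HasAntidiagonal.sigmaAntidiagonalEquivProd.tsum_eq, ENNReal.tsum_sigma']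
  refine tsum_congr fun n => ?_
  rw [← Finset.tsum_subtype]
  rfl

lemma taboo_self (n : ℕ) : taboo D j (n + 1) j = 0 := by
  rw [taboo, if_pos rfl]

lemma occ_zero_self : occ D j 0 j = Measure.dirac 0 := by
  rw [occ, if_pos rfl]

/-- Sum the first-return decomposition at `j` over all n; the taboo part vanishes at `j`. -/
lemma renewalMeasure_eq :
    renewalMeasure D j = Measure.dirac 0 + returnLaw D j ∗ renewalMeasure D j := by
  refine Measure.ext_of_lintegral _ fun w hw => ?_
  rw [lintegral_add_measure]
  conv_lhs => rw [renewalMeasure, lintegral_sum_measure, tsum_eq_zero_add' ENNReal.summable]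
  rw [occ_zero_self]
  congr 1
  simp only [occ_succ, taboo_self, zero_add, lintegral_finsetSum_measure]
  rw [tsum_antidiagonal fun p => ∫⁻ a, w a ∂(firstReturn D j p.1 ∗ occ D j p.2 j)]
  rw [returnLaw, sum_conv, lintegral_sum_measure]
  refine tsum_congr fun m => ?_
  rw [renewalMeasure, conv_sum, lintegral_sum_measure]

lemma taboo_univ (n : ℕ) (k : S) : taboo D j n k univ = avoid D.trans j n k := by
  induction n generalizing k with
  | zero => rw [taboo, avoid]; split_ifs <;> simp
  | succ n ih =>
    rw [taboo, avoid]
    split_ifs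
    · simp
    · rw [step_univ]; simp only [ih]

lemma occ_zero_univ : ∑' k, occ D j 0 k univ = 1 := by
  classical
  simp only [occ, apply_ite (fun μ : Measure ℝ => μ univ)]
  simp

/-- Conservation of mass: those that have not returned by step n either return at step n + 1 or
survive it. -/
lemma tsum_avoid_succ (n : ℕ) :
    ∑' k, avoid D.trans j (n + 1) k + firstReturn D j n univ = ∑' k, avoid D.trans j n k := by
  have h1 : ∑' k, step D (taboo D j n) k univ = ∑' k, avoid D.trans j n k := by
    simp only [step_univ, taboo_univ]
    rw [ENNReal.tsum_comm]
    simp only [ENNReal.tsum_mul_left, PMF.tsum_coe, mul_one]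
  rw [← h1]
  simp only [step_taboo, Measure.add_apply, conv_univ, taboo_univ]
  rw [ENNReal.tsum_add, ENNReal.tsum_mul_left, occ_zero_univ, mul_one]

lemma tsum_avoid_zero : ∑' k, avoid D.trans j 0 k = 1 := by
  classical
  simp [avoid]

lemma sum_firstReturn_univ (N : ℕ) :
    ∑ n ∈ Finset.range N, firstReturn D j n univ + ∑' k, avoid D.trans j N k = 1 := by
  induction N with
  | zero => simp [tsum_avoid_zero]
  | succ N ih =>
    rw [Finset.sum_range_succ, add_assoc, add_comm (firstReturn D j N univ), tsum_avoid_succ, ih]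

variable {D}

/-- The expected return time is the sum of these survival probabilities, and it is finite. -/
lemma tendsto_tsum_avoid (hD : D.Admissible) :
    Tendsto (fun n => ∑' k, avoid D.trans j n k) atTop (𝓝 0) :=
  ENNReal.tendsto_atTop_zero_of_tsum_ne_top (hD.positiveRecurrent j).ne

lemma returnLaw_univ (hD : D.Admissible) : returnLaw D j univ = 1 := by
  rw [returnLaw, Measure.sum_apply _ MeasurableSet.univ]
  have h1 := (ENNReal.tendsto_nat_tsum fun n => firstReturn D j n univ).add (tendsto_tsum_avoid j hD)
  simp only [sum_firstReturn_univ, add_zero] at h1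
  exact tendsto_nhds_unique h1 tendsto_const_nhds

lemma taboo_Iio (n : ℕ) (k : S) : taboo D j n k (Iio 0) = 0 := by
  induction n generalizing k with
  | zero =>
    rw [taboo]
    split_ifs
    · rw [Measure.dirac_apply' _ measurableSet_Iio]; simp
    · simp
  | succ n ih =>
    rw [taboo]
    split_ifs
    · simp
    · rw [step, Measure.sum_apply _ measurableSet_Iio]
      simp [conv_Iio_zero (ih _) (law_Iio D _ _)]

lemma firstReturn_Iio (n : ℕ) : firstReturn D j n (Iio 0) = 0 := by
  rw [firstReturn, step, Measure.sum_apply _ measurableSet_Iio]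
  simp [conv_Iio_zero (taboo_Iio j n _) (law_Iio D _ _)]

lemma returnLaw_Iio : returnLaw D j (Iio 0) = 0 := by
  rw [returnLaw, Measure.sum_apply _ measurableSet_Iio]
  simp [firstReturn_Iio]

lemma returnLaw_singleton (hD : D.Admissible) (c : ℝ) : returnLaw D j {c} = 0 := by
  rw [returnLaw, Measure.sum_apply _ (measurableSet_singleton c)]
  simp only [firstReturn, step, Measure.sum_apply _ (measurableSet_singleton c),
    conv_singleton (law_singleton hD _ _), tsum_zero]

/-- The function `x ↦ e^{-x}` with values in `[0, ∞]`. -/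
noncomputable def expNeg (x : ℝ) : ℝ≥0∞ := ENNReal.ofReal (Real.exp (-x))

lemma measurable_expNeg : Measurable expNeg := by
  unfold expNeg; fun_prop

lemma lintegral_expNeg_conv (μ ν : Measure ℝ) [SFinite ν] :
    ∫⁻ x, expNeg x ∂(μ ∗ ν) = (∫⁻ x, expNeg x ∂μ) * ∫⁻ x, expNeg x ∂ν := by
  rw [Measure.lintegral_conv measurable_expNeg, ← lintegral_mul_const _ measurable_expNeg]
  refine lintegral_congr fun x => ?_
  rw [← lintegral_const_mul _ measurable_expNeg]
  refine lintegral_congr fun y => ?_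
  rw [expNeg, expNeg, expNeg, ← ENNReal.ofReal_mul (Real.exp_pos _).le, ← Real.exp_add]
  congr 2; ring

lemma lintegral_expNeg_le {μ : Measure ℝ} (h : μ (Iio 0) = 0) : ∫⁻ x, expNeg x ∂μ ≤ μ univ := by
  rw [← lintegral_one]
  refine lintegral_mono_ae ?_
  have h1 := ae_nonneg h
  filter_upwards [h1] with x hx
  rw [expNeg]
  exact ENNReal.ofReal_le_one.2 (Real.exp_le_one_iff.2 (by linarith))

/-- Return times are almost surely positive, the return law having no atom at 0. -/
lemma lintegral_expNeg_returnLaw_lt (hD : D.Admissible) : ∫⁻ x, expNeg x ∂returnLaw D j < 1 := by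
  have huniv := returnLaw_univ j hD
  have h0 : ∀ᵐ x ∂returnLaw D j, 0 < x := by
    rw [ae_iff]
    have : {a : ℝ | ¬ 0 < a} = Iio 0 ∪ {0} := by
      ext x; simp [le_iff_lt_or_eq]
    rw [this]
    exact measure_union_null (returnLaw_Iio j) (returnLaw_singleton j hD 0)
  have hne : returnLaw D j ≠ 0 := by
    intro h
    rw [h] at huniv; simp at huniv
  have := lintegral_strict_mono (μ := returnLaw D j) (f := expNeg) (g := fun _ => 1) hne
    aemeasurable_const
    (ne_top_of_le_ne_top (by rw [huniv]; exact ENNReal.one_ne_top)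
      (lintegral_expNeg_le (returnLaw_Iio j))) (by
      filter_upwards [h0] with x hx
      rw [expNeg]
      exact ENNReal.ofReal_lt_one.2 (Real.exp_lt_one_iff.2 (by linarith)))
  simpa [huniv] using this

lemma lintegral_expNeg_occ_le (n : ℕ) : ∑' k, ∫⁻ x, expNeg x ∂occ D j n k ≤ 1 := by
  induction n with
  | zero =>
    rw [← occ_zero_univ D j]
    refine ENNReal.tsum_le_tsum fun k => lintegral_expNeg_le ?_
    rw [occ]
    split_ifs
    · rw [Measure.dirac_apply' _ measurableSet_Iio]; simp
    · simp
  | succ n ih =>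
    refine le_trans ?_ ih
    simp only [occ, step, lintegral_sum_measure, lintegral_expNeg_conv]
    rw [ENNReal.tsum_comm]
    refine ENNReal.tsum_le_tsum fun l => ?_
    rw [ENNReal.tsum_mul_left]
    refine mul_le_of_le_one_right' ?_
    rw [← PMF.tsum_coe (D.trans l)]
    refine ENNReal.tsum_le_tsum fun k => ?_
    rw [← law_univ]
    exact lintegral_expNeg_le (law_Iio D l k)

/-- The Laplace transform at 1 turns the first-return decomposition into a scalar renewal recursion,
so the partial sums satisfy V_{N+1} ≤ φ V_N + 1 with φ < 1 and stay below (1 - φ)⁻¹. -/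
lemma lintegral_expNeg_renewalMeasure (hD : D.Admissible) :
    ∫⁻ x, expNeg x ∂renewalMeasure D j ≠ ∞ := by
  set φ := ∫⁻ x, expNeg x ∂returnLaw D j with hφ
  have hφ1 : φ < 1 := lintegral_expNeg_returnLaw_lt j hD
  set v : ℕ → ℝ≥0∞ := fun n => ∫⁻ x, expNeg x ∂occ D j n j with hv
  set r : ℕ → ℝ≥0∞ := fun n => ∫⁻ x, expNeg x ∂firstReturn D j n with hr
  have hsr : ∑' n, r n = φ := by rw [hφ, returnLaw, lintegral_sum_measure]
  have hvs : ∀ n, v (n + 1) = ∑ p ∈ Finset.HasAntidiagonal.antidiagonal n, r p.1 * v p.2 := by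
    intro n
    simp only [hv, hr, occ_succ, taboo_self, zero_add, lintegral_finsetSum_measure,
      lintegral_expNeg_conv]
  have hv0 : v 0 ≤ 1 := (ENNReal.le_tsum j).trans (lintegral_expNeg_occ_le (D := D) j 0)
  have hne : 1 - φ ≠ 0 := (tsub_pos_of_lt hφ1).ne'
  have hmul : (1 - φ) * (1 - φ)⁻¹ = 1 :=
    ENNReal.mul_inv_cancel hne (ne_top_of_le_ne_top ENNReal.one_ne_top tsub_le_self)
  have hb : ∀ N, ∑ n ∈ Finset.range N, v n ≤ (1 - φ)⁻¹ := by
    intro N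
    induction N with
    | zero => simp
    | succ N ih =>
      rw [Finset.sum_range_succ']
      -- Truncating v at N changes nothing in the antidiagonals n < N, and lets the sum be enlarged
      -- to a full product φ · V_N that is known to be finite by induction.
      set v' : ℕ → ℝ≥0∞ := fun n => if n ∈ Finset.range N then v n else 0 with hv'
      have hv's : ∑' n, v' n = ∑ n ∈ Finset.range N, v n := by
        rw [tsum_eq_sum (s := Finset.range N) (fun n hn => by rw [hv']; simp only; rw [if_neg hn])]
        exact Finset.sum_congr rfl fun n hn => by rw [hv']; simp only; rw [if_pos hn]
      have h1 : ∑ n ∈ Finset.range N, v (n + 1) ≤ φ * (1 - φ)⁻¹ := by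
        calc ∑ n ∈ Finset.range N, v (n + 1)
            = ∑ n ∈ Finset.range N, ∑ p ∈ Finset.HasAntidiagonal.antidiagonal n, r p.1 * v' p.2 := by
              refine Finset.sum_congr rfl fun n hn => ?_
              rw [hvs]
              refine Finset.sum_congr rfl fun p hp => ?_
              have hp' := Finset.HasAntidiagonal.mem_antidiagonal.1 hp
              have : p.2 ∈ Finset.range N := by
                rw [Finset.mem_range] at *; omega
              rw [hv']; simp only; rw [if_pos this]
          _ ≤ ∑' n, ∑ p ∈ Finset.HasAntidiagonal.antidiagonal n, r p.1 * v' p.2 := ENNReal.sum_le_tsum _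
          _ = φ * ∑ n ∈ Finset.range N, v n := by
              rw [tsum_antidiagonal fun p => r p.1 * v' p.2]
              simp only [ENNReal.tsum_mul_left, ENNReal.tsum_mul_right, hsr, hv's]
          _ ≤ _ := by gcongr
      calc _ ≤ φ * (1 - φ)⁻¹ + 1 := add_le_add h1 hv0
        _ = φ * (1 - φ)⁻¹ + (1 - φ) * (1 - φ)⁻¹ := by rw [hmul]
        _ = (1 - φ)⁻¹ := by rw [← add_mul, add_tsub_cancel_of_le hφ1.le, one_mul]
  rw [renewalMeasure, lintegral_sum_measure]
  refine ne_top_of_le_ne_top (ENNReal.inv_ne_top.2 hne) ?_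
  rw [ENNReal.tsum_eq_iSup_nat]
  exact iSup_le hb

/-- Markov's inequality: e^{-x} ≥ e^{-t} for x ≤ t. -/
lemma renewalMeasure_Iic_ne_top (hD : D.Admissible) (t : ℝ) : renewalMeasure D j (Iic t) ≠ ∞ := by
  have h1 := lintegral_expNeg_renewalMeasure j hD
  have h2 : expNeg t * renewalMeasure D j (Iic t) ≤ ∫⁻ x, expNeg x ∂renewalMeasure D j := by
    rw [← setLIntegral_const]
    refine (setLIntegral_mono' measurableSet_Iic fun x hx => ?_).trans (setLIntegral_le_lintegral _ _)
    exact ENNReal.ofReal_le_ofReal (Real.exp_le_exp.2 (neg_le_neg hx))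
  intro h
  rw [h, ENNReal.mul_top] at h2
  · exact h1 (top_le_iff.1 h2)
  · rw [expNeg]; simpa using Real.exp_pos _

theorem isRenewal (hD : D.Admissible) :
    Renewal.IsRenewal (returnLaw D j) (renewalMeasure D j) where
  prob := ⟨returnLaw_univ j hD⟩
  sfinite := inferInstance
  nonneg := returnLaw_Iio j
  noAtoms := returnLaw_singleton j hD
  eq := renewalMeasure_eq D j
  fin := renewalMeasure_Iic_ne_top j hD

lemma lintegral_ofReal_conv_le (μ ν : Measure ℝ) [SFinite ν] :
    ∫⁻ x, ENNReal.ofReal x ∂(μ ∗ ν) ≤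
      (∫⁻ x, ENNReal.ofReal x ∂μ) * ν univ + μ univ * ∫⁻ x, ENNReal.ofReal x ∂ν := by
  rw [Measure.lintegral_conv ENNReal.measurable_ofReal]
  calc _ ≤ ∫⁻ x, ∫⁻ y, (ENNReal.ofReal x + ENNReal.ofReal y) ∂ν ∂μ :=
        lintegral_mono fun x => lintegral_mono fun y => ENNReal.ofReal_add_le
    _ = _ := by
        simp only [lintegral_add_left measurable_const, lintegral_const]
        rw [lintegral_add_left (ENNReal.measurable_ofReal.mul_const _), lintegral_const,
          lintegral_mul_const _ ENNReal.measurable_ofReal, mul_comm (μ univ)]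

/-- The mean return time is finite. -/
lemma lintegral_returnLaw_ne_top (hD : D.Admissible) :
    ∫⁻ x, ENNReal.ofReal x ∂returnLaw D j ≠ ∞ := by
  set B : ℝ≥0∞ := ⨆ (i : S) (k : S) (_ : D.trans i k ≠ 0), D.meanSojournTo i k with hBdef
  have hB : B ≠ ∞ := hD.meanSojournTo_bdd.ne
  have hmean : ∀ l, ∑' k, ∫⁻ x, ENNReal.ofReal x ∂law D l k ≤ B := by
    intro l
    simp only [lintegral_law_ofReal]
    calc _ ≤ ∑' k, D.trans l k * B := by
          refine ENNReal.tsum_le_tsum fun k => ?_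
          by_cases hk : D.trans l k = 0
          · simp [hk]
          · gcongr
            exact le_iSup_of_le l (le_iSup_of_le k (le_iSup_of_le hk le_rfl))
      _ = B := by rw [ENNReal.tsum_mul_right, PMF.tsum_coe, one_mul]
  set e : ℕ → ℝ≥0∞ := fun n => ∑' k, ∫⁻ x, ENNReal.ofReal x ∂taboo D j n k with he
  set r : ℕ → ℝ≥0∞ := fun n => ∫⁻ x, ENNReal.ofReal x ∂firstReturn D j n with hr
  set a : ℕ → ℝ≥0∞ := fun n => ∑' k, avoid D.trans j n k with ha
  -- Balance of expected elapsed time: one more step adds at most B on the paths that have not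
  -- returned. Summing over n bounds the mean return time by B times the expected number of steps to
  -- return.
  have hstep : ∀ n, e (n + 1) + r n ≤ e n + a n * B := by
    intro n
    have h1 : e (n + 1) + r n ≤ ∑' k, ∫⁻ x, ENNReal.ofReal x ∂step D (taboo D j n) k := by
      simp only [step_taboo, lintegral_add_measure]
      rw [ENNReal.tsum_add]
      refine add_le_add le_rfl (le_trans (le_of_eq ?_) (ENNReal.le_tsum j))
      rw [occ_zero_self, Measure.conv_dirac_zero]
    refine h1.trans ?_
    simp only [step, lintegral_sum_measure]
    rw [ENNReal.tsum_comm]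
    calc _ ≤ ∑' l, (∫⁻ x, ENNReal.ofReal x ∂taboo D j n l + avoid D.trans j n l * B) := by
          refine ENNReal.tsum_le_tsum fun l => ?_
          calc _ ≤ ∑' k, ((∫⁻ x, ENNReal.ofReal x ∂taboo D j n l) * D.trans l k +
                avoid D.trans j n l * ∫⁻ x, ENNReal.ofReal x ∂law D l k) := by
                refine ENNReal.tsum_le_tsum fun k => ?_
                have := lintegral_ofReal_conv_le (taboo D j n l) (law D l k)
                rwa [law_univ, taboo_univ] at this
            _ ≤ _ := by
                rw [ENNReal.tsum_add, ENNReal.tsum_mul_left, ENNReal.tsum_mul_left, PMF.tsum_coe,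
                  mul_one]
                gcongr
                exact hmean l
      _ = _ := by rw [ENNReal.tsum_add, ENNReal.tsum_mul_right]
  have he0 : e 0 = 0 := by
    simp only [he, taboo]
    refine ENNReal.tsum_eq_zero.2 fun k => ?_
    split_ifs
    · rw [lintegral_dirac' _ ENNReal.measurable_ofReal]; simp
    · simp
  have hsum : ∀ N, ∑ n ∈ Finset.range N, r n + e N ≤ ∑ n ∈ Finset.range N, a n * B := by
    intro N
    induction N with
    | zero => simp [he0]
    | succ N ih =>
      rw [Finset.sum_range_succ, Finset.sum_range_succ, add_assoc, add_comm (r N)]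
      calc _ ≤ ∑ n ∈ Finset.range N, r n + (e N + a N * B) := add_le_add le_rfl (hstep N)
        _ ≤ _ := by rw [← add_assoc]; gcongr
  rw [returnLaw, lintegral_sum_measure, ENNReal.tsum_eq_iSup_nat]
  refine ne_top_of_le_ne_top (ENNReal.mul_ne_top (hD.positiveRecurrent j).ne hB)
    (iSup_le fun N => le_self_add.trans ((hsum N).trans ?_))
  rw [← Finset.sum_mul]
  gcongr
  exact ENNReal.sum_le_tsum _

lemma lintegral_tail_eq {f : Measure ℝ} (hf : f (Iio 0) = 0) :
    ∫⁻ u, Renewal.tail f u = ∫⁻ x, ENNReal.ofReal x ∂f := by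
  have h1 := ae_nonneg hf
  rw [lintegral_eq_lintegral_meas_lt f h1 aemeasurable_id]
  unfold Renewal.tail
  rw [lintegral_indicator measurableSet_Ici, restrict_Ioi_eq_restrict_Ici]
  rfl

lemma lintegral_tail_returnLaw_ne_top (hD : D.Admissible) :
    ∫⁻ u, Renewal.tail (returnLaw D j) u ≠ ∞ := by
  rw [lintegral_tail_eq (returnLaw_Iio j)]
  exact lintegral_returnLaw_ne_top j hD

end Kernel

end SemiMarkov

/-! ### Tightness of the forward recurrence time -/

namespace Renewal

lemma decr_tail {f : Measure ℝ} [IsProbabilityMeasure f] (hm : ∫⁻ u, tail f u ≠ ∞) :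
    Decr (tail f) 1 where
  meas := measurable_tail f
  top := ENNReal.one_ne_top
  le t := (indicator_le_self _ _ _).trans prob_le_one
  zero t ht := indicator_of_notMem (by simpa using ht) _
  anti a ha b hb hab := by
    rw [tail, indicator_of_mem (mem_Ici.2 (le_of_lt hb)), indicator_of_mem (mem_Ici.2 (le_of_lt ha))]
    exact measure_mono (Ioi_subset_Ioi hab)
  int := hm

/-- The probability that the forward recurrence time exceeds `y`, as a function of the time since
the last renewal. -/
noncomputable def overshoot (f : Measure ℝ) (y : ℝ) : ℝ → ℝ≥0∞ :=
  (Ici 0).indicator fun u => f (Ioi (u + y))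

lemma measurable_overshoot (f : Measure ℝ) (y : ℝ) : Measurable (overshoot f y) := by
  refine Measurable.indicator ?_ measurableSet_Ici
  have : Antitone fun u => f (Ioi (u + y)) := fun a b h =>
    measure_mono (Ioi_subset_Ioi (by linarith))
  exact this.measurable

/-- The potential bound for decreasing functions depends only on the supremum and the integral,
which here are at most f(y,∞) and ∫ f(u + y,∞) du; both vanish as y → ∞, the second by domination by
the tail. The bound is therefore uniform in t. -/
lemma IsRenewal.tendsto_overshoot {f U : Measure ℝ} (h : IsRenewal f U)
    (hm : ∫⁻ u, tail f u ≠ ∞) :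
    ∃ φ : ℝ → ℝ≥0∞, Tendsto φ atTop (𝓝 0) ∧ ∀ y, 0 ≤ y → ∀ t, pot U (overshoot f y) t ≤ φ y := by
  have := h.prob
  obtain ⟨K, hK, hKb⟩ := h.exists_pot_bound
  have hd := decr_tail hm
  have hle : ∀ y, 0 ≤ y → ∀ u, overshoot f y u ≤ tail f u := fun y hy u =>
    indicator_le_indicator (measure_mono (Ioi_subset_Ioi (by linarith)))
  have h0 : ∀ᶠ y in (atTop : Filter ℝ), (0 : ℝ) ≤ y := eventually_ge_atTop 0
  refine ⟨fun y => K * (f (Ioi y) + ∫⁻ u, overshoot f y u), ?_, fun y hy t => ?_⟩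
  · have h1 : Tendsto (fun y => f (Ioi y)) atTop (𝓝 0) := by
      refine hd.tendsto.congr' ?_
      filter_upwards [h0] with y hy
      exact indicator_of_mem (mem_Ici.2 hy) _
    have h2 : Tendsto (fun y => ∫⁻ u, overshoot f y u) atTop (𝓝 0) := by
      have := tendsto_lintegral_filter_of_dominated_convergence (μ := volume) (l := atTop)
        (F := fun y u => overshoot f y u) (f := fun _ => 0) (tail f)
        (Eventually.of_forall fun y => measurable_overshoot f y)
        (h0.mono fun y hy => ae_of_all _ (hle y hy)) hm
        (ae_of_all _ fun u => by
          have h3 : Tendsto (fun y => tail f (u + y)) atTop (𝓝 0) :=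
            hd.tendsto.comp (tendsto_atTop_add_const_left _ u tendsto_id)
          refine tendsto_of_tendsto_of_tendsto_of_le_of_le' tendsto_const_nhds h3
            (Eventually.of_forall fun _ => zero_le) ?_
          filter_upwards [h0] with y hy
          by_cases hu : 0 ≤ u
          · rw [overshoot, tail, indicator_of_mem (mem_Ici.2 hu),
              indicator_of_mem (mem_Ici.2 (add_nonneg hu hy))]
          · rw [overshoot, indicator_of_notMem (by simpa using hu)]; exact zero_le)
      simpa using this
    have := ENNReal.Tendsto.const_mul (a := K) (h1.add h2) (Or.inr hK)
    simpa using this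
  · refine hKb _ _ ⟨measurable_overshoot f y, measure_ne_top _ _, fun u => ?_, fun u hu => ?_,
      fun a ha b hb hab => ?_, ne_top_of_le_ne_top hm (lintegral_mono (hle y hy))⟩ t
    · by_cases hu : 0 ≤ u
      · rw [overshoot, indicator_of_mem (mem_Ici.2 hu)]
        exact measure_mono (Ioi_subset_Ioi (by linarith))
      · rw [overshoot, indicator_of_notMem (by simpa using hu)]; exact zero_le
    · exact indicator_of_notMem (by simpa using hu) _
    · rw [overshoot, indicator_of_mem (mem_Ici.2 (le_of_lt hb)),
        indicator_of_mem (mem_Ici.2 (le_of_lt ha))]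
      exact measure_mono (Ioi_subset_Ioi (by linarith))

end Renewal

/-! ### The sojourn tail in `j` and the limits of its potentials -/

namespace SemiMarkov

variable {S : Type*} (D : Params S) (j : S)

/-- The tail of the sojourn time in `j`. -/
noncomputable def holdTail (u : ℝ) : ℝ≥0∞ := ∑' k, law D j k (Ioi u)

lemma antitone_holdTail : Antitone (holdTail D j) := fun _ _ h =>
  ENNReal.tsum_le_tsum fun _ => measure_mono (Ioi_subset_Ioi h)

lemma holdTail_le_one (u : ℝ) : holdTail D j u ≤ 1 := by
  rw [← PMF.tsum_coe (D.trans j)]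
  refine ENNReal.tsum_le_tsum fun k => ?_
  rw [← law_univ]
  exact measure_mono (subset_univ _)

/-- The mean of the part of the sojourn time in `j` beyond `x`. -/
noncomputable def meanBeyond (x : ℝ≥0) : ℝ≥0∞ := ∑' k, D.trans j k * D.tailIntegral j k x

lemma lintegral_holdTail [Countable S] (x : ℝ≥0) :
    ∫⁻ u in Ioi (x : ℝ), holdTail D j u = meanBeyond D j x := by
  have hm : ∀ (μ : Measure ℝ), Measurable fun u => μ (Ioi u) := fun μ =>
    Antitone.measurable fun a b h => measure_mono (Ioi_subset_Ioi h)
  unfold holdTail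
  rw [lintegral_tsum fun k => (hm (law D j k)).aemeasurable]
  refine tsum_congr fun k => ?_
  have : ∀ u, law D j k (Ioi u) =
      D.trans j k * (D.sojourn j k : Measure ℝ≥0) {s | u < (s : ℝ)} := fun u => by
    rw [law, Measure.smul_apply, Measure.map_apply measurable_coe_nnreal_real measurableSet_Ioi]
    rfl
  simp only [this]
  rw [lintegral_const_mul' _ _ (PMF.apply_ne_top _ _)]
  rfl

lemma meanBeyond_le (x : ℝ≥0) : meanBeyond D j x ≤ D.meanSojourn j := by
  refine ENNReal.tsum_le_tsum fun k => ?_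
  gcongr
  exact lintegral_mono_set (Ioi_subset_Ioi x.coe_nonneg)

variable {D} in
lemma meanSojourn_ne_top (hD : D.Admissible) : D.meanSojourn j ≠ ∞ := by
  set B : ℝ≥0∞ := ⨆ (i : S) (k : S) (_ : D.trans i k ≠ 0), D.meanSojournTo i k
  refine ne_top_of_le_ne_top hD.meanSojournTo_bdd.ne (b := B) ?_
  calc D.meanSojourn j ≤ ∑' k, D.trans j k * B := by
        refine ENNReal.tsum_le_tsum fun k => ?_
        by_cases hk : D.trans j k = 0
        · simp [hk]
        · gcongr
          exact le_iSup_of_le j (le_iSup_of_le k (le_iSup_of_le hk le_rfl))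
    _ = B := by rw [ENNReal.tsum_mul_right, PMF.tsum_coe, one_mul]

variable {D} in
-- A possible transition with mean sojourn 0 would have its law concentrated at 0, which is excluded
-- by the absence of atoms.
lemma meanSojourn_ne_zero (hD : D.Admissible) : D.meanSojourn j ≠ 0 := by
  intro h0
  obtain ⟨k, hk⟩ := (D.trans j).support_nonempty
  rw [PMF.mem_support_iff] at hk
  have h1 := (ENNReal.tsum_eq_zero.1 h0) k
  rw [← lintegral_law_ofReal, lintegral_eq_zero_iff ENNReal.measurable_ofReal] at h1
  have h2 : ∀ᵐ x ∂law D j k, x = 0 := by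
    filter_upwards [h1, ae_nonneg (law_Iio D j k)] with x hx hx'
    exact le_antisymm (by simpa using hx) hx'
  have h3 : ∀ᵐ x ∂law D j k, x ≠ 0 := by
    rw [ae_iff]; simpa using law_singleton hD j k 0
  have h4 : ∀ᵐ x ∂law D j k, False := by
    filter_upwards [h2, h3] with x hx hx' using hx' hx
  rw [ae_iff] at h4
  simp only [not_false_eq_true] at h4
  exact hk (by rw [← law_univ]; exact h4)

section Limits

variable {D} [Countable S]

/-- The limit of `P_j[Y_t = j, residual time > x]`. -/
theorem tendsto_pot_holdTail_Ioi (hD : D.Admissible) (x : ℝ≥0) :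
    Tendsto (Renewal.pot (renewalMeasure D j) ((Ioi (x : ℝ)).indicator (holdTail D j))) atTop
      (𝓝 (meanBeyond D j x / ∫⁻ u, Renewal.tail (returnLaw D j) u)) := by
  have hmeas : Measurable ((Ioi (x : ℝ)).indicator (holdTail D j)) :=
    (antitone_holdTail D j).measurable.indicator measurableSet_Ioi
  have hint : ∫⁻ u, (Ioi (x : ℝ)).indicator (holdTail D j) (u + x) = meanBeyond D j x := by
    rw [lintegral_add_right_eq_self (fun u => (Ioi (x : ℝ)).indicator (holdTail D j) u),
      lintegral_indicator measurableSet_Ioi, lintegral_holdTail]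
  -- The indicator of (x,∞) jumps upwards at x, so the integrand is not decreasing on (0,∞).
  -- Translating by x moves the jump to 0, and a translation does not affect the limit.
  have hw : Renewal.Decr (fun u => (Ioi (x : ℝ)).indicator (holdTail D j) (u + x)) 1 :=
    { meas := hmeas.comp (measurable_id.add_const _)
      top := ENNReal.one_ne_top
      le := fun t => (indicator_le_self _ _ _).trans (holdTail_le_one D j _)
      zero := fun t ht => indicator_of_notMem (by simp only [mem_Ioi]; linarith) _
      anti := fun a ha b hb hab => by
        rw [mem_Ioi] at ha hb
        simp only
        rw [indicator_of_mem (by rw [mem_Ioi]; linarith),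
          indicator_of_mem (by rw [mem_Ioi]; linarith)]
        exact antitone_holdTail D j (by linarith)
      int := by
        rw [hint]
        exact ne_top_of_le_ne_top (meanSojourn_ne_top j hD) (meanBeyond_le D j x) }
  have := (isRenewal j hD).tendsto_pot (lintegral_tail_returnLaw_ne_top j hD) hw
  rw [hint] at this
  refine (this.comp (tendsto_atTop_add_const_right _ (-(x : ℝ)) tendsto_id)).congr fun t => ?_
  simp only [Renewal.pot, Function.comp, id]
  refine lintegral_congr fun y => ?_
  congr 1; ring

/-- The limit of `P_j[Y_t = j]`. -/
theorem tendsto_pot_holdTail_Ici (hD : D.Admissible) :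
    Tendsto (Renewal.pot (renewalMeasure D j) ((Ici 0).indicator (holdTail D j))) atTop
      (𝓝 (D.meanSojourn j / ∫⁻ u, Renewal.tail (returnLaw D j) u)) := by
  have hint : ∫⁻ u, (Ici 0).indicator (holdTail D j) u = D.meanSojourn j := by
    rw [lintegral_indicator measurableSet_Ici, ← restrict_Ioi_eq_restrict_Ici]
    exact lintegral_holdTail D j 0
  have hw : Renewal.Decr ((Ici 0).indicator (holdTail D j)) 1 :=
    { meas := (antitone_holdTail D j).measurable.indicator measurableSet_Ici
      top := ENNReal.one_ne_top
      le := fun t => (indicator_le_self _ _ _).trans (holdTail_le_one D j _)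
      zero := fun t ht => indicator_of_notMem (by simpa using ht) _
      anti := fun a ha b hb hab => by
        rw [indicator_of_mem (mem_Ici.2 (le_of_lt hb)), indicator_of_mem (mem_Ici.2 (le_of_lt ha))]
        exact antitone_holdTail D j hab
      int := by rw [hint]; exact meanSojourn_ne_top j hD }
  have := (isRenewal j hD).tendsto_pot (lintegral_tail_returnLaw_ne_top j hD) hw
  rwa [hint] at this

end Limits

/-! ### The embedded chain reaches `j` from every state -/

section Hitting

open Classical in
/-- The probability that the embedded chain started in `i` does not visit `j` at the times
`1, …, n`. -/
noncomputable def noHit : ℕ → S → ℝ≥0∞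
  | 0, _ => 1
  | n + 1, i => ∑' k, if k = j then 0 else D.trans i k * noHit n k

/-- Chapman–Kolmogorov for the chain killed at `j`: the forward recursion `avoid` and the backward
recursion `noHit` meet at time m. -/
lemma tsum_avoid_mul_noHit (m n : ℕ) :
    ∑' k, avoid D.trans j m k * noHit D j n k = noHit D j (m + n) j := by
  classical
  induction m generalizing n with
  | zero =>
    rw [tsum_eq_single j (fun k hk => by rw [avoid, if_neg hk, zero_mul])]
    rw [avoid, if_pos rfl, one_mul, zero_add]
  | succ m ih =>
    rw [show m + 1 + n = m + (n + 1) by omega, ← ih (n + 1)]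
    have h1 : ∀ k, avoid D.trans j (m + 1) k * noHit D j n k =
        ∑' l, avoid D.trans j m l * (if k = j then 0 else D.trans l k * noHit D j n k) := fun k => by
      rw [avoid]
      split_ifs
      · simp
      · rw [← ENNReal.tsum_mul_right]
        exact tsum_congr fun l => by ring
    simp only [h1]
    rw [ENNReal.tsum_comm]
    exact tsum_congr fun l => by rw [ENNReal.tsum_mul_left, noHit]

lemma noHit_succ_le (n : ℕ) (l : S) : noHit D j (n + 1) l ≤ noHit D j n l := by
  induction n generalizing l with
  | zero =>
    rw [noHit, noHit, ← PMF.tsum_coe (D.trans l)]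
    refine ENNReal.tsum_le_tsum fun k => ?_
    split_ifs
    · exact zero_le
    · rw [noHit, mul_one]
  | succ n ih =>
    rw [noHit, noHit]
    refine ENNReal.tsum_le_tsum fun k => ?_
    split_ifs
    · exact zero_le
    · gcongr; exact ih k

lemma noHit_self (n : ℕ) : noHit D j n j = ∑' k, avoid D.trans j n k := by
  have := tsum_avoid_mul_noHit D j n 0
  simp only [noHit, mul_one, add_zero] at this
  exact this.symm

variable {D} in
/-- From every state, `j` is reached almost surely. -/
lemma iInf_noHit [Countable S] (hD : D.Admissible) (i : S) : ⨅ n, noHit D j n i = 0 := by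
  have hj : ⨅ n, noHit D j n j = 0 := by
    refine le_antisymm ?_ zero_le
    refine ge_of_tendsto' (tendsto_tsum_avoid j hD) fun n => ?_
    rw [← noHit_self]; exact iInf_le _ n
  -- Induction along a path from `j` to i: if the last step l → i is possible with i ≠ j, a positive
  -- probability of missing `j` from i would give one from l.
  obtain ⟨n, hn⟩ := hD.irreducible j i
  induction n generalizing i with
  | zero =>
    rw [nStep, PMF.pure_apply] at hn
    by_cases h : i = j
    · rw [h, hj]
    · simp [h] at hn
  | succ n ih =>
    by_cases hi : i = j
    · rw [hi, hj]
    · rw [nStep, PMF.bind_apply] at hn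
      obtain ⟨l, hl⟩ : ∃ l, nStep D.trans j n l * D.trans l i ≠ 0 := by
        by_contra! hcon
        exact hn (ENNReal.tsum_eq_zero.2 hcon)
      obtain ⟨hl1, hl2⟩ := mul_ne_zero_iff.1 hl
      have h0 := ih l hl1
      have h1 : D.trans l i * ⨅ n, noHit D j n i ≤ ⨅ n, noHit D j (n + 1) l := by
        refine le_iInf fun n => ?_
        rw [noHit]
        refine le_trans ?_ (ENNReal.le_tsum i)
        rw [if_neg hi]
        gcongr
        exact iInf_le _ n
      have h2 : ⨅ n, noHit D j (n + 1) l = 0 := by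
        refine le_antisymm ?_ zero_le
        rw [← h0]
        refine le_iInf fun n => ?_
        exact (iInf_le _ n).trans (noHit_succ_le D j n l)
      rw [h2] at h1
      exact (mul_eq_zero.1 (le_antisymm h1 zero_le)).resolve_left hl2

end Hitting

end SemiMarkov

/-! ### The past of the chain and the Markov property -/

namespace SemiMarkov

section Past

variable {S Ω : Type*} [MeasurableSpace S] {J : ℕ → Ω → S} {T : ℕ → Ω → ℝ≥0}

lemma past_mono {m n : ℕ} (h : m ≤ n) : past J T m ≤ past J T n :=
  iSup₂_le fun l hl => le_iSup₂_of_le l (hl.trans h) le_rfl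

lemma measurable_J_past {m n : ℕ} (h : m ≤ n) : Measurable[past J T n] (J m) := by
  refine measurable_iff_comap_le.2 (le_trans ?_ (le_iSup₂_of_le m h le_rfl))
  exact le_sup_left

lemma measurable_T_past {m n : ℕ} (h : m ≤ n) : Measurable[past J T n] (T m) := by
  refine measurable_iff_comap_le.2 (le_trans ?_ (le_iSup₂_of_le m h le_rfl))
  exact le_sup_right

lemma measurable_jumpTime_past {m n : ℕ} (h : m ≤ n) : Measurable[past J T n] (jumpTime T m) := by
  let _ := past J T n
  unfold jumpTime
  exact Finset.measurable_sum _ fun i hi =>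
    measurable_T_past ((Nat.lt_succ_iff.1 (Finset.mem_range.1 hi)).trans h)

lemma measurableSet_J_past [DiscreteMeasurableSpace S] {m n : ℕ} (h : m ≤ n) (i : S) :
    MeasurableSet[past J T n] {ω | J m ω = i} :=
  measurable_J_past h (measurableSet_singleton i)

lemma jumpTime_mono (ω : Ω) : Monotone fun n => jumpTime T n ω := by
  intro a b h
  refine Finset.sum_le_sum_of_subset ?_
  intro i hi
  rw [Finset.mem_range] at *; omega

lemma jumpTime_succ (n : ℕ) (ω : Ω) : jumpTime T (n + 1) ω = jumpTime T n ω + T (n + 1) ω :=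
  Finset.sum_range_succ _ _

end Past

section Markov

variable {S Ω : Type*} [MeasurableSpace S] [MeasurableSpace Ω] {D : Params S}
  {μ : Measure Ω} {J : ℕ → Ω → S} {T : ℕ → Ω → ℝ≥0}

lemma past_le (h : IsChain D μ J T) (n : ℕ) : past J T n ≤ ‹MeasurableSpace Ω› :=
  iSup₂_le fun l _ => sup_le (measurable_iff_comap_le.1 (h.measurable_J l))
    (measurable_iff_comap_le.1 (h.measurable_T l))

lemma measurable_jumpTime (h : IsChain D μ J T) (n : ℕ) : Measurable (jumpTime T n) :=
  (measurable_jumpTime_past (J := J) le_rfl).mono (past_le h n) le_rfl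

lemma measurable_jumpTime_real (h : IsChain D μ J T) (n : ℕ) :
    Measurable fun ω => (jumpTime T n ω : ℝ) := (measurable_jumpTime h n).coe_nnreal_real

/-- The law of `S_n` on the event `C ∩ {J_n = k}`. -/
noncomputable def timeLaw (μ : Measure Ω) (J : ℕ → Ω → S) (T : ℕ → Ω → ℝ≥0) (C : Set Ω) (n : ℕ)
    (k : S) : Measure ℝ :=
  (μ.restrict (C ∩ {ω | J n ω = k})).map fun ω => (jumpTime T n ω : ℝ)

instance [IsFiniteMeasure μ] (C : Set Ω) (n : ℕ) (k : S) : IsFiniteMeasure (timeLaw μ J T C n k) := by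
  unfold timeLaw; infer_instance

variable [DiscreteMeasurableSpace S]

lemma measurableSet_J (h : IsChain D μ J T) (n : ℕ) (i : S) : MeasurableSet {ω | J n ω = i} :=
  h.measurable_J n (measurableSet_singleton i)

lemma timeLaw_apply (h : IsChain D μ J T) {C : Set Ω} (n : ℕ) (k : S) {A : Set ℝ}
    (hA : MeasurableSet A) :
    timeLaw μ J T C n k A = μ (C ∩ {ω | J n ω = k} ∩ {ω | (jumpTime T n ω : ℝ) ∈ A}) := by
  rw [timeLaw, Measure.map_apply (measurable_jumpTime_real h n) hA,
    Measure.restrict_apply (measurable_jumpTime_real h n hA), inter_comm]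
  rfl

lemma timeLaw_univ (h : IsChain D μ J T) {C : Set Ω} (n : ℕ) (k : S) :
    timeLaw μ J T C n k univ = μ (C ∩ {ω | J n ω = k}) := by
  rw [timeLaw_apply h n k MeasurableSet.univ]; simp

variable [IsProbabilityMeasure μ]

/-- The joint law of `S_n` and the next sojourn time is a product. -/
lemma map_jumpTime_sojourn (h : IsChain D μ J T) {C : Set Ω} {n : ℕ}
    (hC : MeasurableSet[past J T n] C) (i k : S) :
    (μ.restrict (C ∩ {ω | J n ω = i} ∩ {ω | J (n + 1) ω = k})).map
      (fun ω => ((jumpTime T n ω : ℝ), (T (n + 1) ω : ℝ))) =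
    (timeLaw μ J T C n i).prod (law D i k) := by
  symm
  refine Measure.prod_eq fun s t hs ht => ?_
  have hSm := measurable_jumpTime_real h n
  have hTm := (h.measurable_T (n + 1)).coe_nnreal_real
  set E : Set Ω := C ∩ {ω | (jumpTime T n ω : ℝ) ∈ s} with hE
  have hEp : MeasurableSet[past J T n] E :=
    hC.inter ((measurable_jumpTime_past (J := J) le_rfl).coe_nnreal_real hs)
  have hEm := past_le h n _ hEp
  have hB : MeasurableSet (E ∩ {ω | J n ω = i} ∩ {ω | J (n + 1) ω = k}) :=
    (hEm.inter (measurableSet_J h n i)).inter (measurableSet_J h (n + 1) k)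
  -- The hypothesis prescribes the mass of each half line, which determines a finite measure; the
  -- event on S_n is absorbed into the past event E.
  have key : (μ.restrict (E ∩ {ω | J n ω = i} ∩ {ω | J (n + 1) ω = k})).map (T (n + 1)) =
      (μ (E ∩ {ω | J n ω = i}) * D.trans i k) • (D.sojourn i k : Measure ℝ≥0) := by
    refine Measure.ext_of_Iic _ _ fun u => ?_
    rw [Measure.map_apply (h.measurable_T _) measurableSet_Iic,
      Measure.restrict_apply (h.measurable_T _ measurableSet_Iic), Measure.smul_apply, smul_eq_mul,
      mul_assoc, ← h.markov n i k u E hEp]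
    congr 1
    ext ω
    simp only [mem_inter_iff, mem_preimage, mem_Iic, mem_ofPred_eq]
    tauto
  rw [Measure.map_apply (hSm.prodMk hTm) (hs.prod ht),
    Measure.restrict_apply ((hSm.prodMk hTm) (hs.prod ht)), timeLaw_apply h n i hs,
    law, Measure.smul_apply, Measure.map_apply measurable_coe_nnreal_real ht, smul_eq_mul]
  have h1 := congrArg (fun ν : Measure ℝ≥0 => ν (((↑) : ℝ≥0 → ℝ) ⁻¹' t)) key
  simp only [Measure.smul_apply, smul_eq_mul] at h1
  rw [Measure.map_apply (h.measurable_T _) (measurable_coe_nnreal_real ht),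
    Measure.restrict_apply (h.measurable_T _ (measurable_coe_nnreal_real ht))] at h1
  rw [show C ∩ {ω | J n ω = i} ∩ {ω | (jumpTime T n ω : ℝ) ∈ s} = E ∩ {ω | J n ω = i} by
    rw [hE]; ext ω; simp only [mem_inter_iff, mem_ofPred_eq]; tauto, ← mul_assoc, ← h1]
  congr 1
  ext ω
  simp only [hE, mem_inter_iff, mem_preimage, mem_prod, mem_ofPred_eq]
  tauto

/-- S_{n+1} is the sum of S_n and the next sojourn, whose joint law on each transition is a product
measure. -/
lemma timeLaw_succ [Countable S] (h : IsChain D μ J T) {C : Set Ω} {n : ℕ}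
    (hC : MeasurableSet[past J T n] C) (k : S) :
    timeLaw μ J T C (n + 1) k = step D (timeLaw μ J T C n) k := by
  have hCm := past_le h n _ hC
  have h1 : μ.restrict (C ∩ {ω | J (n + 1) ω = k}) =
      Measure.sum fun i => μ.restrict (C ∩ {ω | J n ω = i} ∩ {ω | J (n + 1) ω = k}) := by
    rw [← Measure.restrict_iUnion]
    · congr 1
      ext ω
      simp only [mem_inter_iff, mem_ofPred_eq, mem_iUnion]
      constructor
      · rintro ⟨a, b⟩; exact ⟨J n ω, ⟨a, rfl⟩, b⟩
      · rintro ⟨i, ⟨a, -⟩, b⟩; exact ⟨a, b⟩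
    · intro i i' hii
      refine disjoint_left.2 fun ω hω hω' => hii ?_
      exact hω.1.2.symm.trans hω'.1.2
    · exact fun i => (hCm.inter (measurableSet_J h n i)).inter (measurableSet_J h (n + 1) k)
  rw [timeLaw, h1, Measure.map_sum (measurable_jumpTime_real h (n + 1)).aemeasurable, step]
  congr 1
  ext1 i
  rw [Measure.conv, ← map_jumpTime_sojourn h hC i k, Measure.map_map (by fun_prop)
    ((measurable_jumpTime_real h n).prodMk (h.measurable_T (n + 1)).coe_nnreal_real)]
  congr 1
  ext ω
  simp [jumpTime_succ]

variable [Countable S] (j : S)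

lemma timeLaw_self (C : Set Ω) (n : ℕ) (k : S) :
    timeLaw μ J T (C ∩ {ω | J n ω = j}) n k = timeLaw μ J T C n j ∗ occ D j 0 k := by
  rw [occ]
  split_ifs with hk
  · subst hk
    rw [Measure.conv_dirac_zero, timeLaw, timeLaw, inter_assoc, inter_self]
  · have : C ∩ {ω | J n ω = j} ∩ {ω | J n ω = k} = ∅ := by
      ext ω
      simp only [mem_inter_iff, mem_ofPred_eq, mem_empty_iff_false, iff_false]
      rintro ⟨⟨-, h1⟩, h2⟩
      exact hk (h2.symm.trans h1)
    rw [timeLaw, this, Measure.restrict_empty, Measure.map_zero, Measure.conv_zero]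

/-- The Markov property: after a visit to `j` the chain starts afresh. -/
lemma timeLaw_add (h : IsChain D μ J T) {C : Set Ω} {m : ℕ} (hC : MeasurableSet[past J T m] C)
    (n : ℕ) (k : S) :
    timeLaw μ J T (C ∩ {ω | J m ω = j}) (m + n) k = timeLaw μ J T C m j ∗ occ D j n k := by
  induction n generalizing k with
  | zero => exact timeLaw_self j C m k
  | succ n ih =>
    have hC' : MeasurableSet[past J T (m + n)] (C ∩ {ω | J m ω = j}) :=
      past_mono (Nat.le_add_right m n) _ (hC.inter (measurableSet_J_past le_rfl j))
    rw [← add_assoc, timeLaw_succ h hC', occ, conv_step]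
    congr 1
    ext1 l
    exact ih l

/-- The part of `C ∩ {J_m = j}` on which `j` is not visited at the times `m + 1, …, m + n`. -/
def noReturn (J : ℕ → Ω → S) (j : S) (C : Set Ω) (m n : ℕ) : Set Ω :=
  C ∩ {ω | J m ω = j} ∩ {ω | ∀ l, m < l → l ≤ m + n → J l ω ≠ j}

omit [MeasurableSpace Ω] [Countable S] in
lemma measurableSet_noReturn_past {C : Set Ω} {m : ℕ}
    (hC : MeasurableSet[past J T m] C) (n : ℕ) :
    MeasurableSet[past J T (m + n)] (noReturn J j C m n) := by
  refine (past_mono (Nat.le_add_right m n) _ (hC.inter (measurableSet_J_past le_rfl j))).inter ?_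
  have : {ω | ∀ l, m < l → l ≤ m + n → J l ω ≠ j} =
      ⋂ l, ⋂ (_ : m < l), ⋂ (_ : l ≤ m + n), {ω | J l ω = j}ᶜ := by
    ext ω; simp
  rw [this]
  exact MeasurableSet.iInter fun l => MeasurableSet.iInter fun _ => MeasurableSet.iInter fun hl =>
    (measurableSet_J_past hl j).compl

/-- The Markov property with the paths returning to `j` removed, so that the taboo laws replace the
occupation laws. -/
lemma timeLaw_noReturn (h : IsChain D μ J T) {C : Set Ω} {m : ℕ}
    (hC : MeasurableSet[past J T m] C) (n : ℕ) (k : S) :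
    timeLaw μ J T (noReturn J j C m n) (m + n) k = timeLaw μ J T C m j ∗ taboo D j n k := by
  induction n generalizing k with
  | zero =>
    have h0 : taboo D j 0 k = occ D j 0 k := by rw [occ, taboo]
    rw [h0, ← timeLaw_self]
    congr 1
    refine inter_eq_left.2 fun ω _ l hl hl' => ?_
    omega
  | succ n ih =>
    rw [taboo]
    split_ifs with hk
    · have : noReturn J j C m (n + 1) ∩ {ω | J (m + (n + 1)) ω = k} = ∅ := by
        ext ω
        simp only [mem_inter_iff, mem_ofPred_eq, mem_empty_iff_false, iff_false]
        rintro ⟨⟨-, h1⟩, h2⟩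
        exact h1 (m + (n + 1)) (by omega) le_rfl (h2.trans hk)
      rw [timeLaw, this, Measure.restrict_empty, Measure.map_zero, Measure.conv_zero]
    · have : noReturn J j C m (n + 1) ∩ {ω | J (m + (n + 1)) ω = k} =
          noReturn J j C m n ∩ {ω | J (m + (n + 1)) ω = k} := by
        ext ω
        simp only [noReturn, mem_inter_iff, mem_ofPred_eq]
        constructor
        · rintro ⟨⟨h1, h2⟩, h3⟩
          exact ⟨⟨h1, fun l hl hl' => h2 l hl (by omega)⟩, h3⟩
        · rintro ⟨⟨h1, h2⟩, h3⟩
          refine ⟨⟨h1, fun l hl hl' => ?_⟩, h3⟩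
          rcases Nat.lt_or_ge l (m + (n + 1)) with hlt | hge
          · exact h2 l hl (by omega)
          · obtain rfl : l = m + (n + 1) := by omega
            rw [h3]; exact hk
      rw [timeLaw, this]
      change timeLaw μ J T (noReturn J j C m n) (m + n + 1) k = _
      rw [timeLaw_succ h (measurableSet_noReturn_past j hC n), conv_step]
      congr 1
      ext1 l
      exact ih l

lemma timeLaw_firstReturn (h : IsChain D μ J T) {C : Set Ω} {m : ℕ}
    (hC : MeasurableSet[past J T m] C) (n : ℕ) :
    timeLaw μ J T (noReturn J j C m n) (m + n + 1) j =
      timeLaw μ J T C m j ∗ firstReturn D j n := by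
  rw [timeLaw_succ h (measurableSet_noReturn_past j hC n), firstReturn, conv_step]
  congr 1
  ext1 l
  exact timeLaw_noReturn j h hC n l

/-- The event that the `k`-th sojourn is in `j`, covers the time `t`, and has age in `B` then. -/
def ageEvent (J : ℕ → Ω → S) (T : ℕ → Ω → ℝ≥0) (j : S) (B : Set ℝ) (t : ℝ) (k : ℕ) : Set Ω :=
  {ω | J k ω = j ∧ t - jumpTime T k ω ∈ B ∧ t < jumpTime T (k + 1) ω}

omit [IsProbabilityMeasure μ] [Countable S] in
lemma measurableSet_ageEvent (h : IsChain D μ J T) {B : Set ℝ} (hB : MeasurableSet B) (t : ℝ)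
    (k : ℕ) : MeasurableSet (ageEvent J T j B t k) :=
  (measurableSet_J h k j).inter (((measurable_const.sub (measurable_jumpTime_real h k)) hB).inter
    (measurableSet_lt measurable_const (measurable_jumpTime_real h (k + 1))))

/-- Given S_n = s and the current state `j`, time t is covered exactly when the next sojourn exceeds
the age t - s. -/
lemma measure_inter_ageEvent (h : IsChain D μ J T) {C : Set Ω} {n : ℕ}
    (hC : MeasurableSet[past J T n] C) {B : Set ℝ} (hB : MeasurableSet B) (t : ℝ) :
    μ (C ∩ ageEvent J T j B t n) =
      ∫⁻ s, B.indicator (holdTail D j) (t - s) ∂timeLaw μ J T C n j := by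
  have hCm := past_le h n _ hC
  set G : Set (ℝ × ℝ) := {p | t - p.1 ∈ B ∧ t < p.1 + p.2} with hG
  have hGm : MeasurableSet G :=
    ((measurable_const.sub measurable_fst) hB).inter
      (measurableSet_lt measurable_const (measurable_fst.add measurable_snd))
  have hpair : Measurable fun ω => ((jumpTime T n ω : ℝ), (T (n + 1) ω : ℝ)) :=
    (measurable_jumpTime_real h n).prodMk (h.measurable_T (n + 1)).coe_nnreal_real
  have h1 : C ∩ ageEvent J T j B t n = ⋃ k, (C ∩ {ω | J n ω = j} ∩ {ω | J (n + 1) ω = k}) ∩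
      (fun ω => ((jumpTime T n ω : ℝ), (T (n + 1) ω : ℝ))) ⁻¹' G := by
    ext ω
    simp only [ageEvent, hG, mem_inter_iff, mem_ofPred_eq, mem_iUnion, mem_preimage, jumpTime_succ,
      NNReal.coe_add]
    constructor
    · rintro ⟨a, b, c⟩; exact ⟨J (n + 1) ω, ⟨⟨a, b⟩, rfl⟩, c⟩
    · rintro ⟨k, ⟨⟨a, b⟩, -⟩, c⟩; exact ⟨a, b, c⟩
  have hBk : ∀ k, MeasurableSet (C ∩ {ω | J n ω = j} ∩ {ω | J (n + 1) ω = k}) := fun k =>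
    (hCm.inter (measurableSet_J h n j)).inter (measurableSet_J h (n + 1) k)
  rw [h1, measure_iUnion]
  · have h2 : ∀ k, μ ((C ∩ {ω | J n ω = j} ∩ {ω | J (n + 1) ω = k}) ∩
        (fun ω => ((jumpTime T n ω : ℝ), (T (n + 1) ω : ℝ))) ⁻¹' G) =
        ∫⁻ s, B.indicator (fun u => law D j k (Ioi u)) (t - s) ∂timeLaw μ J T C n j := by
      intro k
      rw [inter_comm, ← Measure.restrict_apply (hpair hGm), ← Measure.map_apply hpair hGm,
        map_jumpTime_sojourn h hC j k, Measure.prod_apply hGm]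
      refine lintegral_congr fun s => ?_
      by_cases hs : t - s ∈ B
      · rw [indicator_of_mem hs]
        congr 1
        ext y
        simp only [hG, mem_preimage, mem_ofPred_eq, hs, true_and, mem_Ioi]
        exact ⟨fun _ => by linarith, fun _ => by linarith⟩
      · rw [indicator_of_notMem hs]
        have : Prod.mk s ⁻¹' G = ∅ := by
          ext y; simp [hG, hs]
        rw [this, measure_empty]
    simp only [h2]
    rw [← lintegral_tsum]
    · refine lintegral_congr fun s => ?_
      by_cases hs : t - s ∈ B
      · simp only [indicator_of_mem hs, holdTail]
      · simp only [indicator_of_notMem hs, tsum_zero]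
    · intro k
      have hm : Measurable fun u => law D j k (Ioi u) :=
        Antitone.measurable fun a b h => measure_mono (Ioi_subset_Ioi h)
      exact ((hm.indicator hB).comp (measurable_const.sub measurable_id)).aemeasurable
  · intro k k' hkk
    refine disjoint_left.2 fun ω hω hω' => hkk ?_
    exact hω.1.2.symm.trans hω'.1.2
  · exact fun k => (hBk k).inter (hpair hGm)

/-- Regeneration: the probability of being in `j` at time `t` with age in `B`, after a visit to
`j`. -/
theorem tsum_measure_inter_ageEvent (h : IsChain D μ J T) {C : Set Ω} {m : ℕ}
    (hC : MeasurableSet[past J T m] C) {B : Set ℝ} (hB : MeasurableSet B) (t : ℝ) :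
    ∑' n, μ (C ∩ {ω | J m ω = j} ∩ ageEvent J T j B t (m + n)) =
      ∫⁻ a, Renewal.pot (renewalMeasure D j) (B.indicator (holdTail D j)) (t - a)
        ∂timeLaw μ J T C m j := by
  have hz : Measurable (B.indicator (holdTail D j)) := (antitone_holdTail D j).measurable.indicator hB
  have h1 : ∀ n, μ (C ∩ {ω | J m ω = j} ∩ ageEvent J T j B t (m + n)) =
      ∫⁻ a, ∫⁻ b, B.indicator (holdTail D j) (t - a - b) ∂occ D j n j ∂timeLaw μ J T C m j := by
    intro n
    rw [measure_inter_ageEvent j h (past_mono (Nat.le_add_right m n) _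
      (hC.inter (measurableSet_J_past le_rfl j))) hB, timeLaw_add j h hC n j,
      Measure.lintegral_conv (f := fun s => B.indicator (holdTail D j) (t - s))
        (hz.comp (measurable_const.sub measurable_id))]
    simp only [sub_sub]
  simp only [h1]
  rw [← lintegral_tsum]
  · refine lintegral_congr fun a => ?_
    rw [Renewal.pot, renewalMeasure, lintegral_sum_measure]
  · intro n
    exact (Measurable.lintegral_prod_right'
      (f := fun p : ℝ × ℝ => B.indicator (holdTail D j) (t - p.1 - p.2))
      (hz.comp ((measurable_const.sub measurable_fst).sub measurable_snd))).aemeasurable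

/-- The event is disjoint from that of a first return by time b, whose probability is given by the
return law evaluated on (-∞, b - a]. As the return law has mass 1, what remains is at most the
integral of its tail. -/
lemma measure_no_return_le (hD : D.Admissible) (h : IsChain D μ J T) {C : Set Ω} {m : ℕ}
    (hC : MeasurableSet[past J T m] C) (b : ℝ) :
    μ (C ∩ {ω | J m ω = j} ∩ {ω | ∀ n, m < n → J n ω = j → b < jumpTime T n ω}) ≤
      ∫⁻ a, returnLaw D j (Ioi (b - a)) ∂timeLaw μ J T C m j := by
  have hCm := past_le h m _ hC
  set G : ℕ → Set Ω := fun n => noReturn J j C m n ∩ {ω | J (m + n + 1) ω = j} ∩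
    {ω | (jumpTime T (m + n + 1) ω : ℝ) ∈ Iic b} with hG
  have hGm : ∀ n, MeasurableSet (G n) := fun n =>
    ((past_le h _ _ (measurableSet_noReturn_past j hC n)).inter (measurableSet_J h _ j)).inter
      (measurable_jumpTime_real h _ measurableSet_Iic)
  have hGd : Pairwise (Function.onFun Disjoint G) := by
    have aux : ∀ n n', n < n' → Disjoint (G n) (G n') := by
      intro n n' hnn
      refine disjoint_left.2 fun ω hω hω' => ?_
      exact hω'.1.1.2 (m + n + 1) (by omega) (by omega) hω.1.2
    intro n n' hnn
    rcases lt_or_gt_of_ne hnn with hlt | hgt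
    · exact aux n n' hlt
    · exact (aux n' n hgt).symm
  have hGmeas : μ (⋃ n, G n) = ∫⁻ a, returnLaw D j (Iic (b - a)) ∂timeLaw μ J T C m j := by
    rw [measure_iUnion hGd hGm]
    have : ∀ n, μ (G n) = (timeLaw μ J T C m j ∗ firstReturn D j n) (Iic b) := fun n => by
      rw [← timeLaw_firstReturn j h hC n, timeLaw_apply h _ j measurableSet_Iic]
    simp only [this]
    rw [← Measure.sum_apply _ measurableSet_Iic, ← conv_sum]
    change (timeLaw μ J T C m j ∗ returnLaw D j) (Iic b) = _
    rw [← lintegral_indicator_one measurableSet_Iic,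
      Measure.lintegral_conv (measurable_one.indicator measurableSet_Iic)]
    refine lintegral_congr fun a => ?_
    rw [← lintegral_indicator_one measurableSet_Iic]
    refine lintegral_congr fun y => ?_
    simp only [indicator, mem_Iic]
    congr 1
    exact propext ⟨fun _ => by linarith, fun _ => by linarith⟩
  set E := C ∩ {ω | J m ω = j} ∩ {ω | ∀ n, m < n → J n ω = j → b < jumpTime T n ω} with hE
  have hdisj : Disjoint E (⋃ n, G n) := by
    refine disjoint_left.2 fun ω hω hω' => ?_
    obtain ⟨n, hn⟩ := mem_iUnion.1 hω'
    exact absurd (hω.2 (m + n + 1) (by omega) hn.1.2) (not_lt.2 hn.2)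
  have hle : μ E + μ (⋃ n, G n) ≤ μ (C ∩ {ω | J m ω = j}) := by
    rw [← measure_union hdisj (MeasurableSet.iUnion hGm)]
    refine measure_mono (union_subset inter_subset_left (iUnion_subset fun n ω hω => ?_))
    exact hω.1.1.1
  have hm : Measurable fun a => returnLaw D j (Iic (b - a)) := by
    have : Antitone fun a => returnLaw D j (Iic (b - a)) := fun x y hxy =>
      measure_mono (Iic_subset_Iic.2 (by linarith))
    exact this.measurable
  have hsum : μ (C ∩ {ω | J m ω = j}) = ∫⁻ a, returnLaw D j (Ioi (b - a)) ∂timeLaw μ J T C m j +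
      ∫⁻ a, returnLaw D j (Iic (b - a)) ∂timeLaw μ J T C m j := by
    rw [← timeLaw_univ h, ← lintegral_add_right _ hm, ← lintegral_one]
    refine lintegral_congr fun a => ?_
    rw [add_comm, ← measure_union (Iic_disjoint_Ioi le_rfl) measurableSet_Ioi, Iic_union_Ioi,
      returnLaw_univ j hD]
  rw [hsum, hGmeas] at hle
  refine (ENNReal.add_le_add_iff_right ?_).1 hle
  rw [← hGmeas]
  exact measure_ne_top _ _

end Markov

end SemiMarkov

/-! ### Pathwise description of `proc`, the visits to `j` and the residual time -/

namespace SemiMarkov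

section Paths

variable {S Ω : Type*} {J : ℕ → Ω → S} {T : ℕ → Ω → ℝ≥0} {j : S}

lemma jumpCount_eq {t : ℝ≥0} {ω : Ω} {k : ℕ} (h1 : jumpTime T k ω ≤ t)
    (h2 : t < jumpTime T (k + 1) ω) : jumpCount T t ω = k := by
  have : {n | jumpTime T n ω ≤ t} = Iic k := by
    ext n
    simp only [mem_ofPred_eq, mem_Iic]
    refine ⟨fun h => ?_, fun h => (jumpTime_mono ω h).trans h1⟩
    by_contra hn
    exact absurd (h2.trans_le (jumpTime_mono ω (show k + 1 ≤ n by omega))) (not_lt.2 h)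
  rw [jumpCount, this, csSup_Iic]

lemma jumpCount_spec {t : ℝ≥0} {ω : Ω} (h0 : jumpTime T 0 ω ≤ t)
    (hfin : {n | jumpTime T n ω ≤ t}.Finite) :
    jumpTime T (jumpCount T t ω) ω ≤ t ∧ t < jumpTime T (jumpCount T t ω + 1) ω := by
  refine ⟨Nat.sSup_mem ⟨0, h0⟩ hfin.bddAbove, ?_⟩
  by_contra hn
  have := le_csSup hfin.bddAbove (show jumpCount T t ω + 1 ∈ {n | jumpTime T n ω ≤ t} from not_lt.1 hn)
  rw [jumpCount] at this
  omega

lemma iInf_nat_spec (p : ℕ → Prop) :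
    (∃ m, p m ∧ (⨅ (n : ℕ) (_ : p n), (n : ℕ∞)) = m) ∨ (⨅ (n : ℕ) (_ : p n), (n : ℕ∞)) = ⊤ := by
  classical
  by_cases h : ∃ m, p m
  · refine Or.inl ⟨Nat.find h, Nat.find_spec h, le_antisymm (iInf₂_le _ (Nat.find_spec h)) ?_⟩
    exact le_iInf₂ fun n hn => Nat.cast_le.2 (Nat.find_min' h hn)
  · push Not at h
    right
    simp [h]

lemma visitIndex_spec (k : ℕ) (ω : Ω) :
    (∃ m : ℕ, J m ω = j ∧ visitIndex J j k ω = m) ∨ visitIndex J j k ω = ⊤ := by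
  cases k with
  | zero => exact iInf_nat_spec _
  | succ k =>
    rcases iInf_nat_spec fun m => visitIndex J j k ω < m ∧ J m ω = j with ⟨m, hm, h⟩ | h
    · exact Or.inl ⟨m, hm.2, h⟩
    · exact Or.inr h

lemma visitIndex_lt_succ {k m : ℕ} {ω : Ω} (h : visitIndex J j k ω = m) :
    (m : ℕ∞) < visitIndex J j (k + 1) ω := by
  rcases iInf_nat_spec fun m => visitIndex J j k ω < m ∧ J m ω = j with ⟨m', hm, h'⟩ | h'
  · rw [visitIndex, h', ← h]; exact hm.1
  · rw [visitIndex, h']; exact ENat.natCast_lt_top m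

lemma visitIndex_le_succ (k : ℕ) (ω : Ω) : visitIndex J j k ω ≤ visitIndex J j (k + 1) ω := by
  rw [visitIndex]
  exact le_iInf₂ fun m hm => hm.1.le

lemma visitIndex_mono (ω : Ω) : Monotone fun k => visitIndex J j k ω :=
  monotone_nat_of_le_succ fun k => visitIndex_le_succ k ω

lemma le_visitIndex (k : ℕ) (ω : Ω) : (k : ℕ∞) ≤ visitIndex J j k ω := by
  induction k with
  | zero => simp
  | succ k ih =>
    rcases visitIndex_spec (J := J) (j := j) k ω with ⟨m, -, hm⟩ | h
    · rw [hm] at ih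
      have h1 : k ≤ m := by exact_mod_cast ih
      have h2 := visitIndex_lt_succ hm
      refine le_trans ?_ (Order.add_one_le_of_lt h2)
      exact_mod_cast Nat.succ_le_succ h1
    · have := visitIndex_le_succ (J := J) (j := j) k ω
      rw [h, top_le_iff] at this
      rw [this]; exact le_top

/-- Visit indices are at least their rank, so there is a first rank whose index is not below m; by
minimality it is m. -/
lemma exists_visitIndex_eq {m : ℕ} {ω : Ω} (h : J m ω = j) : ∃ k, visitIndex J j k ω = m := by
  classical
  have hex : ∃ k, (m : ℕ∞) ≤ visitIndex J j k ω := ⟨m, le_visitIndex m ω⟩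
  refine ⟨Nat.find hex, le_antisymm ?_ (Nat.find_spec hex)⟩
  rcases hk : Nat.find hex with _ | k
  · rw [visitIndex]; exact iInf₂_le m h
  · have hlt : visitIndex J j k ω < m := not_le.1 (Nat.find_min hex (by omega))
    rw [visitIndex]; exact iInf₂_le m ⟨hlt, h⟩

lemma hitTime_of_eq {k m : ℕ} {ω : Ω} (h : visitIndex J j k ω = m) :
    hitTime J T j k ω = jumpTime T m ω := by
  rw [hitTime, h, if_neg (ENat.natCast_ne_top m)]
  simp

lemma hitTime_le_iff {k : ℕ} {ω : Ω} {t : ℝ≥0} :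
    hitTime J T j k ω ≤ t ↔ ∃ m : ℕ, J m ω = j ∧ visitIndex J j k ω = m ∧ jumpTime T m ω ≤ t := by
  constructor
  · intro h
    rcases visitIndex_spec (J := J) (j := j) k ω with ⟨m, hj, hm⟩ | h'
    · rw [hitTime_of_eq hm] at h
      exact ⟨m, hj, hm, by exact_mod_cast h⟩
    · rw [hitTime, if_pos h'] at h
      simp at h
  · rintro ⟨m, -, hm, h⟩
    rw [hitTime_of_eq hm]
    exact_mod_cast h

lemma hitTime_le_of_le {k l : ℕ} {ω : Ω} {t : ℝ≥0} (hkl : k ≤ l) (h : hitTime J T j l ω ≤ t) :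
    hitTime J T j k ω ≤ t := by
  obtain ⟨m, -, hm, hmt⟩ := hitTime_le_iff.1 h
  have h1 := visitIndex_mono (J := J) (j := j) ω hkl
  simp only [hm] at h1
  rcases visitIndex_spec (J := J) (j := j) k ω with ⟨m', hj', hm'⟩ | h'
  · rw [hm'] at h1
    exact hitTime_le_iff.2 ⟨m', hj', hm', (jumpTime_mono ω (by exact_mod_cast h1)).trans hmt⟩
  · rw [h', top_le_iff] at h1
    exact absurd h1 (ENat.natCast_ne_top m)

lemma lastVisit_eq {t : ℝ≥0} {ω : Ω} {k : ℕ} (h1 : hitTime J T j k ω ≤ t)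
    (h2 : ¬ hitTime J T j (k + 1) ω ≤ t) : lastVisit J T j t ω = k := by
  have : {n | hitTime J T j n ω ≤ t} = Iic k := by
    ext n
    simp only [mem_ofPred_eq, mem_Iic]
    refine ⟨fun h => ?_, fun h => hitTime_le_of_le h h1⟩
    by_contra hn
    exact h2 (hitTime_le_of_le (by omega) h)
  rw [lastVisit, this, csSup_Iic]

/-- Away from the default value of `sSup`: the set is nonempty by `h0`, and bounded because the n-th
visit has index at least n while only finitely many jumps occur by t. -/
lemma lastVisit_spec {t : ℝ≥0} {ω : Ω} (h0 : hitTime J T j 0 ω ≤ t)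
    (hfin : {n | jumpTime T n ω ≤ t}.Finite) :
    hitTime J T j (lastVisit J T j t ω) ω ≤ t ∧
      ¬ hitTime J T j (lastVisit J T j t ω + 1) ω ≤ t := by
  have hb : BddAbove {n | hitTime J T j n ω ≤ t} := by
    refine hfin.bddAbove.mono fun n hn => ?_
    obtain ⟨m, -, hm, hmt⟩ := hitTime_le_iff.1 hn
    have h1 := le_visitIndex (J := J) (j := j) n ω
    rw [hm] at h1
    exact (jumpTime_mono ω (by exact_mod_cast h1)).trans hmt
  refine ⟨Nat.sSup_mem (s := {n | hitTime J T j n ω ≤ t}) ⟨0, h0⟩ hb, fun hn => ?_⟩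
  have := le_csSup hb (show lastVisit J T j t ω + 1 ∈ {n | hitTime J T j n ω ≤ t} from hn)
  rw [lastVisit] at this
  omega

/-- When the sojourn covering t is in `j`, its beginning is the last entry into `j` before t, since
any later visit starts at S_{k+1} or after. -/
lemma backwardResidual_eq {t : ℝ≥0} {ω : Ω} {k : ℕ} (hj : J k ω = j) (h1 : jumpTime T k ω ≤ t)
    (h2 : t < jumpTime T (k + 1) ω) :
    backwardResidual J T j t ω = (t : ℝ≥0∞) - jumpTime T k ω := by
  obtain ⟨n, hn⟩ := exists_visitIndex_eq hj
  have hlast : lastVisit J T j t ω = n := by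
    refine lastVisit_eq (hitTime_le_iff.2 ⟨k, hj, hn, h1⟩) fun h => ?_
    obtain ⟨m, -, hm, hmt⟩ := hitTime_le_iff.1 h
    have h3 := visitIndex_lt_succ hn
    rw [hm] at h3
    have h4 : k < m := by exact_mod_cast h3
    exact absurd (h2.trans_le (jumpTime_mono ω (show k + 1 ≤ m by omega))) (not_lt.2 hmt)
  rw [backwardResidual, hlast, hitTime_of_eq hn]

lemma ageEvent_disjoint {B : Set ℝ} (hB : B ⊆ Ici 0) (t : ℝ) :
    Pairwise (Function.onFun Disjoint (ageEvent J T j B t)) := by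
  have aux : ∀ k l, k < l → Disjoint (ageEvent J T j B t k) (ageEvent J T j B t l) := by
    intro k l hkl
    refine disjoint_left.2 fun ω hω hω' => ?_
    have h1 : (jumpTime T (k + 1) ω : ℝ) ≤ jumpTime T l ω :=
      NNReal.coe_le_coe.2 (jumpTime_mono ω (Nat.succ_le_of_lt hkl))
    have h2 := hB hω'.2.1
    have h3 := hω.2.2
    rw [mem_Ici] at h2
    linarith
  intro k l hkl
  rcases lt_or_gt_of_ne hkl with h | h
  · exact aux k l h
  · exact (aux l k h).symm

lemma proc_eq_iff {t : ℝ≥0} {ω : Ω} (h0 : jumpTime T 0 ω ≤ t)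
    (hfin : {n | jumpTime T n ω ≤ t}.Finite) :
    proc J T t ω = j ↔ ω ∈ ⋃ k, ageEvent J T j (Ici 0) t k := by
  simp only [mem_iUnion, ageEvent, mem_ofPred_eq, mem_Ici, sub_nonneg, NNReal.coe_le_coe,
    NNReal.coe_lt_coe]
  constructor
  · intro h
    exact ⟨jumpCount T t ω, h, jumpCount_spec h0 hfin⟩
  · rintro ⟨k, hj, h1, h2⟩
    rw [proc, jumpCount_eq h1 h2, hj]

lemma proc_and_residual_iff {t x : ℝ≥0} {ω : Ω} (h0 : jumpTime T 0 ω ≤ t)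
    (hfin : {n | jumpTime T n ω ≤ t}.Finite) :
    (proc J T t ω = j ∧ (x : ℝ≥0∞) < backwardResidual J T j t ω) ↔
      ω ∈ ⋃ k, ageEvent J T j (Ioi x) t k := by
  simp only [mem_iUnion, ageEvent, mem_ofPred_eq, mem_Ioi, NNReal.coe_lt_coe]
  have key : ∀ s : ℝ≥0, s ≤ t → ((x : ℝ≥0∞) < (t : ℝ≥0∞) - s ↔ (x : ℝ) < t - s) := by
    intro s hs
    rw [← ENNReal.coe_sub, ENNReal.coe_lt_coe, ← NNReal.coe_lt_coe, NNReal.coe_sub hs]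
  constructor
  · rintro ⟨h, hx⟩
    obtain ⟨h1, h2⟩ := jumpCount_spec h0 hfin
    refine ⟨jumpCount T t ω, h, ?_, h2⟩
    rw [backwardResidual_eq h h1 h2] at hx
    exact (key _ h1).1 hx
  · rintro ⟨k, hj, hx, h2⟩
    have h1 : jumpTime T k ω ≤ t := by
      rw [← NNReal.coe_le_coe]
      have := x.coe_nonneg
      linarith
    refine ⟨by rw [proc, jumpCount_eq h1 h2, hj], ?_⟩
    rw [backwardResidual_eq hj h1 h2]
    exact (key _ h1).2 hx

end Paths

/-! ### What the histories know about the steps of the chain -/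

section Histories

variable {S Ω : Type*} [MeasurableSpace S] [MeasurableSpace Ω] {D : Params S}
  {μ : Measure Ω} {J : ℕ → Ω → S} {T : ℕ → Ω → ℝ≥0} {j : S}

/-- The events which, for every `m`, are determined on `{s < S_m}` by the first `m` steps of the
chain, up to null sets. -/
@[reducible] def strictPast (μ : Measure Ω) (J : ℕ → Ω → S) (T : ℕ → Ω → ℝ≥0) (s : ℝ≥0) :
    MeasurableSpace Ω where
  MeasurableSet' B := ∀ m, MeasurableSet[eventuallyMeasurableSpace (past J T m) (ae μ)]
    (B ∩ {ω | s < jumpTime T m ω})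
  measurableSet_empty m := by simp
  measurableSet_compl B hB m := by
    have hm : MeasurableSet[eventuallyMeasurableSpace (past J T m) (ae μ)]
        {ω | s < jumpTime T m ω} :=
      le_eventuallyMeasurableSpace _ (measurable_jumpTime_past (J := J) le_rfl measurableSet_Ioi)
    have := hm.diff (hB m)
    convert this using 1
    ext ω
    simp only [mem_inter_iff, mem_compl_iff, mem_ofPred_eq, Set.mem_sdiff]
    tauto
  measurableSet_iUnion f hf m := by
    rw [iUnion_inter]
    exact MeasurableSet.iUnion fun i => hf i m

lemma strictPast_congr {s : ℝ≥0} {B B' : Set Ω} (hB : MeasurableSet[strictPast μ J T s] B)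
    (h : B' =ᵐ[μ] B) : MeasurableSet[strictPast μ J T s] B' := fun m => by
  obtain ⟨C, hC, hBC⟩ := hB m
  exact ⟨C, hC, (h.inter (ae_eq_refl _)).trans hBC⟩

lemma strictPast_of_past {s : ℝ≥0} {B : Set Ω}
    (h : ∀ m, ∃ C, MeasurableSet[past J T m] C ∧
      B ∩ {ω | s < jumpTime T m ω} = C ∩ {ω | s < jumpTime T m ω}) :
    MeasurableSet[strictPast μ J T s] B := fun m => by
  obtain ⟨C, hC, hBC⟩ := h m
  rw [hBC]
  exact le_eventuallyMeasurableSpace _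
    (hC.inter (measurable_jumpTime_past (J := J) le_rfl measurableSet_Ioi))

/-- For u ≤ s < S_m the process at time u sits in one of the first steps, so on {s < S_m} the
variable Y_u is a function of the chain up to step m. Completion costs nothing, `strictPast` being
closed under null modifications. -/
lemma historyUpTo_le (s : ℝ≥0) : historyUpTo μ J T s ≤ strictPast μ J T s := by
  rintro B ⟨C, hC, hBC⟩
  refine strictPast_congr ?_ hBC
  refine (iSup₂_le fun u hu => ?_ : (⨆ (u : ℝ≥0) (_ : u ≤ s),
    MeasurableSpace.comap (proc J T u) inferInstance) ≤ strictPast μ J T s) C hC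
  rintro _ ⟨A, hA, rfl⟩
  refine strictPast_of_past fun m => ?_
  -- The second set takes care of u < S_0, where the supremum of the empty set makes `jumpCount`
  -- equal to 0.
  refine ⟨⋃ k ∈ Iic m, J k ⁻¹' A ∩ ({ω | jumpTime T k ω ≤ u ∧ ∀ l ≤ m, k < l → u < jumpTime T l ω} ∪
    {ω | k = 0 ∧ u < jumpTime T 0 ω}), ?_, ?_⟩
  · refine MeasurableSet.biUnion (to_countable _) fun k hk => ?_
    rw [mem_Iic] at hk
    refine (measurable_J_past hk hA).inter (MeasurableSet.union ?_ ?_)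
    · have : {ω | jumpTime T k ω ≤ u ∧ ∀ l ≤ m, k < l → u < jumpTime T l ω} =
          {ω | jumpTime T k ω ≤ u} ∩ ⋂ l, ⋂ (_ : l ≤ m), ⋂ (_ : k < l), {ω | u < jumpTime T l ω} := by
        ext ω; simp
      rw [this]
      refine (measurable_jumpTime_past (J := J) hk measurableSet_Iic).inter ?_
      exact MeasurableSet.iInter fun l => MeasurableSet.iInter fun hl => MeasurableSet.iInter
        fun _ => measurable_jumpTime_past (J := J) hl measurableSet_Ioi
    · by_cases h0 : k = 0
      · simp only [h0, true_and]
        exact measurable_jumpTime_past (J := J) (Nat.zero_le m) measurableSet_Ioi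
      · simp only [h0, false_and, ofPred_false]
        exact @MeasurableSet.empty _ (past J T m)
  · ext ω
    simp only [mem_inter_iff, mem_preimage, mem_ofPred_eq, and_congr_left_iff]
    intro hs
    have hum : u < jumpTime T m ω := hu.trans_lt hs
    have hbound : ∀ n, jumpTime T n ω ≤ u → n < m := fun n hn => by
      by_contra hnm
      exact absurd ((jumpTime_mono ω (not_lt.1 hnm)).trans hn) (not_le.2 hum)
    have hfin : {n | jumpTime T n ω ≤ u}.Finite := (finite_Iio m).subset fun n hn => hbound n hn
    simp only [mem_iUnion, mem_Iic, mem_inter_iff, mem_preimage, mem_union, mem_ofPred_eq, proc]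
    by_cases h0 : jumpTime T 0 ω ≤ u
    · obtain ⟨h1, h2⟩ := jumpCount_spec h0 hfin
      constructor
      · intro hA'
        refine ⟨jumpCount T u ω, (hbound _ h1).le, hA', Or.inl ⟨h1, fun l _ hl => ?_⟩⟩
        exact h2.trans_le (jumpTime_mono ω hl)
      · rintro ⟨k, hk, hA', h | h⟩
        · have hkm := hbound k h.1
          rwa [jumpCount_eq h.1 (h.2 (k + 1) hkm (Nat.lt_succ_self k))]
        · exact absurd h.2 (not_lt.2 h0)
    · have hempty : {n | jumpTime T n ω ≤ u} = ∅ := by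
        ext n
        simp only [mem_ofPred_eq, mem_empty_iff_false, iff_false]
        exact fun hn => h0 ((jumpTime_mono ω (Nat.zero_le n)).trans hn)
      have hc : jumpCount T u ω = 0 := by
        rw [jumpCount, hempty, csSup_empty]; rfl
      rw [hc]
      constructor
      · intro hA'
        exact ⟨0, Nat.zero_le _, hA', Or.inr ⟨rfl, not_le.1 h0⟩⟩
      · rintro ⟨k, hk, hA', h | h⟩
        · exact absurd ((jumpTime_mono ω (Nat.zero_le k)).trans h.1) h0
        · rwa [h.1] at hA'

variable [DiscreteMeasurableSpace S]

lemma measurableSet_visitIndex_le (n k : ℕ) :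
    MeasurableSet[past J T k] {ω | visitIndex J j n ω ≤ k} := by
  induction n generalizing k with
  | zero =>
    have : {ω | visitIndex J j 0 ω ≤ k} = ⋃ i ∈ Iic k, {ω | J i ω = j} := by
      ext ω
      simp only [mem_ofPred_eq, mem_iUnion, mem_Iic, exists_prop]
      constructor
      · intro h
        rcases visitIndex_spec (J := J) (j := j) 0 ω with ⟨m, hj, hm⟩ | h'
        · rw [hm] at h
          exact ⟨m, by exact_mod_cast h, hj⟩
        · rw [h', top_le_iff] at h
          exact absurd h (ENat.natCast_ne_top k)
      · rintro ⟨i, hi, hj⟩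
        rw [visitIndex]
        exact (iInf₂_le i hj).trans (by exact_mod_cast hi)
    rw [this]
    exact MeasurableSet.biUnion (to_countable _) fun i hi => measurableSet_J_past hi j
  | succ n ih =>
    have : {ω | visitIndex J j (n + 1) ω ≤ k} = ⋃ i ∈ Iic k, ⋃ l ∈ Iio i,
        {ω | visitIndex J j n ω ≤ l} ∩ {ω | J i ω = j} := by
      ext ω
      simp only [mem_ofPred_eq, mem_iUnion, mem_Iic, mem_Iio, exists_prop, mem_inter_iff]
      constructor
      · intro h
        rcases visitIndex_spec (J := J) (j := j) (n + 1) ω with ⟨m, hj, hm⟩ | h'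
        · rcases visitIndex_spec (J := J) (j := j) n ω with ⟨l, -, hl⟩ | h''
          · have := visitIndex_lt_succ hl
            rw [hm] at this h
            exact ⟨m, by exact_mod_cast h, l, by exact_mod_cast this, hl.le, hj⟩
          · have := visitIndex_le_succ (J := J) (j := j) n ω
            rw [h'', hm, top_le_iff] at this
            exact absurd this (ENat.natCast_ne_top m)
        · rw [h', top_le_iff] at h
          exact absurd h (ENat.natCast_ne_top k)
      · rintro ⟨i, hi, l, hl, h, hj⟩
        rw [visitIndex]
        refine (iInf₂_le i ⟨h.trans_lt (by exact_mod_cast hl), hj⟩).trans (by exact_mod_cast hi)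
    rw [this]
    refine MeasurableSet.biUnion (to_countable _) fun i hi =>
      MeasurableSet.biUnion (to_countable _) fun l hl => ?_
    rw [mem_Iic] at hi
    rw [mem_Iio] at hl
    exact (past_mono (hl.le.trans hi) _ (ih l)).inter (measurableSet_J_past hi j)

/-- On {s < S_m} an entry by time s must occur at a step before m. -/
lemma measurableSet_hitTime_le (n : ℕ) (s : ℝ≥0) :
    MeasurableSet[strictPast μ J T s] {ω | hitTime J T j n ω ≤ s} := by
  refine strictPast_of_past fun m => ⟨⋃ k ∈ Iio m,
    {ω | visitIndex J j n ω ≤ k} ∩ {ω | jumpTime T k ω ≤ s}, ?_, ?_⟩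
  · refine MeasurableSet.biUnion (to_countable _) fun k hk => ?_
    rw [mem_Iio] at hk
    exact (past_mono hk.le _ (measurableSet_visitIndex_le n k)).inter
      (measurable_jumpTime_past (J := J) hk.le measurableSet_Iic)
  · ext ω
    simp only [mem_inter_iff, mem_ofPred_eq, and_congr_left_iff, mem_iUnion, mem_Iio, exists_prop]
    intro hs
    rw [hitTime_le_iff]
    constructor
    · rintro ⟨k, -, hk, hks⟩
      refine ⟨k, ?_, hk.le, hks⟩
      by_contra hkm
      exact absurd ((jumpTime_mono ω (not_lt.1 hkm)).trans hks) (not_le.2 hs)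
    · rintro ⟨k, -, hk, hks⟩
      rcases visitIndex_spec (J := J) (j := j) n ω with ⟨m', hj, hm⟩ | h'
      · rw [hm] at hk
        exact ⟨m', hj, hm, (jumpTime_mono ω (by exact_mod_cast hk)).trans hks⟩
      · rw [h', top_le_iff] at hk
        exact absurd hk (ENat.natCast_ne_top k)

lemma stoppedHistory_inter {n : ℕ} {s : ℝ≥0} {E : Set Ω}
    (hE : MeasurableSet[stoppedHistory μ J T j n] E) :
    MeasurableSet[strictPast μ J T s] (E ∩ {ω | hitTime J T j n ω ≤ s}) := by
  have hτ := measurableSet_hitTime_le (μ := μ) (J := J) (T := T) (j := j) n s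
  refine MeasurableSpace.generateFrom_induction _
    (fun E _ => MeasurableSet[strictPast μ J T s] (E ∩ {ω | hitTime J T j n ω ≤ s}))
    (fun E hE _ => ?_) ?_ (fun E _ hE => ?_) (fun E _ hE => ?_) E hE
  · exact historyUpTo_le s _ (hE s)
  · rw [empty_inter]; exact @MeasurableSet.empty _ (strictPast μ J T s)
  · have := hτ.diff hE
    convert this using 1
    ext ω
    simp only [mem_inter_iff, mem_compl_iff, mem_ofPred_eq, Set.mem_sdiff]
    tauto
  · rw [iUnion_inter]
    exact MeasurableSet.iUnion hE

/-- Almost surely {τ_0 ≤ s} is the disjoint union of the sets {τ_n ≤ s < τ_{n+1}}, on which the last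
visit has rank n and an event of F_{τ_n} is known by time s. The intersection with {τ_0 ≤ s} is
needed: before the first entry the rank is 0 by convention, and F_{τ_0} may look beyond s. -/
lemma lastVisitHistory_inter (h : IsChain D μ J T) {s : ℝ≥0} {A : Set Ω}
    (hA : MeasurableSet[lastVisitHistory μ J T j s] A) :
    MeasurableSet[strictPast μ J T s] (A ∩ {ω | hitTime J T j 0 ω ≤ s}) := by
  have hτ := fun n => measurableSet_hitTime_le (μ := μ) (J := J) (T := T) (j := j) n s
  refine MeasurableSpace.generateFrom_induction _
    (fun A _ => MeasurableSet[strictPast μ J T s] (A ∩ {ω | hitTime J T j 0 ω ≤ s}))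
    (fun A hA _ => ?_) ?_ (fun E _ hE => ?_) (fun E _ hE => ?_) A hA
  · choose E hE hAE using hA
    refine strictPast_congr (B := ⋃ n, (E n ∩ {ω | hitTime J T j n ω ≤ s}) \
      {ω | hitTime J T j (n + 1) ω ≤ s}) ?_ ?_
    · exact MeasurableSet.iUnion fun n => (stoppedHistory_inter (hE n)).diff (hτ (n + 1))
    · filter_upwards [h.conservative s] with ω hω
      have hmem : ∀ n, lastVisit J T j s ω = n → (ω ∈ A ↔ ω ∈ E n) := fun n hn => by
        have := congrArg (fun X => ω ∈ X) (hAE n)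
        simpa [hn] using this
      refine propext ?_
      change ω ∈ A ∩ {ω | hitTime J T j 0 ω ≤ s} ↔ ω ∈ ⋃ n, _
      simp only [mem_inter_iff, mem_ofPred_eq, mem_iUnion, Set.mem_sdiff]
      constructor
      · rintro ⟨hωA, h0⟩
        obtain ⟨h1, h2⟩ := lastVisit_spec h0 hω
        exact ⟨_, ⟨(hmem _ rfl).1 hωA, h1⟩, h2⟩
      · rintro ⟨n, ⟨hωE, h1⟩, h2⟩
        exact ⟨(hmem n (lastVisit_eq h1 h2)).2 hωE, hitTime_le_of_le (Nat.zero_le n) h1⟩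
  · rw [empty_inter]; exact @MeasurableSet.empty _ (strictPast μ J T s)
  · have := (hτ 0).diff hE
    convert this using 1
    ext ω
    simp only [mem_inter_iff, mem_compl_iff, mem_ofPred_eq, Set.mem_sdiff]
    tauto
  · rw [iUnion_inter]
    exact MeasurableSet.iUnion hE

end Histories

end SemiMarkov

/-! ### Recurrence and tightness of the entries into `j` -/

namespace SemiMarkov

variable {S Ω : Type*} [MeasurableSpace S] [MeasurableSpace Ω] {D : Params S}
  {μ : Measure Ω} {J : ℕ → Ω → S} {T : ℕ → Ω → ℝ≥0}
  [DiscreteMeasurableSpace S] [IsProbabilityMeasure μ] [Countable S] (j : S)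

lemma measure_transition (h : IsChain D μ J T) {C : Set Ω} {m : ℕ}
    (hC : MeasurableSet[past J T m] C) (i k : S) :
    μ (C ∩ {ω | J m ω = i} ∩ {ω | J (m + 1) ω = k}) = μ (C ∩ {ω | J m ω = i}) * D.trans i k := by
  have h1 := congrArg (fun ν : Measure (ℝ × ℝ) => ν univ) (map_jumpTime_sojourn h hC i k)
  rw [← univ_prod_univ, Measure.prod_prod, timeLaw_univ h, law_univ, univ_prod_univ,
    Measure.map_apply ((measurable_jumpTime_real h m).prodMk
      (h.measurable_T (m + 1)).coe_nnreal_real) MeasurableSet.univ] at h1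
  simpa using h1

lemma measure_noHit (h : IsChain D μ J T) (n : ℕ) {C : Set Ω} {m : ℕ}
    (hC : MeasurableSet[past J T m] C) (i : S) :
    μ (C ∩ {ω | J m ω = i} ∩ {ω | ∀ l, m < l → l ≤ m + n → J l ω ≠ j}) =
      μ (C ∩ {ω | J m ω = i}) * noHit D j n i := by
  classical
  induction n generalizing C m i with
  | zero =>
    rw [noHit, mul_one]
    congr 1
    refine inter_eq_left.2 fun ω _ l hl hl' => ?_
    omega
  | succ n ih =>
    have hC' : MeasurableSet[past J T (m + 1)] (C ∩ {ω | J m ω = i}) :=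
      past_mono (Nat.le_succ m) _ (hC.inter (measurableSet_J_past le_rfl i))
    set G : S → Set Ω := fun k => if k = j then ∅ else
      C ∩ {ω | J m ω = i} ∩ {ω | J (m + 1) ω = k} ∩
        {ω | ∀ l, m + 1 < l → l ≤ m + 1 + n → J l ω ≠ j} with hG
    have hU : C ∩ {ω | J m ω = i} ∩ {ω | ∀ l, m < l → l ≤ m + (n + 1) → J l ω ≠ j} = ⋃ k, G k := by
      ext ω
      rw [mem_iUnion]
      constructor
      · rintro ⟨h1, h2⟩
        refine ⟨J (m + 1) ω, ?_⟩
        rw [hG]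
        simp only
        rw [if_neg (h2 (m + 1) (by omega) (by omega))]
        exact ⟨⟨h1, rfl⟩, fun l hl hl' => h2 l (by omega) (by omega)⟩
      · rintro ⟨k, hk⟩
        simp only [hG] at hk
        split_ifs at hk with hkj
        · exact absurd hk (notMem_empty _)
        · obtain ⟨⟨h1, h2⟩, h3⟩ := hk
          refine ⟨h1, fun l hl hl' => ?_⟩
          rcases Nat.lt_or_ge (m + 1) l with hlt | hge
          · exact h3 l hlt (by omega)
          · obtain rfl : l = m + 1 := by omega
            rw [show J (m + 1) ω = k from h2]; exact hkj
    have hGm : ∀ k, MeasurableSet (G k) := by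
      intro k
      simp only [hG]
      split_ifs
      · exact MeasurableSet.empty
      · refine ((past_le h _ _ hC').inter (measurableSet_J h _ k)).inter ?_
        have : {ω | ∀ l, m + 1 < l → l ≤ m + 1 + n → J l ω ≠ j} =
            ⋂ l, ⋂ (_ : m + 1 < l), ⋂ (_ : l ≤ m + 1 + n), {ω | J l ω = j}ᶜ := by
          ext ω; simp
        rw [this]
        exact MeasurableSet.iInter fun l => MeasurableSet.iInter fun _ => MeasurableSet.iInter
          fun hl => (measurableSet_J h l j).compl
    have hGd : Pairwise (Function.onFun Disjoint G) := by
      intro k k' hkk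
      refine disjoint_left.2 fun ω hω hω' => hkk ?_
      simp only [hG] at hω hω'
      split_ifs at hω with h1
      · exact absurd hω (notMem_empty _)
      split_ifs at hω' with h2
      · exact absurd hω' (notMem_empty _)
      exact hω.1.2.symm.trans hω'.1.2
    rw [hU, measure_iUnion hGd hGm, noHit, ← ENNReal.tsum_mul_left]
    refine tsum_congr fun k => ?_
    simp only [hG]
    split_ifs
    · simp
    · rw [ih hC' k, measure_transition h hC i k, mul_assoc]

/-- The probability of never visiting `j` from the initial state i is below `noHit` for every n,
whose infimum is 0. -/
lemma ae_exists_visit (hD : D.Admissible) (h : IsChain D μ J T) : ∀ᵐ ω ∂μ, ∃ n, J n ω = j := by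
  rw [ae_iff]
  have hsub : {ω | ¬ ∃ n, J n ω = j} ⊆
      ⋃ i, {ω | J 0 ω = i} ∩ {ω | ∀ l, 0 < l → J l ω ≠ j} := by
    intro ω hω
    simp only [mem_ofPred_eq, not_exists] at hω
    exact mem_iUnion.2 ⟨J 0 ω, rfl, fun l _ => hω l⟩
  refine measure_mono_null hsub (measure_iUnion_null fun i => ?_)
  refine le_antisymm ?_ zero_le
  rw [← iInf_noHit j hD i]
  refine le_iInf fun n => ?_
  have h1 := measure_noHit j h n (C := univ) (m := 0) MeasurableSet.univ i
  rw [univ_inter] at h1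
  calc _ ≤ μ ({ω | J 0 ω = i} ∩ {ω | ∀ l, 0 < l → l ≤ 0 + n → J l ω ≠ j}) :=
        measure_mono fun ω hω => ⟨hω.1, fun l hl _ => hω.2 l hl⟩
    _ = _ := h1
    _ ≤ _ := mul_le_of_le_one_left' prob_le_one

omit [IsProbabilityMeasure μ] [Countable S] in
lemma measurableSet_noVisit (h : IsChain D μ J T) (s : ℝ≥0) :
    MeasurableSet {ω | ∀ n, J n ω = j → s < jumpTime T n ω} := by
  have : {ω | ∀ n, J n ω = j → s < jumpTime T n ω} =
      ⋂ n, ({ω | J n ω = j}ᶜ ∪ {ω | s < jumpTime T n ω}) := by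
    ext ω
    simp only [mem_ofPred_eq, mem_iInter, mem_union, mem_compl_iff, imp_iff_not_or]
  rw [this]
  exact MeasurableSet.iInter fun n => (measurableSet_J h n j).compl.union
    (measurableSet_lt measurable_const (measurable_jumpTime h n))

lemma tendsto_measure_noVisit (hD : D.Admissible) (h : IsChain D μ J T) :
    Tendsto (fun s : ℝ≥0 => μ {ω | ∀ n, J n ω = j → s < jumpTime T n ω}) atTop (𝓝 0) := by
  have h1 := tendsto_measure_iInter_atTop (μ := μ)
    (s := fun s : ℝ≥0 => {ω | ∀ n, J n ω = j → s < jumpTime T n ω})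
    (fun s => (measurableSet_noVisit j h s).nullMeasurableSet)
    (fun s s' hs ω hω n hn => hs.trans_lt (hω n hn)) ⟨0, measure_ne_top _ _⟩
  have h2 : μ (⋂ s : ℝ≥0, {ω | ∀ n, J n ω = j → s < jumpTime T n ω}) = 0 := by
    have := ae_exists_visit j hD h
    rw [ae_iff] at this
    refine measure_mono_null (fun ω hω => ?_) this
    rintro ⟨n, hn⟩
    exact lt_irrefl _ (mem_iInter.1 hω (jumpTime T n ω) n hn)
  rwa [h2] at h1

/-- Tightness of the forward recurrence time: the probability that no entry into `j` falls in
`(s, b]`. -/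
lemma measure_no_visit_between_le (hD : D.Admissible) (h : IsChain D μ J T) (s b : ℝ≥0)
    {φ : ℝ≥0∞} (hφ : ∀ t, Renewal.pot (renewalMeasure D j)
      (Renewal.overshoot (returnLaw D j) (b - s)) t ≤ φ) :
    μ {ω | ∀ n, J n ω = j → jumpTime T n ω ≤ s ∨ b < jumpTime T n ω} ≤
      μ {ω | ∀ n, J n ω = j → s < jumpTime T n ω} + φ := by
  classical
  -- Split by the index m of the first visit to `j` and the index m + n of the last visit not later
  -- than s; after the latter no visit occurs up to b.
  set A : ℕ → Set Ω := fun m => {ω | ∀ l < m, J l ω ≠ j} with hA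
  have hAp : ∀ m, MeasurableSet[past J T m] (A m) := by
    intro m
    have : A m = ⋂ l, ⋂ (_ : l < m), {ω | J l ω = j}ᶜ := by
      ext ω; simp [hA]
    rw [this]
    exact MeasurableSet.iInter fun l => MeasurableSet.iInter fun hl =>
      (measurableSet_J_past hl.le j).compl
  set Q : ℕ → ℕ → Set Ω := fun m n => (A m ∩ {ω | J m ω = j} ∩ {ω | jumpTime T (m + n) ω ≤ s}) ∩
    {ω | J (m + n) ω = j} ∩ {ω | ∀ n', m + n < n' → J n' ω = j → (b : ℝ) < jumpTime T n' ω} with hQ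
  have hsub : ∀ᵐ ω ∂μ, ω ∈ {ω | ∀ n, J n ω = j → jumpTime T n ω ≤ s ∨ b < jumpTime T n ω} →
      ω ∈ {ω | ∀ n, J n ω = j → s < jumpTime T n ω} ∪ ⋃ m, ⋃ n, Q m n := by
    filter_upwards [h.conservative s] with ω hfin hω
    by_cases hno : ∀ n, J n ω = j → s < jumpTime T n ω
    · exact Or.inl hno
    right
    push Not at hno
    obtain ⟨n0, hn0, hn0s⟩ := hno
    have hex : ∃ n, J n ω = j := ⟨n0, hn0⟩
    set m := Nat.find hex
    set V : Set ℕ := {n | J n ω = j ∧ jumpTime T n ω ≤ s}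
    have hVfin : V.Finite := hfin.subset fun n hn => hn.2
    have hN : sSup V ∈ V := Nat.sSup_mem ⟨n0, hn0, hn0s⟩ hVfin.bddAbove
    have hmN : m ≤ sSup V := Nat.find_min' hex hN.1
    refine mem_iUnion.2 ⟨m, mem_iUnion.2 ⟨sSup V - m, ?_⟩⟩
    have hadd : m + (sSup V - m) = sSup V := by omega
    rw [hQ]
    simp only [hadd]
    refine ⟨⟨⟨⟨fun l hl => Nat.find_min hex hl, Nat.find_spec hex⟩, hN.2⟩, hN.1⟩, fun n' hn' hj => ?_⟩
    rcases hω n' hj with h1 | h1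
    · have := le_csSup hVfin.bddAbove (show n' ∈ V from ⟨hj, h1⟩)
      omega
    · exact NNReal.coe_lt_coe.2 h1
  refine (measure_mono_ae hsub).trans ((measure_union_le _ _).trans (add_le_add le_rfl ?_))
  set w := Renewal.overshoot (returnLaw D j) (b - s) with hw
  have hwm : Measurable w := Renewal.measurable_overshoot _ _
  have hQle : ∀ m n, μ (Q m n) ≤ ∫⁻ a, w (s - a) ∂(timeLaw μ J T (A m) m j ∗ occ D j n j) := by
    intro m n
    have hAJ : MeasurableSet[past J T (m + n)] (A m ∩ {ω | J m ω = j}) :=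
      past_mono (Nat.le_add_right m n) _ ((hAp m).inter (measurableSet_J_past le_rfl j))
    have hC : MeasurableSet[past J T (m + n)]
        (A m ∩ {ω | J m ω = j} ∩ {ω | jumpTime T (m + n) ω ≤ s}) :=
      hAJ.inter (measurable_jumpTime_past (J := J) le_rfl measurableSet_Iic)
    -- If the last visit by time s is at time a ≤ s, the next one must be more than b - a later,
    -- which is the overshoot by b - s at age s - a.
    refine (measure_no_return_le j hD h hC b).trans ?_
    rw [← timeLaw_add j h (hAp m) n j]
    have hm : Measurable fun a => returnLaw D j (Ioi (b - a)) := by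
      have : Monotone fun a => returnLaw D j (Ioi (b - a)) := fun x y hxy =>
        measure_mono (Ioi_subset_Ioi (by linarith))
      exact this.measurable
    rw [timeLaw, timeLaw, lintegral_map hm (measurable_jumpTime_real h _),
      lintegral_map (f := fun a => w (s - a)) (hwm.comp (measurable_const.sub measurable_id))
        (measurable_jumpTime_real h _)]
    refine le_trans (setLIntegral_mono' ((past_le h _ _ hC).inter (measurableSet_J h _ j))
      fun ω hω => ?_) (lintegral_mono_set (inter_subset_inter_left _ inter_subset_left))
    have hωs : (jumpTime T (m + n) ω : ℝ) ≤ s := NNReal.coe_le_coe.2 hω.1.2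
    rw [hw, Renewal.overshoot, indicator_of_mem (by rw [mem_Ici]; linarith)]
    exact measure_mono (Ioi_subset_Ioi (by linarith))
  have hdis : ∑' m, μ (A m ∩ {ω | J m ω = j}) ≤ 1 := by
    rw [← measure_iUnion]
    · exact prob_le_one
    · have aux : ∀ m m', m < m' → Disjoint (A m ∩ {ω | J m ω = j}) (A m' ∩ {ω | J m' ω = j}) :=
        fun m m' hmm => disjoint_left.2 fun ω hω hω' => hω'.1 m hmm hω.2
      intro m m' hmm
      rcases lt_or_gt_of_ne hmm with h1 | h1
      · exact aux m m' h1
      · exact (aux m' m h1).symm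
    · exact fun m => (past_le h _ _ (hAp m)).inter (measurableSet_J h m j)
  -- The sum over n is a renewal potential, bounded by φ; the sum over m costs at most 1, because
  -- there is only one first visit.
  calc μ (⋃ m, ⋃ n, Q m n) ≤ ∑' m, ∑' n, μ (Q m n) :=
        (measure_iUnion_le _).trans (ENNReal.tsum_le_tsum fun m => measure_iUnion_le _)
    _ ≤ ∑' m, φ * μ (A m ∩ {ω | J m ω = j}) := by
        refine ENNReal.tsum_le_tsum fun m => ?_
        calc _ ≤ ∑' n, ∫⁻ a, w (s - a) ∂(timeLaw μ J T (A m) m j ∗ occ D j n j) :=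
              ENNReal.tsum_le_tsum fun n => hQle m n
          _ = ∫⁻ a, Renewal.pot (renewalMeasure D j) w (s - a) ∂timeLaw μ J T (A m) m j := by
              rw [← lintegral_sum_measure, ← conv_sum]
              change ∫⁻ a, w (s - a) ∂(timeLaw μ J T (A m) m j ∗ renewalMeasure D j) = _
              rw [Measure.lintegral_conv (f := fun a => w (s - a))
                (hwm.comp (measurable_const.sub measurable_id))]
              simp only [Renewal.pot, sub_sub]
          _ ≤ ∫⁻ _, φ ∂timeLaw μ J T (A m) m j := lintegral_mono fun a => hφ _
          _ = _ := by rw [lintegral_const, timeLaw_univ h]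
    _ ≤ φ := by
        rw [ENNReal.tsum_mul_left]
        exact mul_le_of_le_one_right' hdis

/-! ### Regeneration at the first entry into `j` after time s -/

section Regeneration

variable {B : Set ℝ} {K : ℝ} {l r : ℝ≥0∞} {b t : ℝ≥0}

/-- Since S_m ≤ b ≤ t - K on C, no sojourn before the m-th can cover t, so the regeneration formula
applies, and the potential is evaluated only at times t - a ≥ K, where it lies between l and r. -/
lemma regeneration_past (h : IsChain D μ J T) (hB : MeasurableSet B) (hB0 : B ⊆ Ici 0)
    (hK : 0 ≤ K) (hbt : b + K ≤ t)
    (hpot : ∀ u, K ≤ u → l ≤ Renewal.pot (renewalMeasure D j) (B.indicator (holdTail D j)) u ∧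
      Renewal.pot (renewalMeasure D j) (B.indicator (holdTail D j)) u ≤ r)
    {C : Set Ω} {m : ℕ} (hC : MeasurableSet[past J T m] C) (hCb : ∀ ω ∈ C, jumpTime T m ω ≤ b) :
    l * μ (C ∩ {ω | J m ω = j}) ≤ μ (C ∩ {ω | J m ω = j} ∩ ⋃ k, ageEvent J T j B t k) ∧
      μ (C ∩ {ω | J m ω = j} ∩ ⋃ k, ageEvent J T j B t k) ≤ r * μ (C ∩ {ω | J m ω = j}) := by
  have hU : C ∩ {ω | J m ω = j} ∩ ⋃ k, ageEvent J T j B t k =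
      ⋃ n, C ∩ {ω | J m ω = j} ∩ ageEvent J T j B t (m + n) := by
    ext ω
    simp only [mem_inter_iff, mem_iUnion]
    constructor
    · rintro ⟨⟨hω, hj⟩, k, hk⟩
      have hmk : m ≤ k := by
        by_contra hlt
        have h1 : (jumpTime T (k + 1) ω : ℝ) ≤ jumpTime T m ω :=
          NNReal.coe_le_coe.2 (jumpTime_mono ω (by omega))
        have h2 : (jumpTime T m ω : ℝ) ≤ b := NNReal.coe_le_coe.2 (hCb ω hω)
        have h3 := hk.2.2
        linarith
      exact ⟨k - m, ⟨hω, hj⟩, by rwa [Nat.add_sub_cancel' hmk]⟩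
    · rintro ⟨n, ⟨hω, hj⟩, hn⟩
      exact ⟨⟨hω, hj⟩, m + n, hn⟩
  have hCJ : MeasurableSet (C ∩ {ω | J m ω = j}) := (past_le h _ _ hC).inter (measurableSet_J h m j)
  have hμ : μ (C ∩ {ω | J m ω = j} ∩ ⋃ k, ageEvent J T j B t k) =
      ∫⁻ a, Renewal.pot (renewalMeasure D j) (B.indicator (holdTail D j)) (t - a)
        ∂timeLaw μ J T C m j := by
    rw [hU, measure_iUnion, tsum_measure_inter_ageEvent j h hC hB]
    · intro n n' hnn
      exact (ageEvent_disjoint hB0 (t : ℝ) (fun hc => hnn (by omega))).mono inter_subset_right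
        inter_subset_right
    · exact fun n => hCJ.inter (measurableSet_ageEvent j h hB t _)
  have hae : ∀ᵐ a ∂timeLaw μ J T C m j, a ≤ (b : ℝ) := by
    rw [ae_iff]
    have : {a : ℝ | ¬ a ≤ (b : ℝ)} = Ioi (b : ℝ) := by ext; simp
    rw [this, timeLaw_apply h m j measurableSet_Ioi]
    have : C ∩ {ω | J m ω = j} ∩ {ω | (jumpTime T m ω : ℝ) ∈ Ioi (b : ℝ)} = ∅ := by
      ext ω
      simp only [mem_inter_iff, mem_ofPred_eq, mem_Ioi, mem_empty_iff_false, iff_false]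
      rintro ⟨⟨hω, -⟩, hlt⟩
      exact absurd (NNReal.coe_le_coe.2 (hCb ω hω)) (not_le.2 hlt)
    rw [this, measure_empty]
  rw [hμ, ← timeLaw_univ h, ← lintegral_const, ← lintegral_const]
  constructor
  · refine lintegral_mono_ae ?_
    filter_upwards [hae] with a ha using (hpot _ (by linarith)).1
  · refine lintegral_mono_ae ?_
    filter_upwards [hae] with a ha using (hpot _ (by linarith)).2

/-- Decompose by the step m of the first visit to `j` after s. On {s < S_m} the event E belongs to
the past of step m up to a null set, so each piece regenerates at step m; being first makes the
pieces disjoint. -/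
lemma regeneration_strictPast (h : IsChain D μ J T) (hB : MeasurableSet B) (hB0 : B ⊆ Ici 0)
    (hK : 0 ≤ K) (hbt : b + K ≤ t)
    (hpot : ∀ u, K ≤ u → l ≤ Renewal.pot (renewalMeasure D j) (B.indicator (holdTail D j)) u ∧
      Renewal.pot (renewalMeasure D j) (B.indicator (holdTail D j)) u ≤ r)
    {s : ℝ≥0} {E : Set Ω} (hE : MeasurableSet[strictPast μ J T s] E) :
    l * μ (E ∩ {ω | ∃ n, J n ω = j ∧ s < jumpTime T n ω ∧ jumpTime T n ω ≤ b}) ≤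
      μ (E ∩ {ω | ∃ n, J n ω = j ∧ s < jumpTime T n ω ∧ jumpTime T n ω ≤ b} ∩
        ⋃ k, ageEvent J T j B t k) ∧
    μ (E ∩ {ω | ∃ n, J n ω = j ∧ s < jumpTime T n ω ∧ jumpTime T n ω ≤ b} ∩
        ⋃ k, ageEvent J T j B t k) ≤
      r * μ (E ∩ {ω | ∃ n, J n ω = j ∧ s < jumpTime T n ω ∧ jumpTime T n ω ≤ b}) := by
  classical
  set Φ := ⋃ k, ageEvent J T j B t k
  have hΦ : MeasurableSet Φ := MeasurableSet.iUnion fun k => measurableSet_ageEvent j h hB t k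
  set W : ℕ → Set Ω := fun m => {ω | ∀ n < m, J n ω = j → jumpTime T n ω ≤ s} ∩
    {ω | jumpTime T m ω ≤ b} with hW
  have hWp : ∀ m, MeasurableSet[past J T m] (W m) := by
    intro m
    have : {ω | ∀ n < m, J n ω = j → jumpTime T n ω ≤ s} =
        ⋂ n, ⋂ (_ : n < m), ({ω | J n ω = j}ᶜ ∪ {ω | jumpTime T n ω ≤ s}) := by
      ext ω
      simp only [mem_ofPred_eq, mem_iInter, mem_union, mem_compl_iff, imp_iff_not_or]
    rw [hW]
    simp only [this]
    refine MeasurableSet.inter (MeasurableSet.iInter fun n => MeasurableSet.iInter fun hn => ?_)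
      (measurable_jumpTime_past (J := J) le_rfl measurableSet_Iic)
    exact (measurableSet_J_past hn.le j).compl.union
      (measurable_jumpTime_past (J := J) hn.le measurableSet_Iic)
  set F : ℕ → Set Ω := fun m => E ∩ {ω | s < jumpTime T m ω} ∩ W m ∩ {ω | J m ω = j} with hF
  have hVF : E ∩ {ω | ∃ n, J n ω = j ∧ s < jumpTime T n ω ∧ jumpTime T n ω ≤ b} = ⋃ m, F m := by
    ext ω
    simp only [hF, hW, mem_inter_iff, mem_ofPred_eq, mem_iUnion]
    constructor
    · rintro ⟨hω, n, hj, hs, hb⟩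
      have hex : ∃ n, J n ω = j ∧ s < jumpTime T n ω := ⟨n, hj, hs⟩
      have hfs := Nat.find_spec hex
      refine ⟨Nat.find hex, ⟨⟨hω, hfs.2⟩, fun l hl hlj => ?_, ?_⟩, hfs.1⟩
      · by_contra hcon
        exact Nat.find_min hex hl ⟨hlj, not_le.1 hcon⟩
      · exact (jumpTime_mono ω (Nat.find_min' hex ⟨hj, hs⟩)).trans hb
    · rintro ⟨m, ⟨⟨hω, hs⟩, -, hb⟩, hj⟩
      exact ⟨hω, m, hj, hs, hb⟩
  have hFd : Pairwise (Function.onFun Disjoint F) := by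
    have aux : ∀ m m', m < m' → Disjoint (F m) (F m') := fun m m' hmm =>
      disjoint_left.2 fun ω hω hω' => absurd (hω'.1.2.1 m hmm hω.2) (not_le.2 hω.1.1.2)
    intro m m' hmm
    rcases lt_or_gt_of_ne hmm with h1 | h1
    · exact aux m m' h1
    · exact (aux m' m h1).symm
  have hmain : ∀ m, NullMeasurableSet (F m) μ ∧ l * μ (F m) ≤ μ (F m ∩ Φ) ∧
      μ (F m ∩ Φ) ≤ r * μ (F m) := by
    intro m
    obtain ⟨C, hC, hEC⟩ := hE m
    have hCW : MeasurableSet[past J T m] (C ∩ W m) := hC.inter (hWp m)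
    have hFC : F m =ᵐ[μ] (C ∩ W m ∩ {ω | J m ω = j} : Set Ω) :=
      (hEC.inter (ae_eq_refl _)).inter (ae_eq_refl _)
    have hreg := regeneration_past j h hB hB0 hK hbt hpot hCW fun ω hω => hω.2.2
    refine ⟨NullMeasurableSet.congr ?_ hFC.symm, ?_⟩
    · exact ((past_le h _ _ hCW).inter (measurableSet_J h m j)).nullMeasurableSet
    · rwa [measure_congr hFC, measure_congr (hFC.inter (ae_eq_refl Φ))]
  have hsum : μ (⋃ m, F m) = ∑' m, μ (F m) :=
    measure_iUnion₀ (fun m m' hmm => (hFd hmm).aedisjoint) fun m => (hmain m).1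
  have hsumΦ : μ ((⋃ m, F m) ∩ Φ) = ∑' m, μ (F m ∩ Φ) := by
    rw [iUnion_inter]
    exact measure_iUnion₀ (fun m m' hmm =>
      ((hFd hmm).mono inter_subset_left inter_subset_left).aedisjoint)
      fun m => (hmain m).1.inter hΦ.nullMeasurableSet
  rw [hVF, hsum, hsumΦ, ← ENNReal.tsum_mul_left, ← ENNReal.tsum_mul_left]
  exact ⟨ENNReal.tsum_le_tsum fun m => (hmain m).2.1, ENNReal.tsum_le_tsum fun m => (hmain m).2.2⟩

end Regeneration

end SemiMarkov

/-! ### Asymptotic independence from the strict past -/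

namespace SemiMarkov

section Mixing

variable {S Ω : Type*} [MeasurableSpace S] [MeasurableSpace Ω] {D : Params S}
  {μ : Measure Ω} {J : ℕ → Ω → S} {T : ℕ → Ω → ℝ≥0}
  [DiscreteMeasurableSpace S] [IsProbabilityMeasure μ] [Countable S] (j : S)

/-- Either `j` is not visited before s at all, or the gap straddles s, and the overshoot bound is
uniform in s. -/
lemma tendsto_measure_noVisit_between (hD : D.Admissible) (h : IsChain D μ J T)
    {s b : ℝ≥0 → ℝ≥0} (hs : Tendsto s atTop atTop)
    (hgap : Tendsto (fun t => (b t : ℝ) - s t) atTop atTop) :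
    Tendsto (fun t => μ {ω | ∀ n, J n ω = j → jumpTime T n ω ≤ s t ∨ b t < jumpTime T n ω})
      atTop (𝓝 0) := by
  obtain ⟨φ, hφ, hle⟩ :=
    (isRenewal j hD).tendsto_overshoot (lintegral_tail_returnLaw_ne_top j hD)
  have hlim := ((tendsto_measure_noVisit j hD h).comp hs).add (hφ.comp hgap)
  rw [add_zero] at hlim
  refine tendsto_of_tendsto_of_tendsto_of_le_of_le' tendsto_const_nhds hlim
    (Eventually.of_forall fun _ => zero_le) ?_
  filter_upwards [hgap.eventually_ge_atTop 0] with t ht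
  exact measure_no_visit_between_le j hD h (s t) (b t) (hle _ ht)

/-- The event that the chain is in `j` at time `t`, with age in `B`, becomes independent of the
events determined strictly before the jumps after `s t`, provided `t - s t → ∞`. -/
lemma eventually_ageEvent_mixing (hD : D.Admissible) (h : IsChain D μ J T) {B : Set ℝ}
    (hB : MeasurableSet B) (hB0 : B ⊆ Ici 0) {q : ℝ≥0∞} (hq : q ≠ ∞)
    (hpot : Tendsto (Renewal.pot (renewalMeasure D j) (B.indicator (holdTail D j))) atTop (𝓝 q))
    {s : ℝ≥0 → ℝ≥0} (hs : Tendsto s atTop atTop)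
    (hgap : Tendsto (fun t : ℝ≥0 => (t : ℝ) - s t) atTop atTop) {η : ℝ≥0∞} (hη : η ≠ 0) :
    ∀ᶠ t in atTop, ∀ E, MeasurableSet[strictPast μ J T (s t)] E →
      μ (E ∩ ⋃ k, ageEvent J T j B t k) ≤ q * μ E + η ∧
        q * μ E ≤ μ (E ∩ ⋃ k, ageEvent J T j B t k) + η := by
  have hη2 : η / 2 ≠ 0 := by simpa using hη
  obtain ⟨K₀, hK₀⟩ := eventually_atTop.1 (ENNReal.tendsto_nhds hq |>.1 hpot (η / 2) (by
    exact pos_iff_ne_zero.2 hη2))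
  -- With at least K units of time left the potential is within η/2 of q; hence the entries used for
  -- regeneration are those up to t - K.
  set K : ℝ≥0 := K₀.toNNReal with hKdef
  have hK : ∀ u, (K : ℝ) ≤ u → q - η / 2 ≤
      Renewal.pot (renewalMeasure D j) (B.indicator (holdTail D j)) u ∧
      Renewal.pot (renewalMeasure D j) (B.indicator (holdTail D j)) u ≤ q + η / 2 :=
    fun u hu => hK₀ u ((Real.le_coe_toNNReal K₀).trans hu)
  have hgap' : Tendsto (fun t : ℝ≥0 => ((t - K : ℝ≥0) : ℝ) - s t) atTop atTop := by
    refine tendsto_atTop_mono (fun t => ?_) (tendsto_atTop_add_const_right _ (-(K : ℝ)) hgap)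
    have : (t : ℝ) - K ≤ ((t - K : ℝ≥0) : ℝ) := by
      rw [NNReal.coe_sub_def]; exact le_max_left _ _
    linarith
  have hno := tendsto_measure_noVisit_between j hD h hs hgap'
  have hno1 : ∀ᶠ t in atTop, _ ≤ η / 2 := (hno.eventually_lt_const (pos_iff_ne_zero.2 hη2)).mono
    fun _ => le_of_lt
  have hno2 := ENNReal.Tendsto.const_mul (a := q) hno (Or.inr hq)
  rw [mul_zero] at hno2
  have hno3 : ∀ᶠ t in atTop, _ ≤ η / 2 := (hno2.eventually_lt_const (pos_iff_ne_zero.2 hη2)).mono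
    fun _ => le_of_lt
  filter_upwards [hno1, hno3, eventually_ge_atTop K] with t h1 h2 htK E hE
  obtain ⟨hl, hr⟩ := regeneration_strictPast j h (b := t - K) (t := t) hB hB0 K.coe_nonneg
    (by rw [NNReal.coe_sub htK]; linarith) hK hE
  set Φ := ⋃ k, ageEvent J T j B t k
  set V := {ω | ∃ n, J n ω = j ∧ s t < jumpTime T n ω ∧ jumpTime T n ω ≤ t - K}
  set N := {ω | ∀ n, J n ω = j → jumpTime T n ω ≤ s t ∨ t - K < jumpTime T n ω}
  have hVN : ∀ ω, ω ∈ V ∨ ω ∈ N := fun ω => by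
    by_contra hc
    simp only [V, N, mem_ofPred_eq, not_or, not_forall, not_exists, not_and] at hc
    obtain ⟨hc1, n, hn, hn2, hn3⟩ := hc
    exact hc1 n hn (not_le.1 hn2) (not_lt.1 hn3)
  have hEV : μ (E ∩ V) ≤ μ E := measure_mono inter_subset_left
  have hEV1 : μ (E ∩ V) ≤ 1 := prob_le_one
  constructor
  -- Off N an entry falls in (s, t - K] and regeneration gives the factor q ± η/2; N itself is
  -- negligible, also after multiplication by q.
  · calc μ (E ∩ Φ) ≤ μ (E ∩ V ∩ Φ ∪ N) := measure_mono fun ω hω => by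
          rcases hVN ω with hv | hv
          · exact Or.inl ⟨⟨hω.1, hv⟩, hω.2⟩
          · exact Or.inr hv
      _ ≤ μ (E ∩ V ∩ Φ) + μ N := measure_union_le _ _
      _ ≤ (q + η / 2) * μ (E ∩ V) + η / 2 := add_le_add hr h1
      _ ≤ q * μ E + η / 2 * 1 + η / 2 := by
          rw [add_mul]; gcongr
      _ = q * μ E + η := by rw [mul_one, add_assoc, ENNReal.add_halves]
  · calc q * μ E ≤ q * μ (E ∩ V ∪ N) := by
          gcongr
          intro ω hω
          exact (hVN ω).imp (fun hv => ⟨hω, hv⟩) id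
      _ ≤ q * (μ (E ∩ V) + μ N) := by gcongr; exact measure_union_le _ _
      _ ≤ (q - η / 2 + η / 2) * μ (E ∩ V) + η / 2 := by
          rw [mul_add]; gcongr; exact le_tsub_add
      _ ≤ μ (E ∩ V ∩ Φ) + η / 2 * 1 + η / 2 := by
          rw [add_mul]; gcongr
      _ ≤ μ (E ∩ Φ) + η := by
          rw [mul_one, add_assoc, ENNReal.add_halves]
          gcongr
          exact inter_subset_left

lemma tendsto_measure_ageEvent (hD : D.Admissible) (h : IsChain D μ J T) {B : Set ℝ}
    (hB : MeasurableSet B) (hB0 : B ⊆ Ici 0) {q : ℝ≥0∞} (hq : q ≠ ∞)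
    (hpot : Tendsto (Renewal.pot (renewalMeasure D j) (B.indicator (holdTail D j))) atTop (𝓝 q))
    {s : ℝ≥0 → ℝ≥0} (hs : Tendsto s atTop atTop)
    (hgap : Tendsto (fun t : ℝ≥0 => (t : ℝ) - s t) atTop atTop) :
    Tendsto (fun t : ℝ≥0 => μ (⋃ k, ageEvent J T j B t k)) atTop (𝓝 q) := by
  rw [ENNReal.tendsto_nhds hq]
  intro η hη
  filter_upwards [eventually_ageEvent_mixing j hD h hB hB0 hq hpot hs hgap hη.ne'] with t ht
  obtain ⟨h1, h2⟩ := ht univ (@MeasurableSet.univ _ (strictPast μ J T (s t)))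
  rw [univ_inter, measure_univ, mul_one] at h1 h2
  exact ⟨tsub_le_iff_right.2 h2, h1⟩

end Mixing

/-! ### Portmanteau, tightness and Slutsky's argument -/

section Slutsky

variable {Ω Ω' E ι : Type*} [MeasurableSpace Ω] [MeasurableSpace Ω'] {μ : Measure Ω}
  [IsProbabilityMeasure μ] {ν : Measure Ω'} [IsProbabilityMeasure ν] {l : Filter ι}

lemma eventually_measure_lt_of_isClosed [TopologicalSpace E] [MeasurableSpace E]
    [BorelSpace E] [HasOuterApproxClosed E] {X : ι → Ω → E} {Z : Ω' → E}
    (h : TendstoInDistribution X l Z (fun _ => μ) ν) {F : Set E} (hF : IsClosed F) {c : ℝ≥0∞}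
    (hc : ν (Z ⁻¹' F) < c) : ∀ᶠ i in l, μ (X i ⁻¹' F) < c := by
  have := ProbabilityMeasure.limsup_measure_closed_le_of_tendsto h.tendsto hF
  simp only [ProbabilityMeasure.coe_mk] at this
  rw [Measure.map_apply_of_aemeasurable h.aemeasurable_limit hF.measurableSet] at this
  filter_upwards [eventually_lt_of_limsup_lt (this.trans_lt hc)] with i hi
  rwa [Measure.map_apply_of_aemeasurable (h.forall_aemeasurable i) hF.measurableSet] at hi

/-- The norm of the limit variable is finite, so a large closed exterior {R ≤ ‖z‖} has small
limiting mass; the portmanteau bound for closed sets transfers this along the filter. -/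
lemma exists_norm_bound [NormedAddCommGroup E] [MeasurableSpace E] [BorelSpace E]
    {X : ι → Ω → E} {Z : Ω' → E} (h : TendstoInDistribution X l Z (fun _ => μ) ν)
    {c : ℝ≥0∞} (hc : c ≠ 0) : ∃ R : ℝ, 0 < R ∧ ∀ᶠ i in l, μ {ω | R ≤ ‖X i ω‖} ≤ c := by
  have hZ := h.aemeasurable_limit
  have hlim : Tendsto (fun R : ℝ => (ν.map Z) {z | R ≤ ‖z‖}) atTop (𝓝 0) := by
    have := tendsto_measure_iInter_atTop (μ := ν.map Z) (s := fun R : ℝ => {z : E | R ≤ ‖z‖})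
      (fun R => (isClosed_le continuous_const continuous_norm).measurableSet.nullMeasurableSet)
      (fun a b hab z hz => hab.trans hz) ⟨0, by
        have : IsProbabilityMeasure (ν.map Z) := Measure.isProbabilityMeasure_map hZ
        exact measure_ne_top _ _⟩
    have hempty : ⋂ R : ℝ, {z : E | R ≤ ‖z‖} = ∅ := by
      refine eq_empty_of_forall_notMem fun z hz => ?_
      have := mem_iInter.1 hz (‖z‖ + 1)
      simp only [mem_ofPred_eq] at this
      linarith
    rwa [hempty, measure_empty] at this
  obtain ⟨R, hR, hR0⟩ :=
    ((hlim.eventually_lt_const (pos_iff_ne_zero.2 hc)).and (eventually_gt_atTop 0)).exists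
  refine ⟨R, hR0, ?_⟩
  have hcl : IsClosed {z : E | R ≤ ‖z‖} := isClosed_le continuous_const continuous_norm
  rw [Measure.map_apply_of_aemeasurable hZ hcl.measurableSet] at hR
  exact (eventually_measure_lt_of_isClosed h hcl hR).mono fun i hi => hi.le

/-- In the sup norm the matrix defect contributes at most d · R times its entrywise bound; d + 1 in
the denominator keeps the bound meaningful for d = 0. -/
lemma norm_add_mulVec_sub_lt {d : ℕ} {a x : Fin d → ℝ} {M : Matrix (Fin d) (Fin d) ℝ} {δ R : ℝ}
    (hδ : 0 < δ) (hR : 0 < R) (ha : ‖a‖ < δ / 2)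
    (hM : ∀ i k, ‖M i k - (1 : Matrix (Fin d) (Fin d) ℝ) i k‖ < δ / (2 * (d + 1) * R))
    (hx : ‖x‖ < R) : ‖a + M.mulVec x - x‖ < δ := by
  rw [pi_norm_lt_iff hδ]
  intro i
  have hi : (a + M.mulVec x - x) i =
      a i + ∑ k, (M i k - (1 : Matrix (Fin d) (Fin d) ℝ) i k) * x k := by
    have : x i = ∑ k, (1 : Matrix (Fin d) (Fin d) ℝ) i k * x k := by
      conv_lhs => rw [← Matrix.one_mulVec x]
      rfl
    simp only [Pi.add_apply, Pi.sub_apply, Matrix.mulVec, dotProduct, sub_mul,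
      Finset.sum_sub_distrib]
    rw [← this]; ring
  have hsum : ‖∑ k, (M i k - (1 : Matrix (Fin d) (Fin d) ℝ) i k) * x k‖ ≤ δ / 2 := by
    refine (norm_sum_le _ _).trans ?_
    calc ∑ k, ‖(M i k - (1 : Matrix (Fin d) (Fin d) ℝ) i k) * x k‖
        ≤ ∑ _k : Fin d, δ / (2 * (d + 1) * R) * R := by
          refine Finset.sum_le_sum fun k _ => ?_
          rw [norm_mul]
          exact mul_le_mul (hM i k).le ((norm_le_pi_norm x k).trans hx.le) (norm_nonneg _)
            (by positivity)
      _ = δ / 2 * (d / (d + 1)) := by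
          rw [Finset.sum_const, Finset.card_univ, Fintype.card_fin, nsmul_eq_mul]
          field_simp
      _ ≤ δ / 2 * 1 := by
          gcongr
          rw [div_le_one (by positivity)]
          linarith
      _ = δ / 2 := mul_one _
  rw [hi]
  have := (norm_le_pi_norm a i).trans_lt ha
  linarith [norm_add_le (a i) (∑ k, (M i k - (1 : Matrix (Fin d) (Fin d) ℝ) i k) * x k)]

/-- L² - I is small in probability, and X is tight because it converges in distribution, so (L² -
I)X is small in probability. -/
lemma tendstoInMeasure_add_mulVec_sub {d : ℕ} {X : ι → Ω → Fin d → ℝ} {Z : Ω' → Fin d → ℝ}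
    (h : TendstoInDistribution X l Z (fun _ => μ) ν)
    {L₁ : ι → Ω → Fin d → ℝ} {L₂ : ι → Ω → Matrix (Fin d) (Fin d) ℝ}
    (hL₁ : TendstoInMeasure μ L₁ l (fun _ => 0))
    (hL₂ : ∀ a b, TendstoInMeasure μ (fun t ω => L₂ t ω a b) l
      (fun _ => (1 : Matrix (Fin d) (Fin d) ℝ) a b)) :
    TendstoInMeasure μ (fun t ω => L₁ t ω + (L₂ t ω).mulVec (X t ω) - X t ω) l (fun _ => 0) := by
  rw [tendstoInMeasure_iff_norm] at hL₁ ⊢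
  simp only [sub_zero] at hL₁ ⊢
  intro δ hδ
  rw [ENNReal.tendsto_nhds_zero]
  intro c hc
  have hc2 : c / 2 ≠ 0 := by simpa using hc.ne'
  obtain ⟨R, hR, hXR⟩ := exists_norm_bound h hc2
  set r : ℝ := δ / (2 * (d + 1) * R)
  have hr : 0 < r := by positivity
  have hlim : Tendsto (fun t => μ {ω | δ / 2 ≤ ‖L₁ t ω‖} + ∑ p : Fin d × Fin d,
      μ {ω | r ≤ ‖L₂ t ω p.1 p.2 - (1 : Matrix (Fin d) (Fin d) ℝ) p.1 p.2‖}) l (𝓝 0) := by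
    have := (hL₁ (δ / 2) (by positivity)).add (tendsto_finsetSum (Finset.univ : Finset (Fin d × Fin d))
      fun p _ => (tendstoInMeasure_iff_norm.1 (hL₂ p.1 p.2)) r hr)
    simpa using this
  filter_upwards [hXR, hlim.eventually_lt_const (pos_iff_ne_zero.2 hc2)] with t h1 h2
  calc μ {ω | δ ≤ ‖L₁ t ω + (L₂ t ω).mulVec (X t ω) - X t ω‖}
      ≤ μ (({ω | δ / 2 ≤ ‖L₁ t ω‖} ∪ ⋃ p ∈ (Finset.univ : Finset (Fin d × Fin d)),
          {ω | r ≤ ‖L₂ t ω p.1 p.2 - (1 : Matrix (Fin d) (Fin d) ℝ) p.1 p.2‖}) ∪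
          {ω | R ≤ ‖X t ω‖}) := measure_mono fun ω hω => by
        by_contra hn
        simp only [mem_union, mem_iUnion, mem_ofPred_eq, not_or, not_exists, not_le,
          Finset.mem_univ, Prod.forall, forall_true_left] at hn
        exact absurd hω (not_le.2 (norm_add_mulVec_sub_lt hδ hR hn.1.1 hn.1.2 hn.2))
    _ ≤ c / 2 + c / 2 := (measure_union_le _ _).trans (add_le_add (((measure_union_le _ _).trans
        (add_le_add le_rfl (measure_biUnion_finset_le _ _))).trans h2.le) h1)
    _ = c := ENNReal.add_halves c

end Slutsky

end SemiMarkov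

/-! ### Joint limit of the process and the age event -/

namespace SemiMarkov

section Asymptotics

variable {S Ω Ω' : Type*} [MeasurableSpace S] [MeasurableSpace Ω] [MeasurableSpace Ω']
  {D : Params S} {μ : Measure Ω} {ν : Measure Ω'} {J : ℕ → Ω → S} {T : ℕ → Ω → ℝ≥0}
  [DiscreteMeasurableSpace S] [IsProbabilityMeasure μ] [IsProbabilityMeasure ν] [Countable S]
  (j : S)
  {E : Type*} [NormedAddCommGroup E] [MeasurableSpace E] [BorelSpace E]
  {H X : ℝ≥0 → Ω → E} {Z : Ω' → E} {s : ℝ≥0 → ℝ≥0} {B : Set ℝ} {q : ℝ≥0∞} {A : Set E}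

lemma noVisit_of_lt_hitTime {s : ℝ≥0} {ω : Ω} (hω : ¬ hitTime J T j 0 ω ≤ s) (n : ℕ)
    (hn : J n ω = j) : s < jumpTime T n ω := by
  by_contra hc
  obtain ⟨k, hk⟩ := exists_visitIndex_eq hn
  exact hω (hitTime_le_of_le (Nat.zero_le k) (hitTime_le_iff.2 ⟨n, hn, hk, not_lt.1 hc⟩))

/-- If X_t lies in A and is close to H_{s(t)}, then H_{s(t)} lies in a closed thickening of A. That
event is, with a visit by time s(t), in the strict past, so mixing yields the factor q, and the
portmanteau theorem bounds its probability. -/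
lemma eventually_measure_mem_inter_ageEvent_le (hD : D.Admissible) (h : IsChain D μ J T)
    (hB : MeasurableSet B) (hB0 : B ⊆ Ici 0) (hq : q ≠ ∞)
    (hpot : Tendsto (Renewal.pot (renewalMeasure D j) (B.indicator (holdTail D j))) atTop (𝓝 q))
    (hs : Tendsto s atTop atTop)
    (hgap : Tendsto (fun t : ℝ≥0 => (t : ℝ) - s t) atTop atTop)
    (hH : ∀ t, Measurable[lastVisitHistory μ J T j t] (H t))
    (hHZ : TendstoInDistribution H atTop Z (fun _ => μ) ν)
    (hX : TendstoInMeasure μ (fun t ω => X t ω - H (s t) ω) atTop (fun _ => 0))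
    (A : Set E) {η : ℝ≥0∞} (hη : η ≠ 0) :
    ∀ᶠ t in atTop, μ (X t ⁻¹' A ∩ ⋃ k, ageEvent J T j B t k) ≤ q * ν (Z ⁻¹' closure A) + η := by
  have hη4 : η / 2 / 2 ≠ 0 := by simpa using hη
  have hη8 : η / 2 / 2 / 2 ≠ 0 := by simpa using hη
  have hZ := hHZ.aemeasurable_limit
  have hprob : IsProbabilityMeasure (ν.map Z) := Measure.isProbabilityMeasure_map hZ
  -- Leave some room above the mass of the closure, then shrink the thickening until its mass fits
  -- below c.
  obtain ⟨c, hc, hac⟩ : ∃ c, q * c < q * ν (Z ⁻¹' closure A) + η / 2 ∧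
      ν (Z ⁻¹' closure A) < c := by
    have hcont : Tendsto (fun c => q * c) (𝓝[>] (ν (Z ⁻¹' closure A)))
        (𝓝 (q * ν (Z ⁻¹' closure A))) :=
      (ENNReal.Tendsto.const_mul tendsto_id (Or.inr hq)).mono_left nhdsWithin_le_nhds
    have : (𝓝[>] (ν (Z ⁻¹' closure A))).NeBot := nhdsGT_neBot_of_exists_gt ⟨∞, measure_lt_top _ _⟩
    exact ((hcont.eventually_lt_const (ENNReal.lt_add_right
      (ENNReal.mul_ne_top hq (measure_ne_top _ _)) (by simpa using hη))).and
      self_mem_nhdsWithin).exists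
  obtain ⟨δ, hδc, hδ⟩ : ∃ δ : ℝ, ν (Z ⁻¹' Metric.cthickening δ A) < c ∧ 0 < δ := by
    have hlim := tendsto_measure_cthickening (μ := ν.map Z) (s := A)
      ⟨1, one_pos, measure_ne_top _ _⟩
    rw [Measure.map_apply_of_aemeasurable hZ isClosed_closure.measurableSet] at hlim
    obtain ⟨δ, h1, h2⟩ := (((hlim.eventually_lt_const hac).filter_mono nhdsWithin_le_nhds).and
      (self_mem_nhdsWithin (s := Ioi (0 : ℝ)))).exists
    rw [Measure.map_apply_of_aemeasurable hZ Metric.isClosed_cthickening.measurableSet] at h1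
    exact ⟨δ, h1, h2⟩
  have hF := hs.eventually (eventually_measure_lt_of_isClosed hHZ
    (Metric.isClosed_cthickening (δ := δ) (E := A)) hδc)
  have hnear := (tendstoInMeasure_iff_norm.1 hX) δ hδ
  simp only [sub_zero] at hnear
  have hsmall := ((tendsto_measure_noVisit j hD h).comp hs).add hnear
  rw [add_zero] at hsmall
  filter_upwards [hF, hsmall.eventually_lt_const (pos_iff_ne_zero.2 hη4),
    eventually_ageEvent_mixing j hD h hB hB0 hq hpot hs hgap hη4] with t h1 h2 h3
  set F := Metric.cthickening δ A
  set C := H (s t) ⁻¹' F ∩ {ω | hitTime J T j 0 ω ≤ s t}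
  have hC : MeasurableSet[strictPast μ J T (s t)] C :=
    lastVisitHistory_inter h (hH (s t) Metric.isClosed_cthickening.measurableSet)
  calc μ (X t ⁻¹' A ∩ ⋃ k, ageEvent J T j B t k)
      ≤ μ ((C ∩ ⋃ k, ageEvent J T j B t k) ∪ ({ω | ∀ n, J n ω = j → s t < jumpTime T n ω} ∪
          {ω | δ ≤ ‖X t ω - H (s t) ω‖})) := measure_mono fun ω hω => by
        by_cases hd : δ ≤ ‖X t ω - H (s t) ω‖
        · exact Or.inr (Or.inr hd)
        by_cases hv : hitTime J T j 0 ω ≤ s t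
        · refine Or.inl ⟨⟨Metric.mem_cthickening_of_dist_le _ (X t ω) δ A hω.1 ?_, hv⟩, hω.2⟩
          rw [dist_comm, dist_eq_norm]
          exact (not_le.1 hd).le
        · exact Or.inr (Or.inl (noVisit_of_lt_hitTime j hv))
    _ ≤ (q * μ C + η / 2 / 2) + η / 2 / 2 := (measure_union_le _ _).trans
        (add_le_add (h3 C hC).1 ((measure_union_le _ _).trans h2.le))
    _ ≤ q * c + η / 2 := by
        rw [add_assoc, ENNReal.add_halves]
        gcongr
        exact (measure_mono inter_subset_left).trans h1.le
    _ ≤ q * ν (Z ⁻¹' closure A) + η / 2 + η / 2 := by gcongr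
    _ = q * ν (Z ⁻¹' closure A) + η := by rw [add_assoc, ENNReal.add_halves]

omit [IsProbabilityMeasure ν] in
lemma measure_preimage_closure_le (hA : ν (Z ⁻¹' frontier A) = 0) :
    ν (Z ⁻¹' closure A) ≤ ν (Z ⁻¹' A) := by
  rw [closure_eq_self_union_frontier, preimage_union]
  exact (measure_union_le _ _).trans (by rw [hA, add_zero])

/-- Asymptotic independence of `X t` and of the event that the chain is in `j` at time `t` with
age in `B`. -/
lemma tendsto_measure_mem_inter_ageEvent (hD : D.Admissible) (h : IsChain D μ J T)
    (hB : MeasurableSet B) (hB0 : B ⊆ Ici 0) (hq : q ≠ ∞)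
    (hpot : Tendsto (Renewal.pot (renewalMeasure D j) (B.indicator (holdTail D j))) atTop (𝓝 q))
    (hs : Tendsto s atTop atTop)
    (hgap : Tendsto (fun t : ℝ≥0 => (t : ℝ) - s t) atTop atTop)
    (hH : ∀ t, Measurable[lastVisitHistory μ J T j t] (H t))
    (hHZ : TendstoInDistribution H atTop Z (fun _ => μ) ν)
    (hX : TendstoInMeasure μ (fun t ω => X t ω - H (s t) ω) atTop (fun _ => 0))
    (hA : MeasurableSet A) (hA' : ν (Z ⁻¹' frontier A) = 0) :
    Tendsto (fun t : ℝ≥0 => μ (X t ⁻¹' A ∩ ⋃ k, ageEvent J T j B t k)) atTop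
      (𝓝 (ν (Z ⁻¹' A) * q)) := by
  have hsum : ν (Z ⁻¹' A) + ν (Z ⁻¹' Aᶜ) = 1 := by
    have := measure_add_measure_compl₀ (hHZ.aemeasurable_limit.nullMeasurableSet_preimage hA)
    rwa [measure_univ] at this
  rw [mul_comm, ENNReal.tendsto_nhds (ENNReal.mul_ne_top hq (measure_ne_top _ _))]
  intro η hη
  have hη2 : η / 2 ≠ 0 := by simpa using hη.ne'
  filter_upwards [
    eventually_measure_mem_inter_ageEvent_le j hD h hB hB0 hq hpot hs hgap hH hHZ hX A hη.ne',
    eventually_measure_mem_inter_ageEvent_le j hD h hB hB0 hq hpot hs hgap hH hHZ hX Aᶜ hη2,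
    (ENNReal.tendsto_nhds hq).1 (tendsto_measure_ageEvent j hD h hB hB0 hq hpot hs hgap) (η / 2)
      (pos_iff_ne_zero.2 hη2)] with t h1 h2 h3
  set Φ := ⋃ k, ageEvent J T j B t k
  have h4 : q ≤ μ Φ + η / 2 := tsub_le_iff_right.1 h3.1
  refine ⟨tsub_le_iff_right.2 ?_, h1.trans (by
    exact add_le_add (mul_le_mul_right (measure_preimage_closure_le hA') q) le_rfl)⟩
  -- The lower bound for A comes from the upper bound for its complement, which has the same
  -- boundary, and the convergence of the total mass to q.
  refine (ENNReal.add_le_add_iff_right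
    (ENNReal.mul_ne_top hq (measure_ne_top ν (Z ⁻¹' Aᶜ)))).1 ?_
  calc q * ν (Z ⁻¹' A) + q * ν (Z ⁻¹' Aᶜ) = q := by rw [← mul_add, hsum, mul_one]
    _ ≤ μ ((X t ⁻¹' A ∩ Φ) ∪ (X t ⁻¹' Aᶜ ∩ Φ)) + η / 2 := by
        rw [← union_inter_distrib_right, preimage_compl, union_compl_self, univ_inter]; exact h4
    _ ≤ μ (X t ⁻¹' A ∩ Φ) + (q * ν (Z ⁻¹' Aᶜ) + η / 2) + η / 2 := by
        gcongr
        refine (measure_union_le _ _).trans (add_le_add le_rfl (h2.trans ?_))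
        exact add_le_add (mul_le_mul_right
          (measure_preimage_closure_le (by rwa [frontier_compl])) q) le_rfl
    _ = μ (X t ⁻¹' A ∩ Φ) + η + q * ν (Z ⁻¹' Aᶜ) := by
        nth_rw 3 [← ENNReal.add_halves η]; ring

end Asymptotics

/-! ### The conditional probability as a ratio of age events -/

section Identification

variable {S Ω : Type*} [MeasurableSpace S] [MeasurableSpace Ω]
  {D : Params S} {μ : Measure Ω} {J : ℕ → Ω → S} {T : ℕ → Ω → ℝ≥0}
  [DiscreteMeasurableSpace S] [IsProbabilityMeasure μ] [Countable S] (j : S)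

lemma ae_jumpTime_zero (h : IsChain D μ J T) : ∀ᵐ ω ∂μ, jumpTime T 0 ω = 0 := by
  have hm : ∀ i, MeasurableSet {ω | J 0 ω = i ∧ T 0 ω = 0} := fun i =>
    ((h.measurable_J 0) (MeasurableSet.singleton i)).inter
      ((h.measurable_T 0) (MeasurableSet.singleton 0))
  have hU : μ (⋃ i, {ω | J 0 ω = i ∧ T 0 ω = 0}) = 1 := by
    rw [measure_iUnion (fun a b hab => Set.disjoint_left.2 fun ω h1 h2 => hab (h1.1.symm.trans h2.1))
      hm]
    simp_rw [h.init]
    exact D.init.tsum_coe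
  filter_upwards [(prob_compl_eq_zero_iff (MeasurableSet.iUnion hm)).2 hU |> measure_eq_zero_iff_ae_notMem.1]
    with ω hω
  rw [notMem_compl_iff, mem_iUnion] at hω
  obtain ⟨i, -, hi⟩ := hω
  simpa [jumpTime] using hi

lemma proc_eq_ae (h : IsChain D μ J T) (t : ℝ≥0) :
    {ω | proc J T t ω = j} =ᵐ[μ] ⋃ k, ageEvent J T j (Ici 0) t k := by
  filter_upwards [ae_jumpTime_zero h, h.conservative t] with ω h0 hfin
  exact propext (proc_eq_iff (h0.trans_le (zero_le)) hfin)

lemma proc_and_residual_ae (h : IsChain D μ J T) (t x : ℝ≥0) :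
    {ω | proc J T t ω = j ∧ (x : ℝ≥0∞) < backwardResidual J T j t ω} =ᵐ[μ]
      ⋃ k, ageEvent J T j (Ioi x) t k := by
  filter_upwards [ae_jumpTime_zero h, h.conservative t] with ω h0 hfin
  exact propext (proc_and_residual_iff (h0.trans_le (zero_le)) hfin)

/-- On {Y_t = j} the residual time is the age of the covering sojourn, so almost surely numerator
and denominator are age events for (x,∞) and [0,∞). The latter is measurable outright, which handles
the restriction without measurability of G. -/
lemma cond_proc_apply (h : IsChain D μ J T) (t x : ℝ≥0) (G : Set Ω) :
    cond μ {ω | proc J T t ω = j} {ω | ω ∈ G ∧ (x : ℝ≥0∞) < backwardResidual J T j t ω} =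
      μ (G ∩ ⋃ k, ageEvent J T j (Ioi x) t k) / μ (⋃ k, ageEvent J T j (Ici 0) t k) := by
  have hm : MeasurableSet (⋃ k, ageEvent J T j (Ici 0) t k) :=
    MeasurableSet.iUnion fun k => measurableSet_ageEvent j h measurableSet_Ici t k
  have hP := proc_eq_ae j h t
  rw [ProbabilityTheory.cond, Measure.smul_apply, Measure.restrict_congr_set hP, measure_congr hP,
    Measure.restrict_apply' hm, smul_eq_mul, mul_comm, div_eq_mul_inv]
  congr 1
  refine measure_congr ?_
  filter_upwards [hP, proc_and_residual_ae j h t x] with ω h1 h2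
  refine propext ?_
  have h1' : proc J T t ω = j ↔ ω ∈ ⋃ k, ageEvent J T j (Ici 0) t k := iff_of_eq h1
  have h2' : (proc J T t ω = j ∧ (x : ℝ≥0∞) < backwardResidual J T j t ω) ↔
    ω ∈ ⋃ k, ageEvent J T j (Ioi x) t k := iff_of_eq h2
  change (ω ∈ G ∧ _) ∧ ω ∈ _ ↔ ω ∈ G ∧ ω ∈ _
  rw [← h1', ← h2']
  tauto

end Identification

/-- Eventually ε(t) ≤ t/2, so the truncated subtraction is a true one, t - ε(t) ≥ t/2, and the gap
is ε(t) itself. -/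
lemma tendsto_sub_lag {ε : ℝ≥0 → ℝ≥0} (hε_top : Tendsto ε atTop atTop)
    (hε_div : Tendsto (fun t => ε t / t) atTop (𝓝 0)) :
    Tendsto (fun t => t - ε t) atTop atTop ∧
      Tendsto (fun t : ℝ≥0 => (t : ℝ) - ((t - ε t : ℝ≥0) : ℝ)) atTop atTop := by
  have hhalf : ∀ᶠ t in atTop, ε t ≤ t / 2 := by
    filter_upwards [hε_div.eventually_lt_const (by norm_num : (0 : ℝ≥0) < 1 / 2),
      eventually_gt_atTop 0] with t h1 h2
    rw [div_lt_iff₀ h2] at h1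
    exact h1.le.trans_eq (by ring)
  constructor
  · refine tendsto_atTop_mono' _ (f₁ := fun t : ℝ≥0 => t / 2) ?_ ?_
    · filter_upwards [hhalf] with t ht
      exact le_tsub_of_add_le_right ((add_le_add le_rfl ht).trans_eq (add_halves t))
    · exact tendsto_id.atTop_div_const (by norm_num)
  · refine (NNReal.tendsto_coe_atTop.2 hε_top).congr' ?_
    filter_upwards [hhalf] with t ht
    rw [NNReal.coe_sub (ht.trans (half_le_self zero_le))]
    ring

end SemiMarkov

theorem lemma6p1 {S : Type*} [Countable S] [MeasurableSpace S] [DiscreteMeasurableSpace S]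
    {Ω : Type*} [MeasurableSpace Ω] (μ : Measure Ω) [IsProbabilityMeasure μ]
    {Ω' : Type*} [MeasurableSpace Ω'] (ν : Measure Ω') [IsProbabilityMeasure ν]
    (D : SemiMarkov.Params S) (hD : D.Admissible)
    (J : ℕ → Ω → S) (T : ℕ → Ω → ℝ≥0) (hJT : SemiMarkov.IsChain D μ J T)
    (j : S) (d : ℕ)
    (H : ℝ≥0 → Ω → (Fin d → ℝ)) (Hinf : Ω' → (Fin d → ℝ)) (ε : ℝ≥0 → ℝ≥0)
    (hH : ∀ t, Measurable[SemiMarkov.lastVisitHistory μ J T j t] (H t))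
    (hHinf : TendstoInDistribution H atTop Hinf (fun _ => μ) ν)
    (hε_mono : Monotone ε)
    (hε_top : Tendsto ε atTop atTop)
    (hε_div : Tendsto (fun t => ε t / t) atTop (𝓝 0))
    (hH_sub : TendstoInMeasure μ (fun t ω => H t ω - H (t - ε t) ω) atTop (fun _ => 0))
    (L₁ : ℝ≥0 → Ω → (Fin d → ℝ)) (L₂ : ℝ≥0 → Ω → Matrix (Fin d) (Fin d) ℝ)
    (hL₁_meas : ∀ t, AEMeasurable (L₁ t) μ)
    (hL₂_meas : ∀ t a b, AEMeasurable (fun ω => L₂ t ω a b) μ)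
    (hL₁ : TendstoInMeasure μ L₁ atTop (fun _ => 0))
    (hL₂ : ∀ a b, TendstoInMeasure μ (fun t ω => L₂ t ω a b) atTop
      (fun _ => (1 : Matrix (Fin d) (Fin d) ℝ) a b))
    (A : Set (Fin d → ℝ)) (hA : MeasurableSet A) (hA_bdry : ν {ω | Hinf ω ∈ frontier A} = 0)
    (x : ℝ≥0) :
    Tendsto
      (fun t : ℝ≥0 => cond μ {ω | SemiMarkov.proc J T t ω = j}
        {ω | L₁ t ω + (L₂ t ω).mulVec (H t ω) ∈ A ∧
          (x : ℝ≥0∞) < SemiMarkov.backwardResidual J T j t ω})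
      atTop (𝓝 (ν {ω | Hinf ω ∈ A} * D.residualTail j x)) := by
  obtain ⟨hs, hgap⟩ := SemiMarkov.tendsto_sub_lag hε_top hε_div
  set X : ℝ≥0 → Ω → (Fin d → ℝ) := fun t ω => L₁ t ω + (L₂ t ω).mulVec (H t ω)
  -- Triangle inequality through H_t: Slutsky for the first difference, the hypothesis on increments
  -- for the second.
  have hX : TendstoInMeasure μ (fun t ω => X t ω - H (t - ε t) ω) atTop (fun _ => 0) := by
    have hXH := SemiMarkov.tendstoInMeasure_add_mulVec_sub hHinf hL₁ hL₂
    rw [tendstoInMeasure_iff_norm] at hXH hH_sub ⊢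
    simp only [sub_zero] at hXH hH_sub ⊢
    intro δ hδ
    have hlim := (hXH (δ / 2) (half_pos hδ)).add (hH_sub (δ / 2) (half_pos hδ))
    rw [add_zero] at hlim
    refine tendsto_of_tendsto_of_tendsto_of_le_of_le tendsto_const_nhds hlim (fun _ => zero_le)
      fun t => (measure_mono fun ω hω => ?_).trans (measure_union_le _ _)
    by_contra hn
    simp only [mem_union, mem_ofPred_eq, not_or, not_le] at hn hω
    have := norm_sub_le_norm_sub_add_norm_sub (X t ω) (H t ω) (H (t - ε t) ω)
    linarith [hn.1, hn.2]
  have hm0 : ∫⁻ u, Renewal.tail (SemiMarkov.returnLaw D j) u ≠ 0 :=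
    (SemiMarkov.isRenewal j hD).lintegral_tail_ne_zero
  have hmT := SemiMarkov.lintegral_tail_returnLaw_ne_top j hD
  set m := ∫⁻ u, Renewal.tail (SemiMarkov.returnLaw D j) u
  have hS0 := SemiMarkov.meanSojourn_ne_zero j hD
  have hST := SemiMarkov.meanSojourn_ne_top j hD
  have hnum := SemiMarkov.tendsto_measure_mem_inter_ageEvent j hD hJT measurableSet_Ioi
    (fun y hy => x.coe_nonneg.trans (le_of_lt hy))
    (ENNReal.div_ne_top (ne_top_of_le_ne_top hST (SemiMarkov.meanBeyond_le D j x)) hm0)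
    (SemiMarkov.tendsto_pot_holdTail_Ioi j hD x) hs hgap hH hHinf hX hA hA_bdry
  have hden := SemiMarkov.tendsto_measure_ageEvent j hD hJT measurableSet_Ici subset_rfl
    (ENNReal.div_ne_top hST hm0) (SemiMarkov.tendsto_pot_holdTail_Ici j hD) hs hgap
  have hlim := ENNReal.Tendsto.div hnum (Or.inr (ENNReal.div_ne_zero.2 ⟨hS0, hmT⟩)) hden
    (Or.inl (ENNReal.div_ne_top hST hm0))
  -- The mean return time m is nonzero and finite and cancels, leaving the residual tail.
  have hval : ν (Hinf ⁻¹' A) * (SemiMarkov.meanBeyond D j x / m) / (D.meanSojourn j / m) =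
      ν {ω | Hinf ω ∈ A} * D.residualTail j x := by
    rw [mul_div_assoc, div_eq_mul_inv _ m, div_eq_mul_inv _ m, ENNReal.mul_div_mul_right _ _
      (ENNReal.inv_ne_zero.2 hmT) (ENNReal.inv_ne_top.2 hm0)]
    rfl
  rw [hval] at hlim
  exact hlim.congr fun t => (SemiMarkov.cond_proc_apply j hJT t x (X t ⁻¹' A)).symm
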